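/- All simplicial complexes are finite and geometric, with geometric carrier $\|\Delta\|\subset\mathbb{R}^N$, and $\emptyset$ counts as a simplex of dimension $-1$, with $\mathrm{lk}(\emptyset,\Delta)=\Delta$. A *normal $d$-pseudomanifold* is a pure $d$-dimensional simplicial complex in which every $(d-1)$-simplex lies in exactly two facets and the link of every simplex of codimension at least two is connected (in particular, for $d\ge 1$, $\Delta$ is connected). It is *balanced* if its vertices are coloured by $\kappa:V(\Delta)\to\{0,\dots,d\}$ such that no simplex has two vertices of the same colour. For a set $S$ of colours, $\Delta_S$ is the subcomplex of all simplices with all colours in $S$, $f_S$ is the number of simplices whose set of colours is exactly $S$, and for $S=\{p,q\}$ with $p\ne q$ put $\Gamma_S=f_{\{p,q\}}-f_{\{p\}}-f_{\{q\}}$. The rank $m(\Delta)$ is the least number of generators of $\pi_1(\|\Delta\|)$. A *PL $d$-manifold* is a complex, pure of dimension $d$, in which the link of every nonempty simplex of dimension $k<d$ is a PL $(d-k-1)$-sphere. A *PL sphere* (*PL ball*) is a complex or polyhedron that is PL homeomorphic to the boundary of a simplex (to a simplex). A *theta graph* is the union of three distinct paths between two vertices $a\neq b$ that pairwise meet only in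 $a$ and $b$. **Lemma.** Let $\Delta$ be a balanced normal $d$-pseudomanifold and let $S$ be a two-element set of colours with $\Gamma_S=1$. 1. $m(\Delta)=0$, and $\Delta_S$ is a theta graph. 2. If $\Delta$ is moreover a PL $d$-manifold, then $\Delta$ is a PL $d$-sphere; in particular $\|\Delta\|\cong\mathbb{S}^d$. Let $\Delta_S$ be the union of paths $P_1,P_2,P_3$ from $a$ to $b$ as in the definition of a theta graph, in any order. Then all edges of $P_i$ have the same link $L_i$ in $\Delta$, and $L_1,L_2,L_3$ are three distinct PL $(d-2)$-spheres. If $P_i$ is the single edge $ab$, subdivide it at its midpoint (this happens for at most one $i$); let $a_i$ and $b_i$ be the points following $a$ and preceding $b$ on the (subdivided) path $P_i$, let $P_i'$ be the part of $P_i$ from $a_i$ to $b_i$ (possibly a point), and put $$B_a=\bigcup_{i=1}^3 aa_i\star L_i,\qquad B_b=\bigcup_{i=1}^3 b_ib\star L_i,\qquad M_i=P_i'\star L_i,\qquad U_k=B_a\cup M_1\cup\dots\cup M_k .$$ Here $B_a=\mathrm{st}(a,\Delta)$ and $B_b=\mathrm{st}(b,\Delta)$ if $a,b$ are not adjacent.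 Then $\|\Delta\|=U_3\cup B_b$, and * for $0\le k\le 3$, $U_k$ is a PL $d$-ball with boundary $\bigcup_{i\le k}b_i\star L_i\cup\bigcup_{i>k}a_i\star L_i$; * for $1\le k\le 3$, $U_{k-1}\cap M_k=a_k\star L_k$ is a PL $(d-1)$-ball with boundary $L_k$; if $a_k\neq b_k$, then $M_k$ is a PL $d$-ball with boundary $\{a_k,b_k\}\star L_k$, and if $a_k=b_k$, then $M_k=a_k\star L_k$; * $B_b$ is a PL $d$-ball with boundary $\bigcup_{i=1}^3 b_i\star L_i$, which is also the boundary of $U_3$ and equals $U_3\cap B_b$. -/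

import Mathlib

namespace BalancedComplex

/-! ### Simplicial complexes

Mathlib's geometric simplicial complexes do not list the empty simplex among their faces; it is
added by hand in `IsSimplex`. -/

section Complexes

variable {E : Type*} [AddCommGroup E] [Module ℝ E]

/-- The simplices of `Δ`, including the empty one (of dimension `-1`). A simplex with vertex set
`σ` has dimension `σ.card - 1`. -/
def IsSimplex (Δ : Geometry.SimplicialComplex ℝ E) (σ : Finset E) : Prop :=
  σ = ∅ ∨ σ ∈ Δ.faces

/-- The subcomplex of `Δ` whose faces are the faces satisfying a property `Q` that passes to
subsets. -/
def subcomplex (Δ : Geometry.SimplicialComplex ℝ E) (Q : Finset E → Prop)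
    (hQ : ∀ s t, t ⊆ s → Q s → Q t) : Geometry.SimplicialComplex ℝ E where
  faces := {s | s ∈ Δ.faces ∧ Q s}
  isRelLowerSet_faces := fun _ hs =>
    ⟨Δ.nonempty_of_mem_faces hs.1, fun _ hts ht =>
      ⟨Δ.down_closed hs.1 hts ht, hQ _ _ hts hs.2⟩⟩
  indep := fun hs => Δ.indep hs.1
  inter_subset_convexHull := fun hs ht => Δ.inter_subset_convexHull hs.1 ht.1

open Classical in
/-- The star of the simplex `σ`: all `α ∈ Δ` such that `α ∪ σ` spans a simplex of `Δ`. -/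
def starComplex (Δ : Geometry.SimplicialComplex ℝ E) (σ : Finset E) : Geometry.SimplicialComplex ℝ E :=
  subcomplex Δ (fun α => IsSimplex Δ (α ∪ σ)) (by
    intro s t hts hs
    rcases (t ∪ σ).eq_empty_or_nonempty with h | h
    · exact Or.inl h
    · rcases hs with hs | hs
      · exact Or.inl (Finset.subset_empty.1 (hs ▸ Finset.union_subset_union_left hts))
      · exact Or.inr (Δ.down_closed hs (Finset.union_subset_union_left hts) h))

/-- The link of the simplex `σ`: all `γ ∈ Δ` disjoint from `σ` such that `γ ∪ σ` spans a simplex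
of `Δ`. The link of the empty simplex is `Δ`. -/
def linkComplex (Δ : Geometry.SimplicialComplex ℝ E) (σ : Finset E) : Geometry.SimplicialComplex ℝ E :=
  subcomplex (starComplex Δ σ) (fun γ => Disjoint γ σ) (fun _ _ hts hs => hs.mono_left hts)

/-- The graph (1-skeleton) of a complex, on its set of vertices. -/
def graph (Δ : Geometry.SimplicialComplex ℝ E) : SimpleGraph Δ.vertices where
  Adj u v := u ≠ v ∧ ∃ σ ∈ Δ.faces, (u : E) ∈ σ ∧ (v : E) ∈ σ
  symm := ⟨fun _ _ h => ⟨h.1.symm, by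
    obtain ⟨σ, hσ, hu, hv⟩ := h.2
    exact ⟨σ, hσ, hv, hu⟩⟩⟩
  loopless := ⟨fun _ h => h.1 rfl⟩

/-- `Δ` is pure of dimension `d`. -/
def IsPure (d : ℕ) (Δ : Geometry.SimplicialComplex ℝ E) : Prop :=
  Δ.faces.Nonempty ∧ ∀ σ ∈ Δ.facets, σ.card = d + 1

/-- `κ` is a colouring of the vertices by the colours `0, …, d` for which no simplex has two
vertices of the same colour. (Only the values of `κ` at vertices matter.) A `d`-dimensional complex
is balanced if it has such a colouring. -/
def IsBalancedColoring {d : ℕ} (Δ : Geometry.SimplicialComplex ℝ E) (κ : E → Fin (d + 1)) : Prop :=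
  ∀ σ ∈ Δ.faces, Set.InjOn κ (σ : Set E)

/-- The rank-selected subcomplex `Δ_S`. -/
def rankSelected {d : ℕ} (Δ : Geometry.SimplicialComplex ℝ E) (κ : E → Fin (d + 1))
    (S : Finset (Fin (d + 1))) : Geometry.SimplicialComplex ℝ E :=
  subcomplex Δ (fun σ => ∀ v ∈ σ, κ v ∈ S) (fun _ _ hts hs v hv => hs v (hts hv))

/-- The flag `f`-number `f_S`, for nonempty `S`. -/
noncomputable def flagF {d : ℕ} (Δ : Geometry.SimplicialComplex ℝ E) (κ : E → Fin (d + 1))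
    (S : Finset (Fin (d + 1))) : ℕ :=
  {σ : Finset E | σ ∈ Δ.faces ∧ σ.image κ = S}.ncard

/-- `Γ_S = f_{p,q} - f_{p} - f_{q}` for `S = {p, q}`. -/
noncomputable def Gam {d : ℕ} (Δ : Geometry.SimplicialComplex ℝ E) (κ : E → Fin (d + 1))
    (p q : Fin (d + 1)) : ℤ :=
  (flagF Δ κ {p, q} : ℤ) - (flagF Δ κ {p} : ℤ) - (flagF Δ κ {q} : ℤ)

end Complexes

/-! ### Theta graphs -/

/-- The graph `G` is a theta graph with branch vertices `a`, `b` and branches `P 0`, `P 1`, `P 2`: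
three distinct paths from `a` to `b` that pairwise meet only in `a` and `b` and together make up
all of `G`. -/
structure IsTheta {V : Type*} (G : SimpleGraph V) (a b : V) (P : Fin 3 → G.Path a b) : Prop where
  ne : a ≠ b
  injective : Function.Injective P
  inter : ∀ i j, i ≠ j → ∀ v, v ∈ (P i).1.support → v ∈ (P j).1.support → v = a ∨ v = b
  vertices : ∀ v, ∃ i, v ∈ (P i).1.support
  edges : ∀ e ∈ G.edgeSet, ∃ i, e ∈ (P i).1.edges

/-! ### The rank of a group -/

/-- The least number of elements of a generating set (`⊤` if no finite set generates). -/
noncomputable def groupRank (G : Type*) [Group G] : ℕ∞ :=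
  ⨅ (s : Set G) (_ : Subgroup.closure s = ⊤), s.encard

/-! ### Piecewise linear balls and spheres -/

section PL

variable {E : Type*} [NormedAddCommGroup E] [NormedSpace ℝ E]
variable {F : Type*} [NormedAddCommGroup F] [NormedSpace ℝ F]

/-- A map `f : X → Y` is piecewise linear if `X` is the union of finitely many convex polytopes,
on each of which `f` is the restriction of an affine map. (In particular `X` is a compact
polyhedron. If `f` is a homeomorphism, its inverse is then piecewise linear as well.) -/
def IsPL {X : Set E} {Y : Set F} (f : X → Y) : Prop :=
  ∃ T : Finset (Finset E), (⋃ s ∈ T, convexHull ℝ (s : Set E)) = X ∧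
    ∀ s ∈ T, ∃ A : E →ᵃ[ℝ] F, ∀ x : X, (x : E) ∈ convexHull ℝ (s : Set E) → (f x : F) = A x

/-- The boundary of the standard `n`-simplex in `ℝ^(n+1)`. -/
def simplexBoundary (n : ℕ) : Set (Fin (n + 1) → ℝ) :=
  {x | x ∈ stdSimplex ℝ (Fin (n + 1)) ∧ ∃ i, x i = 0}

/-- `X` is a PL `n`-sphere: it is PL homeomorphic to the boundary of an `(n+1)`-simplex. -/
def IsPLSphere (n : ℕ) (X : Set E) : Prop :=
  ∃ f : X ≃ₜ simplexBoundary (n + 1), IsPL f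

/-- `X` is a PL `n`-ball with boundary `Y`: there is a PL homeomorphism of `X` onto an `n`-simplex
that takes `Y` onto the boundary of the simplex. -/
def IsPLBall (n : ℕ) (X Y : Set E) : Prop :=
  Y ⊆ X ∧ ∃ f : X ≃ₜ stdSimplex ℝ (Fin (n + 1)), IsPL f ∧
    ∀ x : X, (x : E) ∈ Y ↔ (f x : Fin (n + 1) → ℝ) ∈ simplexBoundary n

/-- Normal `d`-pseudomanifolds (finite complexes). A simplex with vertex set `σ` has codimension
`d + 1 - σ.card`. -/
structure IsNormalPseudomanifold (d : ℕ) (Δ : Geometry.SimplicialComplex ℝ E) : Prop where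
  finite : Δ.faces.Finite
  pure : IsPure d Δ
  ridge : ∀ σ, IsSimplex Δ σ → σ.card = d → {τ | τ ∈ Δ.facets ∧ σ ⊆ τ}.ncard = 2
  link_connected : ∀ σ, IsSimplex Δ σ → σ.card + 2 ≤ d + 1 → IsConnected (linkComplex Δ σ).space

/-- `Δ` is a (closed, not necessarily connected) PL `d`-manifold: a finite pure `d`-dimensional
complex in which the link of every nonempty simplex of dimension `k < d` is a PL
`(d - k - 1)`-sphere. -/
structure IsPLManifold (d : ℕ) (Δ : Geometry.SimplicialComplex ℝ E) : Prop where
  finite : Δ.faces.Finite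
  pure : IsPure d Δ
  link_sphere : ∀ σ ∈ Δ.faces, σ.card ≤ d → IsPLSphere (d - σ.card) (linkComplex Δ σ).space

/-! ### The decomposition into balls

`a` and `b` are vertices of a subcomplex `K` of `Δ` and `P 0`, `P 1`, `P 2` are paths from `a` to
`b` in the graph of `K`. If a path consists of the single edge `ab`, it is subdivided at the
midpoint of that edge, so that all three (subdivided) paths have length at least two. The geometric
carrier of a join of two nonempty complexes inside `Δ` is the `convexJoin` of their carriers. -/

section Decomposition

variable (Δ : Geometry.SimplicialComplex ℝ E) {K : Geometry.SimplicialComplex ℝ E}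
  {a b : K.vertices} (P : Fin 3 → (graph K).Path a b)

open Classical in
/-- The link in `Δ` of the first edge of the `i`-th path. -/
noncomputable def branchLink (i : Fin 3) : Geometry.SimplicialComplex ℝ E :=
  linkComplex Δ {(a : E), ((P i).1.snd : E)}

/-- The point that follows `a` on the `i`-th (subdivided) path. -/
noncomputable def firstPt (i : Fin 3) : E :=
  if (P i).1.length = 1 then midpoint ℝ (a : E) (b : E) else ((P i).1.snd : E)

/-- The point that precedes `b` on the `i`-th (subdivided) path. -/
noncomputable def lastPt (i : Fin 3) : E :=
  if (P i).1.length = 1 then midpoint ℝ (a : E) (b : E) else ((P i).1.penultimate : E)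

/-- The arc of the `i`-th (subdivided) path from `firstPt` to `lastPt`. -/
noncomputable def innerArc (i : Fin 3) : Set E :=
  {firstPt P i} ∪ ⋃ j ∈ {j : ℕ | 1 ≤ j ∧ j + 1 < (P i).1.length},
    segment ℝ ((P i).1.getVert j : E) ((P i).1.getVert (j + 1) : E)

/-- The union of the joins of the first segments of the three paths with the links of these. -/
noncomputable def startBall : Set E :=
  ⋃ i, convexJoin ℝ (segment ℝ (a : E) (firstPt P i)) (branchLink Δ P i).space

/-- The union of the joins of the last segments of the three paths with the links of these. -/
noncomputable def endBall : Set E :=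
  ⋃ i, convexJoin ℝ (segment ℝ (lastPt P i) (b : E)) (branchLink Δ P i).space

/-- The join of the `i`-th inner arc with the link that belongs to the `i`-th path. -/
noncomputable def middlePiece (i : Fin 3) : Set E :=
  convexJoin ℝ (innerArc P i) (branchLink Δ P i).space

/-- The union of `startBall` and the first `k` middle pieces. -/
noncomputable def partialUnion (k : ℕ) : Set E :=
  startBall Δ P ∪ ⋃ i ∈ {i : Fin 3 | (i : ℕ) < k}, middlePiece Δ P i

/-- The boundary of `partialUnion k`: cones over the links, with apex `lastPt` for the first `k`
paths and apex `firstPt` for the others. -/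
noncomputable def partialBoundary (k : ℕ) : Set E :=
  ⋃ i : Fin 3, convexJoin ℝ {if (i : ℕ) < k then lastPt P i else firstPt P i}
    (branchLink Δ P i).space

open Classical in
/-- The carrier of `Δ` is put together from `startBall`, the three middle pieces and `endBall`,
which are glued in this order along balls in their boundaries, the last one along its whole
boundary. -/
structure IsBallDecomposition (d : ℕ) : Prop where
  /-- all edges of the `i`-th path have the same link -/
  link_eq : ∀ i, ∀ u v : K.vertices, s(u, v) ∈ (P i).1.edges →
    linkComplex Δ {(u : E), (v : E)} = branchLink Δ P i
  /-- the links are three distinct PL spheres of dimension `d - 2` -/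
  link_sphere : ∀ i, IsPLSphere (d - 2) (branchLink Δ P i).space
  link_injective : Function.Injective (branchLink Δ P)
  /-- the carrier of `Δ` is the union of the pieces -/
  union_eq : partialUnion Δ P 3 ∪ endBall Δ P = Δ.space
  /-- if `a` and `b` are not adjacent, the first and the last piece are the stars of `a` and `b` -/
  star_start : ¬ (graph K).Adj a b → startBall Δ P = (starComplex Δ {(a : E)}).space
  star_end : ¬ (graph K).Adj a b → endBall Δ P = (starComplex Δ {(b : E)}).space
  /-- the first piece, and its union with one, two or three middle pieces, is a `d`-ball -/
  partial_ball : ∀ k ≤ 3, IsPLBall d (partialUnion Δ P k) (partialBoundary Δ P k)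
  /-- a middle piece is a `d`-ball, or is reduced to the `(d-1)`-ball along which it is glued -/
  middle_ball : ∀ i, firstPt P i ≠ lastPt P i → IsPLBall d (middlePiece Δ P i)
    (convexJoin ℝ {firstPt P i, lastPt P i} (branchLink Δ P i).space)
  middle_degenerate : ∀ i, firstPt P i = lastPt P i →
    middlePiece Δ P i = convexJoin ℝ {firstPt P i} (branchLink Δ P i).space
  /-- each middle piece meets the union of the preceding ones in a `(d-1)`-ball, which lies in the
  boundary of both by the form of these boundaries -/
  glue : ∀ i : Fin 3, partialUnion Δ P i ∩ middlePiece Δ P i =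
    convexJoin ℝ {firstPt P i} (branchLink Δ P i).space
  glue_ball : ∀ i, IsPLBall (d - 1) (convexJoin ℝ {firstPt P i} (branchLink Δ P i).space)
    (branchLink Δ P i).space
  /-- the last piece is a `d`-ball, and it meets the union of the others in the common boundary -/
  end_ball : IsPLBall d (endBall Δ P) (partialBoundary Δ P 3)
  glue_end : partialUnion Δ P 3 ∩ endBall Δ P = partialBoundary Δ P 3

end Decomposition

end PL

end BalancedComplex

open BalancedComplex

/-! Combinatorial part. Write `S = {p, q}`. In a balanced normal pseudomanifold a vertex of a facet
can be exchanged, across the opposite ridge, for another vertex of the same colour. Hence every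
vertex of the graph of `Δ_S` has degree at least two. Facets can be joined by steps that change one
vertex only, so consecutive facets share a vertex with colour in `S`, and the graph is connected.
Label each edge by its link in `Δ`. At a vertex of degree two an exchange must swap the two edges,
so their labels agree (`link_eq_of_two_neighbors`). If two edges at a vertex have the same label,
the facets containing one of them are closed under crossing ridges that contain the vertex; since
the star is connected through such ridges, there is no third edge (`eq_or_eq_of_link_eq`).

The condition `Γ_S = 1` says that the numbers `deg v - 2` add up to `2`. This leaves theta graphs,
two cycles with a common vertex, and two cycles joined by a path. A cycle returning to a branch
vertex through vertices of degree two would give two equally labelled edges there, so only theta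
graphs survive (`exists_isTheta`).

Every facet contains exactly one edge of `Δ_S`. Therefore `Δ` is the union of the joins of the three
paths with their common edge links, and points have join coordinates that are unique up to the
evident identifications (`ArcSystem.joinPoint_eq_iff`). The structure `ArcSystem` records this
description, on which the topology rests.

Topological part. The complement of an end of the theta graph contracts to the other end: push
radially away from the removed end, slide along the arcs, then shrink the link coordinate. The
complements of the two ends form an open cover with path connected intersection, so the carrier is
simply connected and the rank is `0` (`ArcSystem.simplyConnectedSpace`).

Piecewise linear part. In a PL manifold the star of a vertex is the cone over a PL sphere, hence a
PL ball. Reparametrising arcs respects the identifications, so joins of initial segments of all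
three arcs are PL homeomorphic to the star of `a`, joins of final segments to the star of `b`, and
the join of a segment of one arc with at least two edges to the star of an inner vertex
(`ArcSystem.exists_plBij`). Cutting each arc at an interior point exhibits `Δ` as two balls with
common boundary, that is, a PL sphere (`isPLSphere_union`). The balls of the decomposition are the
same joins for particular cutting parameters. -/

namespace PLTopology

open Set Filter Topology

/-! ### Convex polytopes: intersections, relative interior, affine maps. -/

section Polytopes

variable {E F G : Type*} [NormedAddCommGroup E] [NormedSpace ℝ E]
  [NormedAddCommGroup F] [NormedSpace ℝ F] [NormedAddCommGroup G] [NormedSpace ℝ G]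

/-- A compact polyhedron in standard form is the convex hull of a finite set. -/
theorem exists_finset_convexHull_eq_standardForm {ι : Type*} [Fintype ι]
    (M : (ι → ℝ) →ₗ[ℝ] F) (b : F) (hc : IsCompact {x : ι → ℝ | (∀ i, 0 ≤ x i) ∧ M x = b}) :
    ∃ t : Finset (ι → ℝ), convexHull ℝ (t : Set (ι → ℝ)) = {x | (∀ i, 0 ≤ x i) ∧ M x = b} := by
  classical
  set P : Set (ι → ℝ) := {x | (∀ i, 0 ≤ x i) ∧ M x = b} with hP
  have hconv : Convex ℝ P := by
    intro x hx y hy r s hr hs hrs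
    refine ⟨fun i => ?_, ?_⟩
    · have := hx.1 i
      have := hy.1 i
      simp only [Pi.add_apply, Pi.smul_apply, smul_eq_mul]
      positivity
    · rw [map_add, map_smul, map_smul, hx.2, hy.2, ← add_smul, hrs, one_smul]
  have hfin : (P.extremePoints ℝ).Finite := by
    refine Set.Finite.of_finite_image (f := fun x : ι → ℝ => Finset.univ.filter (fun i => x i = 0))
      (Set.toFinite _) ?_
    intro x hx y hy hxy
    by_contra hne
    beta_reduce at hxy
    have hsupp : ∀ i, x i = 0 → y i = 0 := by
      intro i hi
      have : i ∈ Finset.univ.filter (fun i => y i = 0) := by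
        rw [← hxy]
        simpa using hi
      simpa using this
    have hxP := hx.1
    -- An extreme point is determined by its set of zero coordinates: if `y` vanishes wherever `x`
    -- does, then both `x + ε (y - x)` and `x - ε (y - x)` stay nonnegative for small `ε`, so `x` is
    -- not extreme unless `y = x`. There are only finitely many zero sets.
    have hev : ∀ᶠ ε in 𝓝[>] (0 : ℝ), ∀ i, ε * |y i - x i| ≤ x i := by
      rw [Filter.eventually_all]
      intro i
      by_cases hi : x i = 0
      · filter_upwards with ε
        simp [hi, hsupp i hi]
      · have hpos : 0 < x i := lt_of_le_of_ne (hxP.1 i) (Ne.symm hi)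
        have : Tendsto (fun ε : ℝ => ε * |y i - x i|) (𝓝[>] 0) (𝓝 (0 * |y i - x i|)) :=
          (tendsto_nhdsWithin_of_tendsto_nhds tendsto_id).mul_const _
        rw [zero_mul] at this
        exact (this.eventually (gt_mem_nhds hpos)).mono fun _ h => h.le
    obtain ⟨ε, hε, hε0⟩ := (hev.and self_mem_nhdsWithin).exists
    have hε0 : (0 : ℝ) < ε := hε0
    have hM : M (y - x) = 0 := by rw [map_sub, hy.1.2, hxP.2, sub_self]
    have h1 : x + ε • (y - x) ∈ P := by
      refine ⟨fun i => ?_, by rw [map_add, map_smul, hM, smul_zero, add_zero, hxP.2]⟩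
      have := hε i
      have h2 := mul_le_mul_of_nonneg_left (neg_abs_le (y i - x i)) hε0.le
      simp only [Pi.add_apply, Pi.smul_apply, Pi.sub_apply, smul_eq_mul]
      linarith
    have h2 : x - ε • (y - x) ∈ P := by
      refine ⟨fun i => ?_, by rw [map_sub, map_smul, hM, smul_zero, sub_zero, hxP.2]⟩
      have := hε i
      have h2 := mul_le_mul_of_nonneg_left (le_abs_self (y i - x i)) hε0.le
      simp only [Pi.sub_apply, Pi.smul_apply, smul_eq_mul]
      linarith
    have h3 : x ∈ openSegment ℝ (x + ε • (y - x)) (x - ε • (y - x)) :=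
      ⟨1 / 2, 1 / 2, by norm_num, by norm_num, by norm_num, by module⟩
    have h4 := ((mem_extremePoints.1 hx).2 _ h1 _ h2 h3).1
    have h5 : ε • (y - x) = 0 := by simpa using h4
    rcases smul_eq_zero.1 h5 with h | h
    · exact hε0.ne' h
    · exact hne (sub_eq_zero.1 h).symm
  refine ⟨hfin.toFinset, ?_⟩
  rw [Set.Finite.coe_toFinset, ← (hfin.isClosed_convexHull ℝ).closure_eq]
  -- Krein–Milman; the closure is superfluous because there are finitely many extreme points.
  exact closure_convexHull_extremePoints hc hconv

theorem affineMap_sum {ι : Type*} (s : Finset ι) (A : E →ᵃ[ℝ] F) (w : ι → ℝ) (v : ι → E)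
    (hw : ∑ i ∈ s, w i = 1) : A (∑ i ∈ s, w i • v i) = ∑ i ∈ s, w i • A (v i) := by
  have h : ∀ x, A x = A.linear x + A 0 := fun x => by
    simpa using congrFun (AffineMap.decomp A) x
  rw [h, map_sum]
  simp_rw [h (v _), smul_add, Finset.sum_add_distrib, map_smul, ← Finset.sum_smul]
  rw [hw, one_smul]

/-- The intersection of a polytope with the preimage of a polytope is a polytope. -/
theorem exists_finset_convexHull_eq_inter_preimage (s : Finset E) (t : Finset F)
    (A : E →ᵃ[ℝ] F) : ∃ u : Finset E, convexHull ℝ (u : Set E) =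
      convexHull ℝ (s : Set E) ∩ A ⁻¹' convexHull ℝ (t : Set F) := by
  classical
  -- The pairs of convex weights on `s` and on `t` whose combinations correspond under `A` form a
  -- compact polyhedron in standard form. The intersection is its image under the linear map `N`,
  -- which forgets the weights on `t`.
  let pl (i : s) : ((s ⊕ t) → ℝ) →ₗ[ℝ] ℝ := LinearMap.proj (Sum.inl i)
  let pr (i : t) : ((s ⊕ t) → ℝ) →ₗ[ℝ] ℝ := LinearMap.proj (Sum.inr i)
  let M : ((s ⊕ t) → ℝ) →ₗ[ℝ] (ℝ × ℝ × F) :=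
    (∑ i : s, pl i).prod ((∑ j : t, pr j).prod
      ((∑ i : s, (pl i).smulRight (A i)) - ∑ j : t, (pr j).smulRight (j : F)))
  let N : ((s ⊕ t) → ℝ) →ₗ[ℝ] E := ∑ i : s, (pl i).smulRight (i : E)
  have hM : ∀ x, M x = (1, 1, 0) ↔ (∑ i : s, x (Sum.inl i) = 1 ∧ ∑ j : t, x (Sum.inr j) = 1 ∧
      ∑ i : s, x (Sum.inl i) • A i = ∑ j : t, x (Sum.inr j) • (j : F)) := by
    intro x
    simp [M, pl, pr, Prod.ext_iff, sub_eq_zero]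
  have hN : ∀ x, N x = ∑ i : s, x (Sum.inl i) • (i : E) := by
    intro x
    simp [N, pl]
  have hc : IsCompact {x : (s ⊕ t) → ℝ | (∀ i, 0 ≤ x i) ∧ M x = (1, 1, 0)} := by
    refine Metric.isCompact_of_isClosed_isBounded ?_ ?_
    · have h1 : IsClosed {x : (s ⊕ t) → ℝ | ∀ i, 0 ≤ x i} := by
        simp only [ofPred_forall]
        exact isClosed_iInter fun i => isClosed_le continuous_const (continuous_apply i)
      exact h1.inter (isClosed_eq M.continuous_of_finiteDimensional continuous_const)
    · refine (Metric.isBounded_Icc (0 : (s ⊕ t) → ℝ) 1).subset ?_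
      rintro x ⟨h0, h1⟩
      rw [hM] at h1
      refine ⟨h0, fun i => ?_⟩
      rcases i with i | j
      · rw [Pi.one_apply, ← h1.1]
        exact Finset.single_le_sum (f := fun i : s => x (Sum.inl i)) (fun i _ => h0 _)
          (Finset.mem_univ i)
      · rw [Pi.one_apply, ← h1.2.1]
        exact Finset.single_le_sum (f := fun i : t => x (Sum.inr i)) (fun i _ => h0 _)
          (Finset.mem_univ j)
  obtain ⟨u, hu⟩ := exists_finset_convexHull_eq_standardForm M (1, 1, 0) hc
  refine ⟨u.image N, ?_⟩
  rw [Finset.coe_image, ← LinearMap.image_convexHull, hu]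
  ext x
  constructor
  · rintro ⟨y, ⟨h0, h1⟩, rfl⟩
    rw [hM] at h1
    have hs : ∀ (i : s), (i : E) ∈ convexHull ℝ (s : Set E) :=
      fun i => subset_convexHull ℝ _ i.2
    have ht : ∀ (i : t), (i : F) ∈ convexHull ℝ (t : Set F) :=
      fun i => subset_convexHull ℝ _ i.2
    rw [hN]
    refine ⟨(convex_convexHull ℝ _).sum_mem (fun i _ => h0 _) h1.1 (fun i _ => hs i), ?_⟩
    rw [mem_preimage, affineMap_sum _ _ _ _ h1.1, h1.2.2]
    exact (convex_convexHull ℝ _).sum_mem (fun i _ => h0 _) h1.2.1 (fun i _ => ht i)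
  · rintro ⟨hx, hy⟩
    obtain ⟨w, hw0, hw1, rfl⟩ := Finset.mem_convexHull'.1 hx
    obtain ⟨w', hw0', hw1', hA⟩ := Finset.mem_convexHull'.1 hy
    refine ⟨Sum.elim (fun i => w i) (fun j => w' j), ⟨?_, ?_⟩, ?_⟩
    · rintro (i | j)
      · exact hw0 _ i.2
      · exact hw0' _ j.2
    · rw [hM]
      simp only [Sum.elim_inl, Sum.elim_inr]
      rw [Finset.sum_coe_sort s w, Finset.sum_coe_sort t w',
        Finset.sum_coe_sort s (fun i => w i • A i), Finset.sum_coe_sort t (fun i => w' i • i)]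
      refine ⟨hw1, hw1', ?_⟩
      rw [hA, affineMap_sum _ _ _ _ hw1]
    · rw [hN]
      simp only [Sum.elim_inl]
      rw [Finset.sum_coe_sort s (fun i => w i • i)]

/-- A polytope has a point from which one can move in every direction of its affine span. -/
theorem exists_relative_interior_point {s : Finset E} (hs : s.Nonempty) :
    ∃ y ∈ convexHull ℝ (s : Set E), ∀ v ∈ vectorSpan ℝ (s : Set E),
      ∃ δ > (0 : ℝ), ∀ ε : ℝ, |ε| ≤ δ → y + ε • v ∈ convexHull ℝ (s : Set E) := by
  classical
  have hn : (0 : ℝ) < s.card := by exact_mod_cast hs.card_pos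
  have hsum : ∑ _x ∈ s, (1 / (s.card : ℝ)) = 1 := by
    rw [Finset.sum_const, nsmul_eq_mul, mul_one_div, div_self hn.ne']
  set y : E := ∑ x ∈ s, (1 / (s.card : ℝ)) • x with hy
  have hyc : y ∈ convexHull ℝ (s : Set E) :=
    Finset.mem_convexHull'.2 ⟨fun _ => 1 / s.card, fun _ _ => by positivity, hsum, rfl⟩
  refine ⟨y, hyc, fun v hv => ?_⟩
  have hcv := convex_convexHull ℝ (s : Set E)
  refine Submodule.span_induction (p := fun v _ => ∃ δ > (0 : ℝ), ∀ ε : ℝ, |ε| ≤ δ →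
    y + ε • v ∈ convexHull ℝ (s : Set E)) ?_ ?_ ?_ ?_ hv
  · rintro _ ⟨a, ha, b, hb, rfl⟩
    -- The point `y` is the barycentre. Moving it by `ε (a - b)` shifts weight `ε` from `b` to `a`,
    -- which is allowed as long as `|ε|` is at most the common weight.
    refine ⟨1 / s.card, by positivity, fun ε hε => ?_⟩
    rw [abs_le] at hε
    by_cases hab : a = b
    · simpa [hab] using hyc
    refine Finset.mem_convexHull'.2 ⟨fun x => 1 / s.card + ((if x = a then ε else 0) -
      (if x = b then ε else 0)), fun x _ => ?_, ?_, ?_⟩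
    · by_cases h1 : x = a <;> by_cases h2 : x = b <;> simp [h1, h2, hab] <;> grind
    · rw [Finset.sum_add_distrib, hsum, Finset.sum_sub_distrib]
      simp [Finset.sum_ite_eq', Finset.mem_coe.1 ha, Finset.mem_coe.1 hb]
    · simp_rw [add_smul, sub_smul, Finset.sum_add_distrib, Finset.sum_sub_distrib, ite_smul, zero_smul]
      simp [Finset.sum_ite_eq', Finset.mem_coe.1 ha, Finset.mem_coe.1 hb, smul_sub, hy]
  · exact ⟨1, one_pos, fun ε _ => by simpa using hyc⟩
  · rintro v w - - ⟨δ, hδ, h⟩ ⟨δ', hδ', h'⟩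
    -- `y + ε (v + w)` is the midpoint of `y + 2 ε v` and `y + 2 ε w`; hence the factor one half.
    refine ⟨min δ δ' / 2, by positivity, fun ε hε => ?_⟩
    have e1 : |2 * ε| ≤ δ := by
      rw [abs_mul, abs_two]
      linarith [min_le_left δ δ']
    have e2 : |2 * ε| ≤ δ' := by
      rw [abs_mul, abs_two]
      linarith [min_le_right δ δ']
    have := hcv (h _ e1) (h' _ e2) (a := 1 / 2) (b := 1 / 2) (by norm_num) (by norm_num)
      (by norm_num)
    convert this using 1
    module
  · rintro c v - ⟨δ, hδ, h⟩
    refine ⟨δ / (|c| + 1), by positivity, fun ε hε => ?_⟩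
    rw [smul_smul]
    refine h _ ?_
    rw [abs_mul]
    rw [le_div_iff₀ (by positivity)] at hε
    nlinarith [abs_nonneg ε]

/-- Around a relative interior point one can move in every direction of the affine span, so
injectivity on the polytope forces the linear part of `A` to be injective on the direction space. A
linear left inverse there, suitably translated, is the required map. -/
theorem exists_affineMap_leftInverse {s : Finset E} (A : E →ᵃ[ℝ] F)
    (hA : InjOn A (convexHull ℝ (s : Set E))) :
    ∃ B : F →ᵃ[ℝ] E, ∀ x ∈ convexHull ℝ (s : Set E), B (A x) = x := by
  rcases s.eq_empty_or_nonempty with rfl | hs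
  · exact ⟨AffineMap.const ℝ F 0, by simp⟩
  obtain ⟨y, hy, hv⟩ := exists_relative_interior_point hs
  set D := vectorSpan ℝ (s : Set E)
  have hlin : ∀ x z, A (x + z) = A x + A.linear z := fun x z => by
    rw [add_comm x z, ← vadd_eq_add, AffineMap.map_vadd, vadd_eq_add, add_comm]
  have hinj : LinearMap.ker (A.linear ∘ₗ D.subtype) = ⊥ := by
    rw [LinearMap.ker_eq_bot']
    rintro ⟨v, hvD⟩ h0
    obtain ⟨δ, hδ, h⟩ := hv v hvD
    have h1 := h δ (by rw [abs_of_pos hδ])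
    have h2 : A (y + δ • v) = A y := by
      have h0' : A.linear v = 0 := h0
      rw [hlin, map_smul, h0', smul_zero, add_zero]
    have h3 := hA h1 hy h2
    have h4 : δ • v = 0 := by simpa using h3
    ext
    simpa using (smul_eq_zero.1 h4).resolve_left hδ.ne'
  obtain ⟨g, hg⟩ := LinearMap.exists_leftInverse_of_injective _ hinj
  set L : F →ₗ[ℝ] E := D.subtype ∘ₗ g
  refine ⟨L.toAffineMap + AffineMap.const ℝ F (y - L (A y)), fun x hx => ?_⟩
  have hxy : x - y ∈ D := by
    have h1 := convexHull_subset_affineSpan (s : Set E) (𝕜 := ℝ)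
    have := AffineSubspace.vsub_mem_direction (h1 hx) (h1 hy)
    rwa [direction_affineSpan] at this
  have h1 : A x = A y + A.linear (x - y) := by rw [← hlin, add_sub_cancel]
  have h2 : g (A.linear (x - y)) = ⟨x - y, hxy⟩ := by
    simpa using congrArg (fun f => f ⟨x - y, hxy⟩) hg
  have h3 : L (A.linear (x - y)) = x - y := by
    simp only [L, LinearMap.comp_apply, h2, Submodule.subtype_apply]
  rw [map_sub, map_sub] at h3
  simp only [h1, map_sub, map_add, AffineMap.coe_add, Pi.add_apply, LinearMap.coe_toAffineMap,
    AffineMap.const_apply, h3]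
  abel

end Polytopes

end PLTopology


namespace PLTopology

open Set Filter Topology

/-! ### Piecewise linear maps and bijections between compact polyhedra. -/

section PLOn

variable {E F G : Type*} [NormedAddCommGroup E] [NormedSpace ℝ E]
  [NormedAddCommGroup F] [NormedSpace ℝ F] [NormedAddCommGroup G] [NormedSpace ℝ G]

/-- `f` is piecewise linear on the compact polyhedron `X`. -/
def PLOn (f : E → F) (X : Set E) : Prop :=
  ∃ T : Finset (Finset E), (⋃ s ∈ T, convexHull ℝ (s : Set E)) = X ∧
    ∀ s ∈ T, ∃ A : E →ᵃ[ℝ] F, EqOn f A (convexHull ℝ (s : Set E))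

theorem PLOn.of_finite {ι : Type*} [Finite ι] {f : E → F} {X : Set E} (s : ι → Finset E)
    (hX : ⋃ i, convexHull ℝ (s i : Set E) = X)
    (hs : ∀ i, ∃ A : E →ᵃ[ℝ] F, EqOn f A (convexHull ℝ (s i : Set E))) : PLOn f X := by
  classical
  have := Fintype.ofFinite ι
  refine ⟨Finset.univ.image s, ?_, ?_⟩
  · rw [← hX]
    simp
  · intro t ht
    obtain ⟨i, -, rfl⟩ := Finset.mem_image.1 ht
    exact hs i

theorem PLOn.congr {f g : E → F} {X : Set E} (hf : PLOn f X) (h : EqOn g f X) : PLOn g X := by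
  obtain ⟨T, rfl, hT⟩ := hf
  refine ⟨T, rfl, fun s hs => ?_⟩
  obtain ⟨A, hA⟩ := hT s hs
  exact ⟨A, fun x hx => (h (mem_biUnion hs hx)).trans (hA hx)⟩

theorem PLOn.polyhedron {f : E → F} {X : Set E} (hf : PLOn f X) : PLOn (id : E → E) X := by
  obtain ⟨T, hX, -⟩ := hf
  exact ⟨T, hX, fun s _ => ⟨AffineMap.id ℝ E, fun _ _ => rfl⟩⟩

theorem PLOn.union {f : E → F} {X Y : Set E} (hX : PLOn f X) (hY : PLOn f Y) :
    PLOn f (X ∪ Y) := by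
  classical
  obtain ⟨T, rfl, hT⟩ := hX
  obtain ⟨T', rfl, hT'⟩ := hY
  refine ⟨T ∪ T', Finset.set_biUnion_union _ _ _, fun s hs => ?_⟩
  rcases Finset.mem_union.1 hs with h | h
  exacts [hT s h, hT' s h]

/-- Each polytope of `X` is cut by the preimages of the polytopes of `Y`. The pieces are again
polytopes, and on each of them both maps are affine. -/
theorem PLOn.comp {f : E → F} {g : F → G} {X : Set E} {Y : Set F} (hg : PLOn g Y)
    (hf : PLOn f X) (hXY : MapsTo f X Y) : PLOn (g ∘ f) X := by
  obtain ⟨T, rfl, hT⟩ := hf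
  obtain ⟨T', rfl, hT'⟩ := hg
  choose! A hA using hT
  choose! B hB using hT'
  choose u hu using fun (s : Finset E) (t : Finset F) =>
    exists_finset_convexHull_eq_inter_preimage s t (A s)
  refine PLOn.of_finite (fun p : T × T' => u p.1 p.2) ?_ ?_
  · ext x
    simp only [hu, mem_iUnion]
    constructor
    · rintro ⟨⟨⟨s, hs⟩, ⟨t, ht⟩⟩, hx⟩
      exact ⟨s, hs, hx.1⟩
    · rintro ⟨s, hs, hx⟩
      obtain ⟨t, ht, hft⟩ := mem_iUnion₂.1 (hXY (mem_biUnion hs hx))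
      exact ⟨⟨⟨s, hs⟩, ⟨t, ht⟩⟩, hx, by rwa [mem_preimage, ← hA s hs hx]⟩
  · rintro ⟨⟨s, hs⟩, ⟨t, ht⟩⟩
    refine ⟨(B t).comp (A s), fun x hx => ?_⟩
    rw [hu] at hx
    rw [Function.comp_apply, hA s hs hx.1, hB t ht hx.2, AffineMap.comp_apply]

/-- `PLOn id Y` expresses that `Y` is a compact polyhedron; restriction to `Y` is composition with
its identity. -/
theorem PLOn.mono {f : E → F} {X Y : Set E} (hf : PLOn f X) (hY : PLOn (id : E → E) Y)
    (h : Y ⊆ X) : PLOn f Y :=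
  hf.comp hY h

theorem PLOn.isCompact {f : E → F} {X : Set E} (hf : PLOn f X) : IsCompact X := by
  obtain ⟨T, rfl, -⟩ := hf
  exact T.finite_toSet.isCompact_biUnion fun s _ => s.finite_toSet.isCompact_convexHull ℝ

theorem PLOn.continuousOn [FiniteDimensional ℝ E] {f : E → F} {X : Set E} (hf : PLOn f X) :
    ContinuousOn f X := by
  obtain ⟨T, rfl, hT⟩ := hf
  have e : (⋃ s ∈ T, convexHull ℝ (s : Set E)) = ⋃ s : T, convexHull ℝ ((s : Finset E) : Set E) := by
    ext
    simp
  rw [e]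
  refine (locallyFinite_of_finite _).continuousOn_iUnion
    (fun s : T => (s : Finset E).finite_toSet.isClosed_convexHull ℝ) fun s => ?_
  obtain ⟨A, hA⟩ := hT s s.2
  exact A.continuous_of_finiteDimensional.continuousOn.congr hA

/-- `f` is a piecewise linear bijection (hence homeomorphism) between compact polyhedra. -/
structure PLBij (f : E → F) (X : Set E) (Y : Set F) : Prop where
  bijOn : BijOn f X Y
  plOn : PLOn f X

theorem PLBij.comp {f : E → F} {g : F → G} {X : Set E} {Y : Set F} {Z : Set G}
    (hg : PLBij g Y Z) (hf : PLBij f X Y) : PLBij (g ∘ f) X Z :=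
  ⟨hg.bijOn.comp hf.bijOn, hg.plOn.comp hf.plOn hf.bijOn.mapsTo⟩

theorem PLBij.congr {f g : E → F} {X : Set E} {Y : Set F} (hf : PLBij f X Y) (h : EqOn g f X) :
    PLBij g X Y :=
  ⟨hf.bijOn.congr h.symm, hf.plOn.congr h⟩

/-- The images of the polytopes are polytopes, and on each of them the inverse is given by an affine
left inverse of the affine map describing `f`. -/
theorem PLBij.invFunOn {f : E → F} {X : Set E} {Y : Set F} (hf : PLBij f X Y) :
    PLBij (Function.invFunOn f X) Y X := by
  classical
  have hinv := hf.bijOn.invOn_invFunOn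
  refine ⟨hinv.symm.bijOn hf.bijOn.surjOn.mapsTo_invFunOn hf.bijOn.mapsTo, ?_⟩
  obtain ⟨hb, T, rfl, hT⟩ := hf
  choose! A hA using hT
  refine PLOn.of_finite (fun s : T => (s : Finset E).image (A s)) ?_ ?_
  · rw [← hb.image_eq, image_iUnion₂, iUnion_subtype]
    refine iUnion₂_congr fun s hs => ?_
    rw [Finset.coe_image, ← AffineMap.image_convexHull]
    exact ((hA s hs).image_eq).symm
  · rintro ⟨s, hs⟩
    have hsub : convexHull ℝ (s : Set E) ⊆ ⋃ s ∈ T, convexHull ℝ (s : Set E) :=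
      subset_biUnion_of_mem (u := fun s : Finset E => convexHull ℝ (s : Set E)) hs
    obtain ⟨B, hB⟩ := exists_affineMap_leftInverse (s := s) (A s)
      ((hA s hs).injOn_iff.1 (hb.injOn.mono hsub))
    refine ⟨B, ?_⟩
    rw [Finset.coe_image, ← AffineMap.image_convexHull]
    rintro _ ⟨x, hx, rfl⟩
    rw [hB x hx, ← hA s hs hx]
    exact hinv.1 (hsub hx)

/-- The hypothesis on the intersections is what gives injectivity across the two parts: a common
value comes from a common point. -/
theorem PLBij.union {f : E → F} {X X' : Set E} {Y Y' : Set F} (h : PLBij f X Y)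
    (h' : PLBij f X' Y') (hi : Y ∩ Y' ⊆ f '' (X ∩ X')) : PLBij f (X ∪ X') (Y ∪ Y') := by
  refine ⟨⟨h.bijOn.mapsTo.union_union h'.bijOn.mapsTo, ?_,
    h.bijOn.surjOn.union_union h'.bijOn.surjOn⟩, h.plOn.union h'.plOn⟩
  have key : ∀ x ∈ X, ∀ x' ∈ X', f x = f x' → x = x' := by
    intro x hx x' hx' e
    obtain ⟨z, hz, hzx⟩ := hi ⟨h.bijOn.mapsTo hx, e ▸ h'.bijOn.mapsTo hx'⟩
    rw [← h.bijOn.injOn hz.1 hx hzx]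
    exact h'.bijOn.injOn hz.2 hx' (hzx.trans e)
  rintro x (hx | hx) y (hy | hy) e
  · exact h.bijOn.injOn hx hy e
  · exact key x hx y hy e
  · exact (key y hy x hx e.symm).symm
  · exact h'.bijOn.injOn hx hy e

/-- A continuous bijection from a compact space to a Hausdorff space is a homeomorphism. This and
the following lemma allow work with functions on the ambient space instead of maps between subtypes.
-/
theorem PLBij.exists_homeomorph [FiniteDimensional ℝ E] {f : E → F} {X : Set E} {Y : Set F}
    (h : PLBij f X Y) : ∃ e : X ≃ₜ Y, IsPL e ∧ ∀ x : X, (e x : F) = f x := by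
  have : CompactSpace X := isCompact_iff_compactSpace.1 h.plOn.isCompact
  let e : X ≃ Y := h.bijOn.equiv f
  have he : ∀ x : X, (e x : F) = f x := fun x => rfl
  have hc : Continuous e :=
    Continuous.subtype_mk h.plOn.continuousOn.domRestrict _
  refine ⟨hc.homeoOfEquivCompactToT2, ?_, he⟩
  obtain ⟨T, hT, hA⟩ := h.plOn
  refine ⟨T, hT, fun s hs => ?_⟩
  obtain ⟨A, hA⟩ := hA s hs
  exact ⟨A, fun x hx => (he x).trans (hA hx)⟩

theorem exists_plBij_of_homeomorph {X : Set E} {Y : Set F} (e : X ≃ₜ Y) (he : IsPL e) :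
    ∃ f : E → F, PLBij f X Y ∧ ∀ x : X, (e x : F) = f x := by
  classical
  let f : E → F := fun x => if h : x ∈ X then e ⟨x, h⟩ else 0
  have hf : ∀ x : X, (e x : F) = f x := fun x => by simp [f]
  refine ⟨f, ⟨⟨fun x hx => ?_, fun x hx y hy hxy => ?_, fun y hy => ?_⟩, ?_⟩, hf⟩
  · rw [← hf ⟨x, hx⟩]
    exact (e ⟨x, hx⟩).2
  · rw [← hf ⟨x, hx⟩, ← hf ⟨y, hy⟩] at hxy
    exact congrArg Subtype.val (e.injective (Subtype.ext hxy))
  · exact ⟨e.symm ⟨y, hy⟩, (e.symm ⟨y, hy⟩).2, by rw [← hf]; simp⟩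
  · obtain ⟨T, rfl, hT⟩ := he
    refine ⟨T, rfl, fun s hs => ?_⟩
    obtain ⟨A, hA⟩ := hT s hs
    refine ⟨A, fun x hx => ?_⟩
    have hx' := mem_biUnion (t := fun s : Finset E => convexHull ℝ (s : Set E)) hs hx
    rw [← hA ⟨x, hx'⟩ hx, hf]

theorem isPLSphere_iff [FiniteDimensional ℝ E] {n : ℕ} {X : Set E} :
    IsPLSphere n X ↔ ∃ f : E → Fin (n + 2) → ℝ, PLBij f X (simplexBoundary (n + 1)) := by
  constructor
  · rintro ⟨e, he⟩
    obtain ⟨f, hf, -⟩ := exists_plBij_of_homeomorph e he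
    exact ⟨f, hf⟩
  · rintro ⟨f, hf⟩
    obtain ⟨e, he, -⟩ := hf.exists_homeomorph
    exact ⟨e, he⟩

theorem isPLBall_iff [FiniteDimensional ℝ E] {n : ℕ} {X Y : Set E} :
    IsPLBall n X Y ↔ Y ⊆ X ∧ ∃ f : E → Fin (n + 1) → ℝ, PLBij f X (stdSimplex ℝ (Fin (n + 1))) ∧
      ∀ x ∈ X, x ∈ Y ↔ f x ∈ simplexBoundary n := by
  constructor
  · rintro ⟨h, e, he, hY⟩
    obtain ⟨f, hf, hef⟩ := exists_plBij_of_homeomorph e he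
    refine ⟨h, f, hf, fun x hx => (hY ⟨x, hx⟩).trans ?_⟩
    have : ⇑(e ⟨x, hx⟩) = f x := hef ⟨x, hx⟩
    rw [this]
  · rintro ⟨h, f, hf, hY⟩
    obtain ⟨e, he, hef⟩ := hf.exists_homeomorph
    refine ⟨h, e, he, fun x => (hY x x.2).trans ?_⟩
    have : ⇑(e x) = f x := hef x
    rw [this]

theorem PLBij.isPLBall [FiniteDimensional ℝ E] [FiniteDimensional ℝ F] {n : ℕ} {f : E → F}
    {X Y : Set E} {X' Y' : Set F} (hf : PLBij f X X') (h : IsPLBall n X' Y') (hY : Y ⊆ X)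
    (hYY' : f '' Y = Y') : IsPLBall n X Y := by
  rw [isPLBall_iff] at h ⊢
  obtain ⟨-, g, hg, hgY⟩ := h
  refine ⟨hY, g ∘ f, hg.comp hf, fun x hx => ?_⟩
  rw [Function.comp_apply, ← hgY _ (hf.bijOn.mapsTo hx), ← hYY',
    hf.bijOn.injOn.mem_image_iff hY hx]

end PLOn

end PLTopology


namespace PLTopology

open Set Filter Topology

/-! ### Nondegenerate cones and the extension of maps to them. -/

section Cones

variable {E F G : Type*} [NormedAddCommGroup E] [NormedSpace ℝ E]
  [NormedAddCommGroup F] [NormedSpace ℝ F] [NormedAddCommGroup G] [NormedSpace ℝ G]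

/-- The cone with apex `c` over `X` is nondegenerate. -/
def IsConeOver (c : E) (X : Set E) : Prop :=
  ∀ x ∈ X, ∀ y ∈ X, ∀ s ∈ Icc (0 : ℝ) 1, ∀ t ∈ Icc (0 : ℝ) 1,
    (1 - s) • c + s • x = (1 - t) • c + t • y → s = t ∧ (s = 0 ∨ x = y)

theorem mem_convexJoin_iff {X Y : Set E} {z : E} : z ∈ convexJoin ℝ X Y ↔
    ∃ x ∈ X, ∃ y ∈ Y, ∃ t ∈ Icc (0 : ℝ) 1, z = (1 - t) • x + t • y := by
  rw [mem_convexJoin]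
  refine exists_congr fun x => and_congr_right fun _ => exists_congr fun y =>
    and_congr_right fun _ => ?_
  rw [segment_eq_image]
  constructor
  · rintro ⟨t, ht, rfl⟩
    exact ⟨t, ht, rfl⟩
  · rintro ⟨t, ht, rfl⟩
    exact ⟨t, ht, rfl⟩

theorem mem_cone_iff {c : E} {Y : Set E} {z : E} : z ∈ convexJoin ℝ {c} Y ↔
    ∃ y ∈ Y, ∃ t ∈ Icc (0 : ℝ) 1, z = (1 - t) • c + t • y := by
  rw [mem_convexJoin_iff]
  simp only [mem_singleton_iff, exists_eq_left]

/-- Otherwise one could move from a relative interior point `y` of the polytope a little towards `c`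
and stay inside. The resulting point would lie in the base with parameter `1` and on the segment
from `c` to `y` with parameter less than `1`. -/
theorem IsConeOver.notMem_affineSpan {c : E} {X : Set E} (h : IsConeOver c X) {s : Finset E}
    (hs : s.Nonempty) (hsX : convexHull ℝ (s : Set E) ⊆ X) : c ∉ affineSpan ℝ (s : Set E) := by
  intro hc
  obtain ⟨y, hy, hv⟩ := exists_relative_interior_point hs
  have hcy : c - y ∈ vectorSpan ℝ (s : Set E) := by
    have := AffineSubspace.vsub_mem_direction hc (convexHull_subset_affineSpan (𝕜 := ℝ) _ hy)
    rwa [direction_affineSpan] at this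
  obtain ⟨δ, hδ, hd⟩ := hv _ hcy
  have hε : (0 : ℝ) < min δ (1 / 2) := by positivity
  have h1 := hd (min δ (1 / 2)) (by rw [abs_of_pos hε]; exact min_le_left _ _)
  have h2 := (h _ (hsX h1) _ (hsX hy) 1 (by simp) (1 - min δ (1 / 2))
    ⟨by linarith [min_le_right δ (1 / 2)], by linarith⟩ (by module)).1
  linarith

/-- Some linear functional vanishes on the direction of the span but not on `c - y₀`. Adding to `A`
a multiple of it, normalised to vanish at `y₀`, corrects the value at `c` and changes nothing on the
span. -/
theorem exists_affineMap_extend {s : Set E} {c y₀ : E} (hy₀ : y₀ ∈ affineSpan ℝ s)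
    (hc : c ∉ affineSpan ℝ s) (A : E →ᵃ[ℝ] F) (c' : F) :
    ∃ B : E →ᵃ[ℝ] F, B c = c' ∧ ∀ x ∈ affineSpan ℝ s, B x = A x := by
  have hcy : c - y₀ ∉ vectorSpan ℝ s := fun h => by
    rw [← direction_affineSpan] at h
    exact hc ((AffineSubspace.vsub_right_mem_direction_iff_mem hy₀ c).1 h)
  obtain ⟨f, hf, hker⟩ := Submodule.exists_le_ker_of_notMem hcy
  let L : E →ₗ[ℝ] F := (f (c - y₀))⁻¹ • f.smulRight (c' - A c)
  have hL : ∀ x, L x = ((f (c - y₀))⁻¹ * f x) • (c' - A c) := fun x => by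
    simp [L, smul_smul]
  refine ⟨A + (L.toAffineMap - AffineMap.const ℝ E (L y₀)), ?_, fun x hx => ?_⟩
  · have : L c - L y₀ = c' - A c := by
      rw [← map_sub, hL, inv_mul_cancel₀ hf, one_smul]
    simp [this]
  · have h0 : f (x - y₀) = 0 := by
      have := AffineSubspace.vsub_mem_direction hx hy₀
      rw [direction_affineSpan] at this
      exact hker this
    have : L x - L y₀ = 0 := by
      rw [← map_sub, hL, h0, mul_zero, zero_smul]
    simp [this]

/-- A piecewise linear bijection extends to the cones. -/
theorem PLBij.exists_cone {c : E} {X : Set E} {c' : F} {Y : Set F} {f : E → F}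
    (hX : IsConeOver c X) (hY : IsConeOver c' Y) (hf : PLBij f X Y) :
    ∃ g : E → F, PLBij g (convexJoin ℝ {c} X) (convexJoin ℝ {c'} Y) ∧
      ∀ x ∈ X, ∀ t ∈ Icc (0 : ℝ) 1, g ((1 - t) • c + t • x) = (1 - t) • c' + t • f x := by
  classical
  -- Nondegeneracy makes the conical extension well defined: the parameter is unique, and so is the
  -- base point unless the parameter is `0`.
  have h0 : ∀ z, ∃ w : F, ∀ x ∈ X, ∀ t ∈ Icc (0 : ℝ) 1, z = (1 - t) • c + t • x →
      w = (1 - t) • c' + t • f x := by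
    intro z
    by_cases hz : ∃ x ∈ X, ∃ t ∈ Icc (0 : ℝ) 1, z = (1 - t) • c + t • x
    · obtain ⟨x, hx, t, ht, rfl⟩ := hz
      refine ⟨(1 - t) • c' + t • f x, fun y hy s hs e => ?_⟩
      obtain ⟨rfl, h⟩ := hX x hx y hy t ht s hs e
      rcases h with rfl | rfl
      · simp
      · rfl
    · exact ⟨0, fun x hx t ht e => (hz ⟨x, hx, t, ht, e⟩).elim⟩
  choose g hg using h0
  have hg' : ∀ x ∈ X, ∀ t ∈ Icc (0 : ℝ) 1, g ((1 - t) • c + t • x) = (1 - t) • c' + t • f x :=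
    fun x hx t ht => hg _ x hx t ht rfl
  refine ⟨g, ⟨⟨?_, ?_, ?_⟩, ?_⟩, hg'⟩
  · intro z hz
    obtain ⟨x, hx, t, ht, rfl⟩ := mem_cone_iff.1 hz
    rw [hg' x hx t ht]
    exact mem_cone_iff.2 ⟨f x, hf.bijOn.mapsTo hx, t, ht, rfl⟩
  · intro z hz z' hz' e
    obtain ⟨x, hx, t, ht, rfl⟩ := mem_cone_iff.1 hz
    obtain ⟨x', hx', t', ht', rfl⟩ := mem_cone_iff.1 hz'
    rw [hg' x hx t ht, hg' x' hx' t' ht'] at e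
    obtain ⟨rfl, h⟩ := hY _ (hf.bijOn.mapsTo hx) _ (hf.bijOn.mapsTo hx') t ht t' ht' e
    rcases h with rfl | h
    · simp
    · rw [hf.bijOn.injOn hx hx' h]
  · intro w hw
    obtain ⟨y, hy, t, ht, rfl⟩ := mem_cone_iff.1 hw
    obtain ⟨x, hx, rfl⟩ := hf.bijOn.surjOn hy
    exact ⟨_, mem_cone_iff.2 ⟨x, hx, t, ht, rfl⟩, hg' x hx t ht⟩
  · obtain ⟨T, rfl, hT⟩ := hf.plOn
    have hsub : ∀ s ∈ T, convexHull ℝ (s : Set E) ⊆ ⋃ s ∈ T, convexHull ℝ (s : Set E) :=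
      fun s hs => subset_biUnion_of_mem (u := fun s : Finset E => convexHull ℝ (s : Set E)) hs
    refine PLOn.of_finite (fun s : {s : T // (s : Finset E).Nonempty} => insert c (s : Finset E))
      ?_ ?_
    · ext z
      rw [mem_cone_iff, mem_iUnion]
      constructor
      · rintro ⟨⟨⟨s, hs⟩, hne⟩, hz⟩
        rw [Finset.coe_insert, convexHull_insert hne, mem_cone_iff] at hz
        obtain ⟨y, hy, t, ht, rfl⟩ := hz
        exact ⟨y, hsub s hs hy, t, ht, rfl⟩
      · rintro ⟨y, hy, t, ht, rfl⟩
        obtain ⟨s, hs, hys⟩ := mem_iUnion₂.1 hy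
        have hne : s.Nonempty := by
          simpa using convexHull_nonempty_iff.1 ⟨y, hys⟩
        refine ⟨⟨⟨s, hs⟩, hne⟩, ?_⟩
        rw [Finset.coe_insert, convexHull_insert hne, mem_cone_iff]
        exact ⟨y, hys, t, ht, rfl⟩
    · rintro ⟨⟨s, hs⟩, hne⟩
      obtain ⟨A, hA⟩ := hT s hs
      have hne' : s.Nonempty := hne
      obtain ⟨y₀, hy₀⟩ := hne'
      -- On the cone over one polytope the extension is affine, because `c` lies outside the affine
      -- span of the polytope and its image can be prescribed.
      obtain ⟨B, hBc, hBA⟩ := exists_affineMap_extend (subset_affineSpan ℝ (s : Set E) hy₀)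
        (hX.notMem_affineSpan hne (hsub s hs)) A c'
      refine ⟨B, fun z hz => ?_⟩
      rw [Finset.coe_insert, convexHull_insert hne, mem_cone_iff] at hz
      obtain ⟨y, hy, t, ht, rfl⟩ := hz
      rw [hg' y (hsub s hs hy) t ht, Convex.combo_affine_apply (by ring), hBc,
        hBA y (convexHull_subset_affineSpan _ hy), hA hy]

theorem IsConeOver.mem_iff {c : E} {X : Set E} (h : IsConeOver c X) {x : E} (hx : x ∈ X) {t : ℝ}
    (ht : t ∈ Icc (0 : ℝ) 1) : (1 - t) • c + t • x ∈ X ↔ t = 1 := by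
  refine ⟨fun hX => ?_, fun e => by simpa [e] using hx⟩
  exact ((h _ hX x hx 1 (by simp) t ht (by simp)).1).symm

theorem subset_cone (c : E) (X : Set E) : X ⊆ convexJoin ℝ {c} X :=
  fun x hx => mem_cone_iff.2 ⟨x, hx, 1, by simp, by simp⟩

end Cones

/-! ### The standard simplex as a cone over its boundary. -/

section Simplex

theorem isCompact_simplex_face (n : ℕ) (i : Fin (n + 1)) :
    IsCompact {x : Fin (n + 1) → ℝ | x ∈ stdSimplex ℝ (Fin (n + 1)) ∧ x i = 0} :=
  (isCompact_stdSimplex ℝ _).inter_right (isClosed_eq (continuous_apply i) continuous_const)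

theorem plOn_id_stdSimplex (n : ℕ) :
    PLOn (id : (Fin n → ℝ) → _) (stdSimplex ℝ (Fin n)) := by
  let M : (Fin n → ℝ) →ₗ[ℝ] ℝ := ∑ i, LinearMap.proj i
  have e : {x : Fin n → ℝ | (∀ i, 0 ≤ x i) ∧ M x = 1} = stdSimplex ℝ (Fin n) := by
    ext x
    simp [M, stdSimplex]
  obtain ⟨t, ht⟩ := exists_finset_convexHull_eq_standardForm M 1
    (by rw [e]; exact isCompact_stdSimplex ℝ _)
  exact PLOn.of_finite (fun _ : Unit => t) (by rw [iUnion_const, ht, e])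
    fun _ => ⟨AffineMap.id ℝ _, fun _ _ => rfl⟩

theorem plOn_id_simplexBoundary (n : ℕ) :
    PLOn (id : (Fin (n + 1) → ℝ) → _) (simplexBoundary n) := by
  have h : ∀ j : Fin (n + 1), ∃ t : Finset (Fin (n + 1) → ℝ), convexHull ℝ (t : Set _) =
      {x : Fin (n + 1) → ℝ | x ∈ stdSimplex ℝ (Fin (n + 1)) ∧ x j = 0} := by
    intro j
    let M : (Fin (n + 1) → ℝ) →ₗ[ℝ] ℝ × ℝ := (∑ i, LinearMap.proj i).prod (LinearMap.proj j)
    have e : {x : Fin (n + 1) → ℝ | (∀ i, 0 ≤ x i) ∧ M x = (1, 0)} =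
        {x | x ∈ stdSimplex ℝ (Fin (n + 1)) ∧ x j = 0} := by
      ext x
      simp [M, stdSimplex, and_assoc]
    obtain ⟨t, ht⟩ := exists_finset_convexHull_eq_standardForm M (1, 0)
      (by rw [e]; exact isCompact_simplex_face n j)
    exact ⟨t, ht.trans e⟩
  choose t ht using h
  refine PLOn.of_finite t ?_ fun _ => ⟨AffineMap.id ℝ _, fun _ _ => rfl⟩
  ext x
  simp [ht, simplexBoundary]

theorem exists_mem_simplexBoundary (n : ℕ) : (simplexBoundary (n + 1)).Nonempty :=
  ⟨Pi.single 0 1, single_mem_stdSimplex ℝ _, 1, by simp⟩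

/-- The barycentre of the standard simplex. -/
noncomputable def barycenter (n : ℕ) : Fin (n + 1) → ℝ := fun _ => 1 / (n + 1)

/-- At a coordinate where `y` vanishes, the right side equals `(1 - t) / (n + 1)`, while the left
side is at least `(1 - s) / (n + 1)`. So `t ≤ s`, and equality follows by symmetry. -/
theorem isConeOver_barycenter (n : ℕ) : IsConeOver (barycenter n) (simplexBoundary n) := by
  have hn : (0 : ℝ) < 1 / (n + 1) := by positivity
  have key : ∀ x ∈ simplexBoundary n, ∀ y ∈ simplexBoundary n, ∀ s ∈ Icc (0 : ℝ) 1,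
      ∀ t ∈ Icc (0 : ℝ) 1, (1 - s) • barycenter n + s • x = (1 - t) • barycenter n + t • y →
      t ≤ s := by
    rintro x ⟨hx, -⟩ y ⟨hy, i, hi⟩ s hs t ht e
    have := congrFun e i
    simp only [barycenter, Pi.add_apply, Pi.smul_apply, smul_eq_mul, hi, mul_zero, add_zero] at this
    have h1 := mul_nonneg hs.1 (hx.1 i)
    by_contra hlt
    nlinarith
  intro x hx y hy s hs t ht e
  have hst : s = t := le_antisymm (key y hy x hx t ht s hs e.symm) (key x hx y hy s hs t ht e)
  subst hst
  refine ⟨rfl, ?_⟩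
  by_cases h0 : s = 0
  · exact Or.inl h0
  · exact Or.inr (smul_right_injective _ h0 (add_left_cancel e))

/-- A point of the hyperplane of the simplex lies on a ray from the barycentre to the boundary. -/
theorem exists_ray {n : ℕ} (x : Fin (n + 2) → ℝ) (hx : ∑ i, x i = 1) :
    ∃ y ∈ simplexBoundary (n + 1), ∃ t : ℝ, 0 ≤ t ∧ ((∀ i, 0 ≤ x i) → t ≤ 1) ∧
      x = (1 - t) • barycenter (n + 1) + t • y := by
  obtain ⟨i₀, -, hi₀⟩ := Finset.exists_min_image Finset.univ x Finset.univ_nonempty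
  have hle : ((n : ℝ) + 1 + 1) * x i₀ ≤ 1 := by
    have := Finset.sum_le_sum fun i (_ : i ∈ Finset.univ) => hi₀ i (Finset.mem_univ i)
    rw [hx] at this
    simp at this
    linarith
  -- There are `n + 2` coordinates. The value of `t` is chosen so that `(1 - t)` times the
  -- barycentre has all coordinates equal to the minimum of `x`; what remains is nonnegative with a
  -- zero at `i₀`.
  set t := 1 - ((n : ℝ) + 1 + 1) * x i₀ with ht
  have ht0 : 0 ≤ t := by linarith
  have hb : ∀ i, (1 - t) * barycenter (n + 1) i = x i₀ := by
    intro i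
    simp only [ht, barycenter]
    push_cast
    field_simp
    ring
  have ht1 : (∀ i, 0 ≤ x i) → t ≤ 1 := fun h => by
    have := h i₀
    have : 0 ≤ ((n : ℝ) + 1 + 1) * x i₀ := by positivity
    linarith
  rcases ht0.eq_or_lt with h0 | hpos
  -- For `t = 0` the point `x` is the barycentre itself, and any boundary point serves.
  · obtain ⟨y, hy⟩ := exists_mem_simplexBoundary n
    refine ⟨y, hy, t, ht0, ht1, ?_⟩
    have hall : ∀ i, x i - x i₀ = 0 := by
      have h1 : ∑ i, (x i - x i₀) = 0 := by
        rw [Finset.sum_sub_distrib, hx]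
        simp
        linarith
      intro i
      exact (Finset.sum_eq_zero_iff_of_nonneg
        (fun i hi => sub_nonneg.2 (hi₀ i hi))).1 h1 i (Finset.mem_univ i)
    ext i
    have := hb i
    have := hall i
    simp only [Pi.add_apply, Pi.smul_apply, smul_eq_mul]
    rw [hb i, ← h0]
    linarith
  · refine ⟨fun i => (x i - x i₀) / t, ⟨⟨fun i => ?_, ?_⟩, i₀, by simp⟩, t, ht0, ht1, ?_⟩
    · exact div_nonneg (sub_nonneg.2 (hi₀ i (Finset.mem_univ i))) ht0
    · rw [← Finset.sum_div, Finset.sum_sub_distrib, hx, div_eq_one_iff_eq hpos.ne']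
      simp [ht]
    · ext i
      simp only [Pi.add_apply, Pi.smul_apply, smul_eq_mul]
      rw [hb i, mul_div_cancel₀ _ hpos.ne']
      ring

theorem barycenter_mem (n : ℕ) : barycenter n ∈ stdSimplex ℝ (Fin (n + 1)) := by
  refine ⟨fun i => by unfold barycenter; positivity, ?_⟩
  simp [barycenter]
  field_simp

theorem cone_simplexBoundary (n : ℕ) :
    convexJoin ℝ {barycenter (n + 1)} (simplexBoundary (n + 1)) = stdSimplex ℝ (Fin (n + 2)) := by
  ext x
  rw [mem_cone_iff]
  constructor
  · rintro ⟨y, hy, t, ht, rfl⟩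
    exact convex_stdSimplex ℝ _ (barycenter_mem _) hy.1 (by linarith [ht.2]) ht.1 (by ring)
  · intro hx
    obtain ⟨y, hy, t, h0, h1, e⟩ := exists_ray x hx.2
    exact ⟨y, hy, t, ⟨h0, h1 hx.1⟩, e⟩

variable {E : Type*} [NormedAddCommGroup E] [NormedSpace ℝ E] [FiniteDimensional ℝ E]

/-- The cone over a PL sphere is a PL ball. -/
theorem isPLBall_cone {n : ℕ} {c : E} {X : Set E} (hX : IsPLSphere n X) (hc : IsConeOver c X) :
    IsPLBall (n + 1) (convexJoin ℝ {c} X) X := by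
  rw [isPLSphere_iff] at hX
  obtain ⟨f, hf⟩ := hX
  obtain ⟨g, hg, hgf⟩ := hf.exists_cone hc (isConeOver_barycenter (n + 1))
  rw [cone_simplexBoundary] at hg
  refine isPLBall_iff.2 ⟨subset_cone c X, g, hg, fun x hx => ?_⟩
  obtain ⟨y, hy, t, ht, rfl⟩ := mem_cone_iff.1 hx
  rw [hc.mem_iff hy ht, hgf y hy t ht, (isConeOver_barycenter (n + 1)).mem_iff
    (hf.bijOn.mapsTo hy) ht]

end Simplex

end PLTopology


namespace PLTopology

open Set Filter Topology

/-! ### Gluing two balls to a sphere, and comparison with the round sphere. -/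

section Gluing

/-- The inclusion of a simplex as the face of the next simplex opposite to the vertex `0`. -/
def faceIncl (n : ℕ) : (Fin n → ℝ) →ₗ[ℝ] (Fin (n + 1) → ℝ) where
  toFun x := Fin.cons 0 x
  map_add' x y := by
    ext i
    refine Fin.cases ?_ (fun j => ?_) i <;> simp
  map_smul' c x := by
    ext i
    refine Fin.cases ?_ (fun j => ?_) i <;> simp

@[simp] theorem faceIncl_zero (n : ℕ) (x : Fin n → ℝ) : faceIncl n x 0 = 0 := rfl

@[simp] theorem faceIncl_succ (n : ℕ) (x : Fin n → ℝ) (i : Fin n) :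
    faceIncl n x i.succ = x i := by
  simp [faceIncl]

theorem faceIncl_injective (n : ℕ) : Function.Injective (faceIncl n) := fun x y h => by
  ext i
  have := congrFun h i.succ
  simpa using this

theorem plBij_faceIncl (n : ℕ) {X : Set (Fin n → ℝ)} (hX : PLOn (id : (Fin n → ℝ) → _) X) :
    PLBij (faceIncl n) X (faceIncl n '' X) := by
  refine ⟨(faceIncl_injective n).injOn.bijOn_image, ?_⟩
  obtain ⟨T, hT, -⟩ := hX
  exact ⟨T, hT, fun s _ => ⟨(faceIncl n).toAffineMap, fun x _ => rfl⟩⟩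

theorem isConeOver_faceIncl (n : ℕ) (X : Set (Fin n → ℝ)) :
    IsConeOver (Pi.single 0 1 : Fin (n + 1) → ℝ) (faceIncl n '' X) := by
  rintro _ ⟨x, hx, rfl⟩ _ ⟨y, hy, rfl⟩ s hs t ht e
  have h0 := congrFun e 0
  simp only [Pi.add_apply, Pi.smul_apply, Pi.single_eq_same, smul_eq_mul, faceIncl_zero] at h0
  have hst : s = t := by linarith
  subst hst
  refine ⟨rfl, ?_⟩
  by_cases h : s = 0
  · exact Or.inl h
  · exact Or.inr (smul_right_injective _ h (add_left_cancel e))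

theorem faceIncl_mem_stdSimplex {n : ℕ} {x : Fin n → ℝ} :
    faceIncl n x ∈ stdSimplex ℝ (Fin (n + 1)) ↔ x ∈ stdSimplex ℝ (Fin n) := by
  simp [stdSimplex, Fin.sum_univ_succ, Fin.forall_fin_succ]

/-- All facets except the one opposite the vertex `0` contain that vertex. This splits the model
sphere into two balls with common boundary, one for each of the balls to be glued. -/
theorem simplexBoundary_succ (n : ℕ) : simplexBoundary (n + 2) =
    faceIncl (n + 2) '' stdSimplex ℝ (Fin (n + 2)) ∪
      convexJoin ℝ {Pi.single 0 1} (faceIncl (n + 2) '' simplexBoundary (n + 1)) := by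
  apply Subset.antisymm
  · rintro x ⟨hx, i, hi⟩
    have htail : ∀ z : Fin (n + 3) → ℝ, z 0 = 0 → faceIncl (n + 2) (fun i => z i.succ) = z := by
      intro z hz
      ext j
      refine Fin.cases ?_ (fun j => ?_) j <;> simp [hz]
    have hcase : ∀ i, x i = 0 → i ≠ 0 → x ∈ convexJoin ℝ {Pi.single 0 1}
        (faceIncl (n + 2) '' simplexBoundary (n + 1)) := by
      intro i hi hi0
      have hsum := hx.2
      rw [Fin.sum_univ_succ] at hsum
      have hnn : 0 ≤ ∑ i : Fin (n + 2), x i.succ := Finset.sum_nonneg fun i _ => hx.1 _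
      rw [mem_cone_iff]
      rcases hnn.eq_or_lt with h0 | hpos
      · obtain ⟨y, hy⟩ := exists_mem_simplexBoundary n
        refine ⟨_, ⟨y, hy, rfl⟩, 0, by simp, ?_⟩
        have h1 := (Finset.sum_eq_zero_iff_of_nonneg (fun i _ => hx.1 _)).1 h0.symm
        ext j
        refine Fin.cases ?_ (fun j => ?_) j
        · simp
          linarith
        · simp [h1 j (Finset.mem_univ j)]
      · obtain ⟨j, rfl⟩ := Fin.exists_succ_eq.2 hi0
        refine ⟨_, ⟨fun i => x i.succ / (1 - x 0), ⟨⟨fun i => ?_, ?_⟩, j, by simp [hi]⟩, rfl⟩,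
          1 - x 0, ⟨by linarith, by linarith [hx.1 0]⟩, ?_⟩
        · exact div_nonneg (hx.1 _) (by linarith)
        · rw [← Finset.sum_div, div_eq_one_iff_eq (by linarith)]
          linarith
        · ext j
          refine Fin.cases ?_ (fun j => ?_) j
          · simp
          · have : 1 - x 0 ≠ 0 := by linarith
            simp [mul_div_cancel₀ _ this]
    by_cases hi0 : i = 0
    · left
      subst hi0
      refine ⟨fun i => x i.succ, ?_, htail x hi⟩
      rw [← faceIncl_mem_stdSimplex, htail x hi]
      exact hx
    · exact Or.inr (hcase i hi hi0)
  · rintro x (⟨y, hy, rfl⟩ | hx)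
    · exact ⟨faceIncl_mem_stdSimplex.2 hy, 0, rfl⟩
    · obtain ⟨_, ⟨y, ⟨hy, i, hi⟩, rfl⟩, t, ht, rfl⟩ := mem_cone_iff.1 hx
      refine ⟨convex_stdSimplex ℝ _ (single_mem_stdSimplex ℝ _) (faceIncl_mem_stdSimplex.2 hy)
        (by linarith [ht.2]) ht.1 (by ring), i.succ, ?_⟩
      simp [hi]

variable {E : Type*} [NormedAddCommGroup E] [NormedSpace ℝ E] [FiniteDimensional ℝ E]

/-- Two PL balls that meet exactly in their common boundary form a PL sphere. -/
theorem isPLSphere_union {n : ℕ} {A B Y : Set E} (hA : IsPLBall (n + 1) A Y)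
    (hB : IsPLBall (n + 1) B Y) (hAB : A ∩ B = Y) : IsPLSphere (n + 1) (A ∪ B) := by
  classical
  obtain ⟨hYA, f, hf, hfY⟩ := isPLBall_iff.1 hA
  obtain ⟨hYB, g, hg, hgY⟩ := isPLBall_iff.1 hB
  set I := faceIncl (n + 2)
  have hIf : PLBij (I ∘ f) A (I '' stdSimplex ℝ (Fin (n + 2))) :=
    (plBij_faceIncl _ (plOn_id_stdSimplex _)).comp hf
  have hfY' : f '' Y = simplexBoundary (n + 1) := by
    ext z
    constructor
    · rintro ⟨y, hy, rfl⟩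
      exact (hfY y (hYA hy)).1 hy
    · intro hz
      obtain ⟨y, hy, rfl⟩ := hf.bijOn.surjOn hz.1
      exact ⟨y, (hfY y hy).2 hz, rfl⟩
  set g' := Function.invFunOn g B
  have hg' : PLBij g' (stdSimplex ℝ (Fin (n + 2))) B := hg.invFunOn
  have hsub : simplexBoundary (n + 1) ⊆ stdSimplex ℝ (Fin (n + 2)) := fun x hx => hx.1
  have hg'g : ∀ x ∈ B, g' (g x) = x := fun x hx => hg.bijOn.injOn.leftInvOn_invFunOn hx
  have hgg' : ∀ x ∈ stdSimplex ℝ (Fin (n + 2)), g (g' x) = x :=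
    fun x hx => hg.bijOn.invOn_invFunOn.2 hx
  have hg'Y : PLBij g' (simplexBoundary (n + 1)) Y := by
    refine ⟨⟨fun x hx => ?_, hg'.bijOn.injOn.mono hsub, fun y hy => ?_⟩,
      hg'.plOn.mono (plOn_id_simplexBoundary _) hsub⟩
    · rw [hgY _ (hg'.bijOn.mapsTo hx.1), hgg' x hx.1]
      exact hx
    · exact ⟨g y, (hgY y (hYB hy)).1 hy, hg'g y (hYB hy)⟩
  have hYpl : PLOn (id : E → E) Y := hg'Y.invFunOn.plOn.polyhedron
  have hfYb : PLBij f Y (simplexBoundary (n + 1)) := by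
    rw [← hfY']
    exact ⟨(hf.bijOn.injOn.mono hYA).bijOn_image, hf.plOn.mono hYpl hYA⟩
  -- The map on `A` prescribes the map on the common boundary. Read in the simplex that models `B`,
  -- it extends over that simplex by coning from the barycentre, with values in the cone from the
  -- vertex `0`. The maps on `A` and `B` then agree on `Y`.
  have hh : PLBij (I ∘ f ∘ g') (simplexBoundary (n + 1)) (I '' simplexBoundary (n + 1)) :=
    (plBij_faceIncl _ (plOn_id_simplexBoundary _)).comp (hfYb.comp hg'Y)
  obtain ⟨k, hk, hkh⟩ := hh.exists_cone (isConeOver_barycenter (n + 1))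
    (isConeOver_faceIncl (n + 2) (simplexBoundary (n + 1)))
  rw [cone_simplexBoundary] at hk
  have hkg := hk.comp hg
  have hkY : ∀ y ∈ Y, k (g y) = I (f y) := by
    intro y hy
    have := hkh (g y) ((hgY y (hYB hy)).1 hy) 1 (by simp)
    simpa [hg'g y (hYB hy)] using this
  let H : E → Fin (n + 3) → ℝ := fun x => if x ∈ A then I (f x) else k (g x)
  have hHA : EqOn H (I ∘ f) A := fun x hx => if_pos hx
  have hHB : EqOn H (k ∘ g) B := fun x hx => by
    by_cases hxA : x ∈ A
    · rw [hHA hxA, Function.comp_apply, Function.comp_apply, hkY x (hAB ▸ ⟨hxA, hx⟩)]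
    · exact if_neg hxA
  refine isPLSphere_iff.2 ⟨H, ?_⟩
  rw [simplexBoundary_succ]
  refine (hIf.congr hHA).union (hkg.congr hHB) ?_
  -- A point of the cone with vanishing coordinate `0` has cone parameter `1`, so the two halves of
  -- the model sphere meet only in the boundary of the face.
  rintro _ ⟨⟨x, hx, rfl⟩, hx'⟩
  obtain ⟨_, ⟨z, hz, rfl⟩, t, ht, e⟩ := mem_cone_iff.1 hx'
  have h0 := congrFun e 0
  simp [I] at h0
  have ht1 : t = 1 := by linarith
  subst ht1
  have hxz : x = z := faceIncl_injective _ (by simpa using e)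
  rw [← hfY'] at hz
  obtain ⟨y, hy, rfl⟩ := hz
  exact ⟨y, hAB.symm ▸ hy, by rw [hHA (hYA hy), hxz]; rfl⟩

/-- A PL sphere is homeomorphic to the round sphere. -/
theorem nonempty_homeomorph_sphere {E : Type*} [NormedAddCommGroup E] [NormedSpace ℝ E]
    {n : ℕ} {X : Set E} (hX : IsPLSphere n X) :
    Nonempty (X ≃ₜ Metric.sphere (0 : EuclideanSpace ℝ (Fin (n + 1))) 1) := by
  obtain ⟨e, -⟩ := hX
  suffices h : Nonempty (simplexBoundary (n + 1) ≃ₜ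
      Metric.sphere (0 : EuclideanSpace ℝ (Fin (n + 1))) 1) from ⟨e.trans h.some⟩
  set β := barycenter (n + 1)
  have hcompact : CompactSpace (simplexBoundary (n + 1)) :=
    isCompact_iff_compactSpace.1 (plOn_id_simplexBoundary _).isCompact
  -- Displacements from the barycentre have coordinate sum `0`, so coordinate `0` can be dropped
  -- without loss. Normalising `ψ` then gives the radial projection to the sphere.
  let ψ : (Fin (n + 2) → ℝ) → EuclideanSpace ℝ (Fin (n + 1)) :=
    fun x => WithLp.toLp 2 (fun i => x i.succ - β i.succ)
  have hψc : Continuous ψ := by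
    refine (PiLp.continuous_toLp 2 _).comp ?_
    fun_prop
  have hψ : ∀ x y : Fin (n + 2) → ℝ, ∑ i, x i = 1 → ∑ i, y i = 1 → ∀ r : ℝ, ψ x = r • ψ y →
      x = (1 - r) • β + r • y := by
    intro x y hx hy r h
    have h1 : ∀ i : Fin (n + 1), x i.succ = (1 - r) * β i.succ + r * y i.succ := by
      intro i
      have := congrArg (fun v : EuclideanSpace ℝ (Fin (n + 1)) => v i) h
      simp [ψ] at this
      linarith
    have hβ := (barycenter_mem (n + 1)).2
    rw [Fin.sum_univ_succ] at hx hy hβ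
    have h2 : ∑ i : Fin (n + 1), x i.succ = (1 - r) * ∑ i : Fin (n + 1), β i.succ +
        r * ∑ i : Fin (n + 1), y i.succ := by
      rw [Finset.mul_sum, Finset.mul_sum, ← Finset.sum_add_distrib]
      exact Finset.sum_congr rfl fun i _ => h1 i
    have hβ' : ∑ i : Fin (n + 1), β i.succ = 1 - β 0 := by linarith
    ext i
    refine Fin.cases ?_ (fun i => ?_) i
    · simp
      rw [hβ'] at h2
      have : ∑ i : Fin (n + 1), y i.succ = 1 - y 0 := by linarith
      rw [this] at h2
      linarith
    · simp [h1 i]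
  have hcone := isConeOver_barycenter (n + 1)
  have key : ∀ x ∈ simplexBoundary (n + 1), ∀ y ∈ simplexBoundary (n + 1), ∀ r ∈ Icc (0 : ℝ) 1,
      ψ x = r • ψ y → r = 1 ∧ x = y := by
    intro x hx y hy r hr h
    have := hcone x hx y hy 1 (by simp) r hr (by
      rw [← hψ x y hx.1.2 hy.1.2 r h]
      simp)
    refine ⟨this.1.symm, this.2.resolve_left one_ne_zero⟩
  have hne : ∀ x ∈ simplexBoundary (n + 1), ψ x ≠ 0 := by
    intro x hx h
    have := (key x hx x hx 0 (by simp) (by simp [h])).1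
    norm_num at this
  let φ : simplexBoundary (n + 1) → Metric.sphere (0 : EuclideanSpace ℝ (Fin (n + 1))) 1 :=
    fun x => ⟨‖ψ x‖⁻¹ • ψ x, by simp [norm_smul, hne x x.2]⟩
  have hφc : Continuous φ := by
    refine Continuous.subtype_mk ?_ _
    have h1 : Continuous fun x : simplexBoundary (n + 1) => ψ x :=
      hψc.comp continuous_subtype_val
    exact (h1.norm.inv₀ fun x => norm_ne_zero_iff.2 (hne x x.2)).smul h1
  have hφ : Function.Bijective φ := by
    constructor
    · rintro x y h
      have h1 : ‖ψ x‖⁻¹ • ψ x = ‖ψ y‖⁻¹ • ψ y := congrArg Subtype.val h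
      have hx0 := norm_pos_iff.2 (hne x x.2)
      have hy0 := norm_pos_iff.2 (hne y y.2)
      rcases le_total ‖ψ x‖ ‖ψ y‖ with hle | hle
      · refine Subtype.ext (key x x.2 y y.2 (‖ψ x‖ * ‖ψ y‖⁻¹) ⟨by positivity, ?_⟩ ?_).2
        · rw [← div_eq_mul_inv]
          exact (div_le_one hy0).2 hle
        · rw [mul_smul, ← h1, smul_smul, mul_inv_cancel₀ hx0.ne', one_smul]
      · refine Subtype.ext (key y y.2 x x.2 (‖ψ y‖ * ‖ψ x‖⁻¹) ⟨by positivity, ?_⟩ ?_).2.symm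
        · rw [← div_eq_mul_inv]
          exact (div_le_one hx0).2 hle
        · rw [mul_smul, h1, smul_smul, mul_inv_cancel₀ hy0.ne', one_smul]
    · rintro ⟨v, hv⟩
      have hv1 : ‖v‖ = 1 := by simpa using hv
      let x : Fin (n + 2) → ℝ := β + Fin.cons (-∑ i, v i) (fun i => v i)
      have hx : ∑ i, x i = 1 := by
        have hβ := (barycenter_mem (n + 1)).2
        simp only [x, Pi.add_apply, Finset.sum_add_distrib]
        rw [hβ, Fin.sum_univ_succ]
        simp
      have hψx : ψ x = v := by
        ext i
        simp [ψ, x]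
      -- Surjectivity: the ray from the barycentre in the direction of `v` meets the boundary of the
      -- simplex.
      obtain ⟨y, hy, t, ht, -, e⟩ := exists_ray x hx
      have hty : v = t • ψ y := by
        rw [← hψx]
        ext i
        rw [e]
        simp [ψ, β]
        ring
      refine ⟨⟨y, hy⟩, Subtype.ext ?_⟩
      have h2 : t * ‖ψ y‖ = 1 := by
        rw [← hv1, hty, norm_smul, Real.norm_of_nonneg ht]
      change ‖ψ y‖⁻¹ • ψ y = v
      rw [hty, eq_comm, eq_inv_of_mul_eq_one_left h2]
  exact ⟨Continuous.homeoOfEquivCompactToT2 (f := Equiv.ofBijective φ hφ) hφc⟩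

end Gluing

end PLTopology


namespace PLTopology

open Set Filter Topology

/-! ### Barycentric coordinates in simplicial complexes. -/

section Barycentric

variable {E F : Type*} [NormedAddCommGroup E] [NormedSpace ℝ E]
  [NormedAddCommGroup F] [NormedSpace ℝ F]

/-- `w` is a system of convex weights on `σ` for the point `x`. -/
structure IsWeight (σ : Finset E) (w : E → ℝ) (x : E) : Prop where
  zero : ∀ v ∉ σ, w v = 0
  nonneg : ∀ v, 0 ≤ w v
  sum : ∑ v ∈ σ, w v = 1
  comb : ∑ v ∈ σ, w v • v = x

theorem exists_isWeight {σ : Finset E} {x : E} (h : x ∈ convexHull ℝ (σ : Set E)) :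
    ∃ w, IsWeight σ w x := by
  classical
  obtain ⟨w, h0, h1, h2⟩ := Finset.mem_convexHull'.1 h
  refine ⟨fun v => if v ∈ σ then w v else 0, fun v hv => if_neg hv, fun v => ?_, ?_, ?_⟩
  · split_ifs with hv
    exacts [h0 v hv, le_rfl]
  · rw [← h1]
    exact Finset.sum_congr rfl fun v hv => if_pos hv
  · rw [← h2]
    exact Finset.sum_congr rfl fun v hv => by rw [if_pos hv]

theorem IsWeight.mem_convexHull {σ : Finset E} {w : E → ℝ} {x : E} (h : IsWeight σ w x) :
    x ∈ convexHull ℝ (σ : Set E) :=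
  Finset.mem_convexHull'.2 ⟨w, fun v _ => h.nonneg v, h.sum, h.comb⟩

theorem IsWeight.mono {σ τ : Finset E} {w : E → ℝ} {x : E} (h : IsWeight σ w x) (hστ : σ ⊆ τ) :
    IsWeight τ w x := by
  refine ⟨fun v hv => h.zero v fun h' => hv (hστ h'), h.nonneg, ?_, ?_⟩
  · rw [← h.sum]
    exact (Finset.sum_subset hστ fun v _ hv => h.zero v hv).symm
  · rw [← h.comb]
    exact (Finset.sum_subset hστ fun v _ hv => by rw [h.zero v hv, zero_smul]).symm

theorem IsWeight.combo {σ : Finset E} {w w' : E → ℝ} {x x' : E} (h : IsWeight σ w x)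
    (h' : IsWeight σ w' x') {s : ℝ} (hs : s ∈ Icc (0 : ℝ) 1) :
    IsWeight σ (fun v => (1 - s) * w v + s * w' v) ((1 - s) • x + s • x') := by
  refine ⟨fun v hv => by simp [h.zero v hv, h'.zero v hv], fun v => ?_, ?_, ?_⟩
  · exact add_nonneg (mul_nonneg (by linarith [hs.2]) (h.nonneg v)) (mul_nonneg hs.1 (h'.nonneg v))
  · rw [Finset.sum_add_distrib, ← Finset.mul_sum, ← Finset.mul_sum, h.sum, h'.sum]
    ring
  · rw [← h.comb, ← h'.comb, Finset.smul_sum, Finset.smul_sum, ← Finset.sum_add_distrib]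
    exact Finset.sum_congr rfl fun v _ => by rw [add_smul, mul_smul, mul_smul]

theorem IsWeight.unique_of_affineIndependent {σ : Finset E}
    (hσ : AffineIndependent ℝ ((↑) : σ → E)) {w w' : E → ℝ} {x : E} (h : IsWeight σ w x)
    (h' : IsWeight σ w' x) : w = w' := by
  ext v
  by_cases hv : v ∈ σ
  · have h1 := (affineIndependent_iff.1 hσ) Finset.univ (fun v => w v - w' v) (by
      rw [Finset.sum_coe_sort σ (fun v => w v - w' v), Finset.sum_sub_distrib, h.sum, h'.sum,
        sub_self]) (by
      rw [Finset.sum_coe_sort σ (fun v => (w v - w' v) • v)]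
      simp_rw [sub_smul]
      rw [Finset.sum_sub_distrib, h.comb, h'.comb, sub_self]) ⟨v, hv⟩ (Finset.mem_univ _)
    exact sub_eq_zero.1 h1
  · rw [h.zero v hv, h'.zero v hv]

/-- Barycentric coordinates in a simplicial complex are unique. -/
theorem IsWeight.unique {Δ : Geometry.SimplicialComplex ℝ E} {σ τ : Finset E} (hσ : σ ∈ Δ.faces)
    (hτ : τ ∈ Δ.faces) {w w' : E → ℝ} {x : E} (h : IsWeight σ w x) (h' : IsWeight τ w' x) :
    w = w' := by
  classical
  have hx := Δ.inter_subset_convexHull hσ hτ ⟨h.mem_convexHull, h'.mem_convexHull⟩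
  rw [← Finset.coe_inter] at hx
  obtain ⟨w'', h''⟩ := exists_isWeight hx
  rw [h.unique_of_affineIndependent (Δ.indep hσ) (h''.mono Finset.inter_subset_left),
    h'.unique_of_affineIndependent (Δ.indep hτ) (h''.mono Finset.inter_subset_right)]

open Classical in
/-- Uniqueness of the decomposition of a point of a join inside a simplicial complex whose vertices
are split into two classes. -/
theorem join_unique {Δ : Geometry.SimplicialComplex ℝ E} (S : E → Prop) {e f e' f' : Finset E}
    (h : e ∪ f ∈ Δ.faces) (h' : e' ∪ f' ∈ Δ.faces) (he : ∀ v ∈ e, S v) (hf : ∀ v ∈ f, ¬ S v)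
    (he' : ∀ v ∈ e', S v) (hf' : ∀ v ∈ f', ¬ S v) {y z y' z' : E}
    (hy : y ∈ convexHull ℝ (e : Set E)) (hz : z ∈ convexHull ℝ (f : Set E))
    (hy' : y' ∈ convexHull ℝ (e' : Set E)) (hz' : z' ∈ convexHull ℝ (f' : Set E)) {s s' : ℝ}
    (hs : s ∈ Icc (0 : ℝ) 1) (hs' : s' ∈ Icc (0 : ℝ) 1)
    (heq : (1 - s) • y + s • z = (1 - s') • y' + s' • z') :
    s = s' ∧ (s = 1 ∨ y = y') ∧ (s = 0 ∨ z = z') := by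
  obtain ⟨w, hw⟩ := exists_isWeight hy
  obtain ⟨u, hu⟩ := exists_isWeight hz
  obtain ⟨w', hw'⟩ := exists_isWeight hy'
  obtain ⟨u', hu'⟩ := exists_isWeight hz'
  have h1 := (hw.mono (τ := e ∪ f) Finset.subset_union_left).combo
    (hu.mono Finset.subset_union_right) hs
  have h2 := (hw'.mono (τ := e' ∪ f') Finset.subset_union_left).combo
    (hu'.mono Finset.subset_union_right) hs'
  rw [heq] at h1
  -- Both sides have the same barycentric coordinates. Vertices satisfying `S` carry only the first
  -- summand and the others only the second, so the two summands can be compared separately; the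
  -- total weight of the second one is `s`.
  have h3 := IsWeight.unique h h' h1 h2
  have hwv : ∀ v, (1 - s) * w v = (1 - s') * w' v := by
    intro v
    have := congrFun h3 v
    by_cases hv : S v
    · have e1 : u v = 0 := hu.zero v fun hvf => hf v hvf hv
      have e2 : u' v = 0 := hu'.zero v fun hvf => hf' v hvf hv
      simpa [e1, e2] using this
    · rw [hw.zero v fun hve => hv (he v hve), hw'.zero v fun hve => hv (he' v hve)]
      simp
  have huv : ∀ v, s * u v = s' * u' v := by
    intro v
    have := congrFun h3 v
    have := hwv v
    linarith
  have hss : s = s' := by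
    have e1 := (hu.mono (τ := f ∪ f') Finset.subset_union_left).sum
    have e2 := (hu'.mono (τ := f ∪ f') Finset.subset_union_right).sum
    have : s * ∑ v ∈ f ∪ f', u v = s' * ∑ v ∈ f ∪ f', u' v := by
      rw [Finset.mul_sum, Finset.mul_sum]
      exact Finset.sum_congr rfl fun v _ => huv v
    rwa [e1, e2, mul_one, mul_one] at this
  subst hss
  refine ⟨rfl, ?_, ?_⟩
  · by_cases hs1 : s = 1
    · exact Or.inl hs1
    · right
      have : w = w' := funext fun v => mul_left_cancel₀ (sub_ne_zero.2 (Ne.symm hs1)) (hwv v)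
      subst this
      rw [← (hw.mono (τ := e ∪ e') Finset.subset_union_left).comb,
        (hw'.mono (τ := e ∪ e') Finset.subset_union_right).comb]
  · by_cases hs0 : s = 0
    · exact Or.inl hs0
    · right
      have : u = u' := funext fun v => mul_left_cancel₀ hs0 (huv v)
      subst this
      rw [← (hu.mono (τ := f ∪ f') Finset.subset_union_left).comb,
        (hu'.mono (τ := f ∪ f') Finset.subset_union_right).comb]

theorem exists_affineMap_of_affineIndependent (φ : E → F) (σ : Finset E)
    (hσ : AffineIndependent ℝ ((↑) : σ → E)) : ∃ A : E →ᵃ[ℝ] F, ∀ v ∈ σ, A v = φ v := by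
  classical
  induction σ using Finset.induction_on with
  | empty => exact ⟨AffineMap.const ℝ E 0, by simp⟩
  | insert c s hc ih =>
    have hsub : (s : Set E) ⊆ ((insert c s : Finset E) : Set E) := by simp
    obtain ⟨A, hA⟩ := ih (AffineIndependent.mono (s := (s : Set E))
      (t := ((insert c s : Finset E) : Set E)) hσ hsub)
    rcases s.eq_empty_or_nonempty with rfl | ⟨y₀, hy₀⟩
    · exact ⟨AffineMap.const ℝ E (φ c), by simp⟩
    have hc' : c ∉ affineSpan ℝ (s : Set E) := by
      have := hσ.notMem_affineSpan_sdiff ⟨c, Finset.mem_insert_self c s⟩ Set.univ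
      intro hcs
      refine this ?_
      convert hcs using 2
      ext v
      simp only [Set.mem_image, Set.mem_sdiff, mem_univ, mem_singleton_iff, true_and, Finset.mem_coe]
      constructor
      · rintro ⟨⟨v, hv⟩, hne, rfl⟩
        exact (Finset.mem_insert.1 hv).resolve_left fun e => hne (Subtype.ext e)
      · intro hv
        exact ⟨⟨v, Finset.mem_insert_of_mem hv⟩, fun e => hc (by rwa [← Subtype.mk.inj e]), rfl⟩
    obtain ⟨B, hB, hBA⟩ := exists_affineMap_extend (subset_affineSpan ℝ (s : Set E) hy₀) hc' A (φ c)
    refine ⟨B, fun v hv => ?_⟩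
    rcases Finset.mem_insert.1 hv with rfl | hv
    · exact hB
    · rw [hBA v (subset_affineSpan ℝ (s : Set E) hv), hA v hv]

theorem affineMap_eqOn_convexHull {A B : E →ᵃ[ℝ] F} {σ : Finset E} (h : ∀ v ∈ σ, A v = B v) :
    EqOn A B (convexHull ℝ (σ : Set E)) := by
  intro x hx
  obtain ⟨w, -, hw1, rfl⟩ := Finset.mem_convexHull'.1 hx
  rw [affineMap_sum _ _ _ _ hw1, affineMap_sum _ _ _ _ hw1]
  exact Finset.sum_congr rfl fun v hv => by rw [h v hv]

end Barycentric

/-! ### Polygonal arcs, parametrised by tent functions so that they are continuous on the whole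
line. -/

section Arcs

variable {E : Type*} [NormedAddCommGroup E] [NormedSpace ℝ E]

/-- The tent function. -/
def tent (t : ℝ) : ℝ := max 0 (1 - |t|)

theorem continuous_tent : Continuous tent := by
  unfold tent
  fun_prop

theorem tent_zero : tent 0 = 1 := by simp [tent]

theorem tent_eq_one {t : ℝ} (h : tent t = 1) : t = 0 := by
  unfold tent at h
  rcases max_choice (0 : ℝ) (1 - |t|) with h' | h' <;> rw [h'] at h
  · norm_num at h
  · exact abs_eq_zero.1 (by linarith)

theorem tent_of_one_le {t : ℝ} (h : 1 ≤ |t|) : tent t = 0 := max_eq_left (by linarith)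

theorem tent_nonneg (t : ℝ) : 0 ≤ tent t := le_max_left _ _

theorem tent_sub {t : ℝ} {j : ℕ} (h : t ∈ Icc (j : ℝ) (j + 1)) : tent (t - j) = 1 - (t - j) := by
  have : |t - j| = t - j := abs_of_nonneg (by linarith [h.1])
  rw [tent, this, max_eq_right (by linarith [h.2])]

theorem tent_sub_succ {t : ℝ} {j : ℕ} (h : t ∈ Icc (j : ℝ) (j + 1)) :
    tent (t - ((j + 1 : ℕ) : ℝ)) = t - j := by
  push_cast
  have : |t - (j + 1)| = j + 1 - t := by rw [abs_of_nonpos (by linarith [h.2])]; ring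
  rw [tent, this, max_eq_right (by linarith [h.1])]
  ring

theorem tent_sub_other {t : ℝ} {j k : ℕ} (h : t ∈ Icc (j : ℝ) (j + 1)) (h1 : k ≠ j)
    (h2 : k ≠ j + 1) : tent (t - k) = 0 := by
  apply tent_of_one_le
  rcases lt_or_gt_of_ne h1 with hk | hk
  · have : (k : ℝ) + 1 ≤ j := by exact_mod_cast hk
    rw [le_abs]
    left
    linarith [h.1]
  · have : (j : ℝ) + 1 + 1 ≤ k := by exact_mod_cast (by omega : j + 1 + 1 ≤ k)
    rw [le_abs]
    right
    linarith [h.2]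

/-- The polygonal arc through the points `x 0, …, x n`. -/
noncomputable def arc (x : ℕ → E) (n : ℕ) (t : ℝ) : E :=
  ∑ k ∈ Finset.range (n + 1), tent (t - k) • x k

theorem continuous_arc (x : ℕ → E) (n : ℕ) : Continuous (arc x n) := by
  unfold arc
  exact continuous_finsetSum _ fun k _ =>
    (continuous_tent.comp (continuous_id.sub continuous_const)).smul continuous_const

/-- On the `j`-th unit interval all tents vanish except those centred at `j` and `j + 1`. -/
theorem arc_of_mem (x : ℕ → E) {n j : ℕ} (hj : j < n) {t : ℝ} (h : t ∈ Icc (j : ℝ) (j + 1)) :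
    arc x n t = (1 - (t - j)) • x j + (t - j) • x (j + 1) := by
  have := Finset.sum_eq_add (s := Finset.range (n + 1)) (f := fun k : ℕ => tent (t - k) • x k)
    j (j + 1) (by omega) (fun k _ hk => by rw [tent_sub_other h hk.1 hk.2, zero_smul])
    (fun hn => absurd (Finset.mem_range.2 (by omega)) hn)
    (fun hn => absurd (Finset.mem_range.2 (by omega)) hn)
  rw [arc, this, tent_sub h, tent_sub_succ h]

theorem exists_nat_of_mem_Icc {n : ℕ} (hn : 1 ≤ n) {t : ℝ} (ht : t ∈ Icc (0 : ℝ) n) :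
    ∃ j < n, t ∈ Icc (j : ℝ) (j + 1) := by
  rcases ht.2.eq_or_lt with h | h
  · refine ⟨n - 1, by omega, ?_, ?_⟩ <;> rw [h, Nat.cast_sub hn] <;> simp
  · refine ⟨⌊t⌋₊, (Nat.floor_lt ht.1).2 h, Nat.floor_le ht.1, (Nat.lt_floor_add_one t).le⟩

theorem arc_natCast (x : ℕ → E) {n j : ℕ} (hj : j ≤ n) (hn : 1 ≤ n) : arc x n j = x j := by
  rcases hj.eq_or_lt with rfl | h
  · obtain ⟨k, rfl⟩ := Nat.exists_eq_add_of_le' hn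
    rw [arc_of_mem x (Nat.lt_succ_self k) (by push_cast; simp)]
    push_cast
    simp
  · rw [arc_of_mem x h (by simp)]
    simp

/-- Tent functions interpolate the identity exactly. This is used to recover a parameter from the
tent weights. -/
theorem arc_real {n : ℕ} (hn : 1 ≤ n) {t : ℝ} (ht : t ∈ Icc (0 : ℝ) n) :
    arc (fun k => (k : ℝ)) n t = t := by
  obtain ⟨j, hj, h⟩ := exists_nat_of_mem_Icc hn ht
  rw [arc_of_mem _ hj h]
  simp
  ring

/-- An arc is affine on each of its edges. -/
theorem arc_combo (x : ℕ → E) {n j : ℕ} (hj : j < n) {t t' r : ℝ} (h : t ∈ Icc (j : ℝ) (j + 1))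
    (h' : t' ∈ Icc (j : ℝ) (j + 1)) (hr : r ∈ Icc (0 : ℝ) 1) :
    arc x n ((1 - r) * t + r * t') = (1 - r) • arc x n t + r • arc x n t' := by
  rw [arc_of_mem x hj h, arc_of_mem x hj h', arc_of_mem x hj]
  · module
  · have := (convex_Icc (j : ℝ) (j + 1)) h h' (a := 1 - r) (b := r) (by linarith [hr.2]) hr.1
      (by ring)
    simpa using this

theorem arc_image_Icc (x : ℕ → E) {n j : ℕ} (hj : j < n) {t t' : ℝ} (h : t ∈ Icc (j : ℝ) (j + 1))
    (h' : t' ∈ Icc (j : ℝ) (j + 1)) : arc x n '' uIcc t t' = segment ℝ (arc x n t) (arc x n t') := by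
  rw [← segment_eq_uIcc, segment_eq_image, segment_eq_image, image_image]
  refine image_congr fun r hr => ?_
  rw [← arc_combo x hj h h' hr, smul_eq_mul, smul_eq_mul]

end Arcs

end PLTopology


namespace BalancedComplex

open Set PLTopology

/-! ### Links, arc systems and uniqueness of join coordinates. -/

section Links

variable {E : Type*} [AddCommGroup E] [Module ℝ E]

open Classical in
theorem mem_linkComplex {Δ : Geometry.SimplicialComplex ℝ E} {σ γ : Finset E} :
    γ ∈ (linkComplex Δ σ).faces ↔ γ ∈ Δ.faces ∧ γ ∪ σ ∈ Δ.faces ∧ Disjoint γ σ := by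
  change (γ ∈ Δ.faces ∧ IsSimplex Δ (γ ∪ σ)) ∧ Disjoint γ σ ↔ _
  constructor
  · rintro ⟨⟨h1, h2 | h2⟩, h3⟩
    · have := Δ.nonempty_of_mem_faces h1
      simp [Finset.union_eq_empty] at h2
      simp [h2.1] at this
    · exact ⟨h1, h2, h3⟩
  · rintro ⟨h1, h2, h3⟩
    exact ⟨⟨h1, Or.inr h2⟩, h3⟩

open Classical in
theorem mem_starComplex {Δ : Geometry.SimplicialComplex ℝ E} {σ γ : Finset E} :
    γ ∈ (starComplex Δ σ).faces ↔ γ ∈ Δ.faces ∧ γ ∪ σ ∈ Δ.faces := by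
  change (γ ∈ Δ.faces ∧ IsSimplex Δ (γ ∪ σ)) ↔ _
  constructor
  · rintro ⟨h1, h2 | h2⟩
    · have := Δ.nonempty_of_mem_faces h1
      simp [Finset.union_eq_empty] at h2
      simp [h2.1] at this
    · exact ⟨h1, h2⟩
  · rintro ⟨h1, h2⟩
    exact ⟨h1, Or.inr h2⟩

end Links

/-- Parameters on the arcs `i` and `i'` that describe the same point of a theta graph whose arcs
have lengths `n 0`, `n 1`, `n 2`. -/
def SameParam (n : Fin 3 → ℕ) (i : Fin 3) (t : ℝ) (i' : Fin 3) (t' : ℝ) : Prop :=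
  (i = i' ∧ t = t') ∨ (t = 0 ∧ t' = 0) ∨ (t = n i ∧ t' = n i')

open Classical in
/-- A simplicial complex that is covered by the joins of the edges of three arcs
`x i 0, …, x i (n i)`, which form a theta graph, with complexes `L i`. The vertices of the arcs
satisfy `S`, those of the complexes `L i` do not. -/
structure ArcSystem {E : Type*} [NormedAddCommGroup E] [NormedSpace ℝ E]
    (Δ : Geometry.SimplicialComplex ℝ E) (S : E → Prop) (n : Fin 3 → ℕ) (x : Fin 3 → ℕ → E)
    (L : Fin 3 → Geometry.SimplicialComplex ℝ E) : Prop where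
  finite : Δ.faces.Finite
  pos : ∀ i, 1 ≤ n i
  start : ∀ i i', x i 0 = x i' 0
  finish : ∀ i i', x i (n i) = x i' (n i')
  inj : ∀ i i' j j', j ≤ n i → j' ≤ n i' → x i j = x i' j' →
    (i = i' ∧ j = j') ∨ (j = 0 ∧ j' = 0) ∨ (j = n i ∧ j' = n i')
  -- Two arcs consisting of one edge each would be the same edge.
  long : ∀ i i', n i = 1 → n i' = 1 → i = i'
  mem_S : ∀ i j, j ≤ n i → S (x i j)
  notMem_S : ∀ i, ∀ σ ∈ (L i).faces, ∀ v ∈ σ, ¬ S v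
  link : ∀ i j, j < n i → linkComplex Δ {x i j, x i (j + 1)} = L i
  nonempty : ∀ i, (L i).faces.Nonempty
  cover : ∀ σ ∈ Δ.faces, ∃ i, ∃ j < n i, ∃ τ ∈ (L i).faces, σ ⊆ {x i j, x i (j + 1)} ∪ τ
  -- Needed for simple connectivity: it makes the complement of both ends of the arcs path
  -- connected.
  meet : ∀ i, ∃ i' ≠ i, ∃ σ, σ ∈ (L i).faces ∧ σ ∈ (L i').faces

namespace ArcSystem

variable {E : Type*} [NormedAddCommGroup E] [NormedSpace ℝ E]
  {Δ : Geometry.SimplicialComplex ℝ E} {S : E → Prop} {n : Fin 3 → ℕ} {x : Fin 3 → ℕ → E}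
  {L : Fin 3 → Geometry.SimplicialComplex ℝ E}

open Classical in
theorem face (A : ArcSystem Δ S n x L) {i : Fin 3} {j : ℕ} (hj : j < n i) {σ : Finset E}
    (hσ : σ ∈ (L i).faces) : {x i j, x i (j + 1)} ∪ σ ∈ Δ.faces := by
  rw [← A.link i j hj, mem_linkComplex] at hσ
  rw [Finset.union_comm]
  exact hσ.2.1

theorem inj_self (A : ArcSystem Δ S n x L) {i : Fin 3} {j j' : ℕ} (hj : j ≤ n i) (hj' : j' ≤ n i)
    (h : x i j = x i j') : j = j' := by
  rcases A.inj i i j j' hj hj' h with h | h | h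
  exacts [h.2, h.1.trans h.2.symm, h.1.trans h.2.symm]

open Classical in
theorem edge_face (A : ArcSystem Δ S n x L) {i : Fin 3} {j : ℕ} (hj : j < n i) :
    {x i j, x i (j + 1)} ∈ Δ.faces := by
  obtain ⟨σ, hσ⟩ := A.nonempty i
  exact Δ.down_closed (A.face hj hσ) Finset.subset_union_left (by simp)

-- The barycentric coordinate of an arc point at the `k`-th vertex is the tent value `tent (t - k)`,
-- independently of the edge containing the point. Comparing points of arcs thus becomes comparing
-- tent values.
open Classical in
theorem exists_isWeight_arc (A : ArcSystem Δ S n x L) {i : Fin 3} {t : ℝ}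
    (ht : t ∈ Icc (0 : ℝ) (n i)) : ∃ σ ∈ Δ.faces, ∃ w, IsWeight σ w (arc (x i) (n i) t) ∧
      (∀ k ≤ n i, w (x i k) = tent (t - k)) ∧ ∀ v, (∀ k ≤ n i, x i k ≠ v) → w v = 0 := by
  obtain ⟨j, hj, htj⟩ := exists_nat_of_mem_Icc (A.pos i) ht
  have hne : x i j ≠ x i (j + 1) := fun h => by
    have := A.inj_self hj.le hj h
    omega
  let w : E → ℝ := fun v => ∑ k ∈ Finset.range (n i + 1), if x i k = v then tent (t - k) else 0
  have hw : ∀ k ≤ n i, w (x i k) = tent (t - k) := by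
    intro k hk
    refine (Finset.sum_eq_single_of_mem k (Finset.mem_range.2 (by omega)) ?_).trans (if_pos rfl)
    intro k' hk' hne
    refine if_neg fun h => hne (A.inj_self ?_ hk h)
    have := Finset.mem_range.1 hk'
    omega
  have hw' : ∀ v, (∀ k ≤ n i, x i k ≠ v) → w v = 0 := by
    intro v hv
    refine Finset.sum_eq_zero fun k hk => if_neg (hv k ?_)
    have := Finset.mem_range.1 hk
    omega
  refine ⟨_, A.edge_face hj, w, ⟨?_, ?_, ?_, ?_⟩, hw, hw'⟩
  · intro v hv
    refine Finset.sum_eq_zero fun k _ => ?_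
    split_ifs with h
    · subst h
      refine tent_sub_other htj ?_ ?_ <;> rintro rfl <;> simp at hv
    · rfl
  · intro v
    refine Finset.sum_nonneg fun k _ => ?_
    split_ifs
    exacts [tent_nonneg _, le_rfl]
  · rw [Finset.sum_pair hne, hw j hj.le, hw (j + 1) hj, tent_sub htj, tent_sub_succ htj]
    ring
  · rw [Finset.sum_pair hne, hw j hj.le, hw (j + 1) hj, tent_sub htj, tent_sub_succ htj,
      arc_of_mem _ hj htj]

theorem arc_zero (A : ArcSystem Δ S n x L) (i : Fin 3) : arc (x i) (n i) 0 = x i 0 := by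
  have := arc_natCast (x i) (Nat.zero_le _) (A.pos i)
  simpa using this

theorem arc_end (A : ArcSystem Δ S n x L) (i : Fin 3) : arc (x i) (n i) (n i) = x i (n i) :=
  arc_natCast (x i) le_rfl (A.pos i)

/-- Equal points have equal barycentric coordinates. On one arc these determine the parameter; on
two arcs they must vanish at all interior vertices, which leaves only the common ends. -/
theorem arc_eq_iff (A : ArcSystem Δ S n x L) {i i' : Fin 3} {t t' : ℝ}
    (ht : t ∈ Icc (0 : ℝ) (n i)) (ht' : t' ∈ Icc (0 : ℝ) (n i')) :
    arc (x i) (n i) t = arc (x i') (n i') t' ↔ SameParam n i t i' t' := by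
  constructor
  · intro h
    obtain ⟨σ, hσ, w, hw, hwx, hw0⟩ := A.exists_isWeight_arc ht
    obtain ⟨σ', hσ', w', hw', hwx', hw0'⟩ := A.exists_isWeight_arc ht'
    rw [h] at hw
    have hww := IsWeight.unique hσ hσ' hw hw'
    subst hww
    by_cases hi : i = i'
    · subst hi
      left
      refine ⟨rfl, ?_⟩
      -- The parameter is the combination of the vertex numbers with the tent values as weights.
      rw [← arc_real (A.pos i) ht, ← arc_real (A.pos i) ht']
      refine Finset.sum_congr rfl fun k hk => ?_
      have hk : k ≤ n i := by
        have := Finset.mem_range.1 hk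
        omega
      rw [← hwx k hk, ← hwx' k hk]
    -- If the point also lies on another arc, its weights at interior vertices of arc `i` are zero.
    -- So it is an end of arc `i`, unless that arc is a single edge; `long` ensures that this
    -- exception does not occur on both arcs.
    · have key : ∀ {i i' : Fin 3} {t : ℝ}, i ≠ i' → t ∈ Icc (0 : ℝ) (n i) →
          (∀ k ≤ n i, w (x i k) = tent (t - k)) →
          (∀ v, (∀ k ≤ n i', x i' k ≠ v) → w v = 0) → t = 0 ∨ t = n i ∨ n i = 1 := by
        intro i i' t hi ht hwx hw0
        have hint : ∀ k, 0 < k → k < n i → tent (t - k) = 0 := by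
          intro k h0 hk
          rw [← hwx k hk.le]
          refine hw0 _ fun k' hk' e => ?_
          rcases A.inj i' i k' k hk' hk.le e with h | h | h
          · exact hi h.1.symm
          · omega
          · omega
        obtain ⟨j, hj, htj⟩ := exists_nat_of_mem_Icc (A.pos i) ht
        rcases Nat.eq_zero_or_pos j with rfl | h0
        · by_cases h1 : 1 < n i
          · have := hint 1 one_pos h1
            have e := tent_sub_succ htj
            simp only [zero_add] at e
            rw [e] at this
            left
            simpa using this
          · right
            right
            omega
        · have e1 := hint j h0 hj
          rw [tent_sub htj] at e1
          right
          left
          by_cases h1 : j + 1 < n i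
          · have e2 := hint (j + 1) (by omega) h1
            rw [tent_sub_succ htj] at e2
            linarith
          · have : n i = j + 1 := by omega
            rw [this]
            push_cast
            linarith
      have e0 : tent t = tent t' := by
        have h1 := hwx 0 (Nat.zero_le _)
        have h2 := hwx' 0 (Nat.zero_le _)
        rw [A.start i i', h2] at h1
        simpa using h1.symm
      have en : tent (t - n i) = tent (t' - n i') := by
        have h1 := hwx (n i) le_rfl
        rw [A.finish i i', hwx' (n i') le_rfl] at h1
        exact h1.symm
      rcases key hi ht hwx hw0' with h | h | h
      · rw [h, tent_zero] at e0
        exact Or.inr (Or.inl ⟨h, tent_eq_one e0.symm⟩)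
      · rw [h, sub_self, tent_zero] at en
        exact Or.inr (Or.inr ⟨h, sub_eq_zero.1 (tent_eq_one en.symm)⟩)
      · rcases key (Ne.symm hi) ht' hwx' hw0 with h' | h' | h'
        · rw [h', tent_zero] at e0
          exact Or.inr (Or.inl ⟨tent_eq_one e0, h'⟩)
        · rw [h', sub_self, tent_zero] at en
          exact Or.inr (Or.inr ⟨sub_eq_zero.1 (tent_eq_one en), h'⟩)
        · exact (hi (A.long i i' h h')).elim
  · rintro (⟨rfl, rfl⟩ | ⟨rfl, rfl⟩ | ⟨rfl, rfl⟩)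
    · rfl
    · rw [A.arc_zero, A.arc_zero, A.start]
    · rw [A.arc_end, A.arc_end, A.finish i i']

open Classical in
theorem arc_mem_convexHull {j : ℕ} {i : Fin 3} (hj : j < n i) {t : ℝ}
    (h : t ∈ Icc (j : ℝ) (j + 1)) :
    arc (x i) (n i) t ∈ convexHull ℝ (({x i j, x i (j + 1)} : Finset E) : Set E) := by
  rw [Finset.coe_pair, convexHull_pair, arc_of_mem _ hj h]
  exact ⟨1 - (t - j), t - j, by linarith [h.2], by linarith [h.1], by ring, rfl⟩

/-- The points of the join of an arc with its complex have unique parameters. -/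
theorem joinPoint_eq_iff (A : ArcSystem Δ S n x L) {i i' : Fin 3} {t t' s s' : ℝ} {z z' : E}
    (ht : t ∈ Icc (0 : ℝ) (n i)) (ht' : t' ∈ Icc (0 : ℝ) (n i')) (hs : s ∈ Icc (0 : ℝ) 1)
    (hs' : s' ∈ Icc (0 : ℝ) 1) (hz : z ∈ (L i).space) (hz' : z' ∈ (L i').space) :
    (1 - s) • arc (x i) (n i) t + s • z = (1 - s') • arc (x i') (n i') t' + s' • z' ↔
      s = s' ∧ (s = 1 ∨ SameParam n i t i' t') ∧ (s = 0 ∨ z = z') := by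
  classical
  constructor
  · intro h
    obtain ⟨j, hj, htj⟩ := exists_nat_of_mem_Icc (A.pos i) ht
    obtain ⟨j', hj', htj'⟩ := exists_nat_of_mem_Icc (A.pos i') ht'
    obtain ⟨σ, hσ, hzσ⟩ := (L i).mem_space_iff.1 hz
    obtain ⟨σ', hσ', hzσ'⟩ := (L i').mem_space_iff.1 hz'
    have hS : ∀ i j, j < n i → ∀ v ∈ ({x i j, x i (j + 1)} : Finset E), S v := by
      intro i j hj v hv
      rcases Finset.mem_insert.1 hv with rfl | hv
      · exact A.mem_S i j hj.le
      · rw [Finset.mem_singleton.1 hv]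
        exact A.mem_S i (j + 1) hj
    have := join_unique S (A.face hj hσ) (A.face hj' hσ') (hS i j hj) (A.notMem_S i σ hσ)
      (hS i' j' hj') (A.notMem_S i' σ' hσ') (arc_mem_convexHull hj htj) hzσ
      (arc_mem_convexHull hj' htj') hzσ' hs hs' h
    rwa [A.arc_eq_iff ht ht'] at this
  · rintro ⟨rfl, h1, h2⟩
    congr 1
    · rcases h1 with rfl | h1
      · simp
      · rw [(A.arc_eq_iff ht ht').2 h1]
    · rcases h2 with rfl | rfl
      · simp
      · rfl

end ArcSystem

end BalancedComplex


/-! ### Straightening arcs by piecewise linear bijections. -/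

namespace BalancedComplex

open Set PLTopology

/-- Two parametrisations over the same domain that identify the same parameters have images in
canonical bijection. It serves to build bijections between joins without choosing coordinates of
points. -/
theorem exists_bijOn_of_kernel_eq {D X Y : Type*} [Nonempty Y] (s : Set D) (α : D → X) (β : D → Y)
    (h : ∀ d ∈ s, ∀ d' ∈ s, α d = α d' ↔ β d = β d') :
    ∃ f : X → Y, (∀ d ∈ s, f (α d) = β d) ∧ BijOn f (α '' s) (β '' s) := by
  classical
  let f : X → Y := fun x => if hx : ∃ d ∈ s, α d = x then β hx.choose else Classical.arbitrary Y
  have hf : ∀ d ∈ s, f (α d) = β d := by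
    intro d hd
    have hx : ∃ d' ∈ s, α d' = α d := ⟨d, hd, rfl⟩
    have : f (α d) = β hx.choose := dif_pos hx
    rw [this]
    exact (h _ hx.choose_spec.1 _ hd).1 hx.choose_spec.2
  refine ⟨f, hf, ?_, ?_, ?_⟩
  · rintro _ ⟨d, hd, rfl⟩
    exact ⟨d, hd, (hf d hd).symm⟩
  · rintro _ ⟨d, hd, rfl⟩ _ ⟨d', hd', rfl⟩ e
    rw [hf d hd, hf d' hd'] at e
    exact (h d hd d' hd').2 e
  · rintro _ ⟨d, hd, rfl⟩
    exact ⟨α d, ⟨d, hd, rfl⟩, hf d hd⟩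

theorem uIcc_eq_image (p q : ℝ) : uIcc p q = (fun t => (1 - t) * p + t * q) '' Icc 0 1 := by
  rw [← segment_eq_uIcc, segment_eq_image]
  rfl

/-- The join of the part of the `i`-th arc with parameters in `I` with the complex `L i`. -/
noncomputable def joinArc {E : Type*} [NormedAddCommGroup E] [NormedSpace ℝ E]
    (n : Fin 3 → ℕ) (x : Fin 3 → ℕ → E) (L : Fin 3 → Geometry.SimplicialComplex ℝ E) (i : Fin 3)
    (I : Set ℝ) : Set E :=
  convexJoin ℝ (arc (x i) (n i) '' I) (L i).space

namespace ArcSystem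

variable {E : Type*} [NormedAddCommGroup E] [NormedSpace ℝ E]
  {Δ : Geometry.SimplicialComplex ℝ E} {S : E → Prop} {n : Fin 3 → ℕ} {x : Fin 3 → ℕ → E}
  {L : Fin 3 → Geometry.SimplicialComplex ℝ E}

theorem mem_joinArc {i : Fin 3} {I : Set ℝ} {w : E} : w ∈ joinArc n x L i I ↔
    ∃ t ∈ I, ∃ z ∈ (L i).space, ∃ s ∈ Icc (0 : ℝ) 1,
      w = (1 - s) • arc (x i) (n i) t + s • z := by
  rw [joinArc, mem_convexJoin_iff, exists_mem_image]

theorem joinArc_mono {i : Fin 3} {I I' : Set ℝ} (h : I ⊆ I') :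
    joinArc n x L i I ⊆ joinArc n x L i I' :=
  convexJoin_mono_left (image_mono h)

theorem iUnion_joinArc_eq_image (J : Set (Fin 3)) (p q : Fin 3 → ℝ) :
    ⋃ i ∈ J, joinArc n x L i (uIcc (p i) (q i)) =
      (fun d : Fin 3 × ℝ × ℝ × E => (1 - d.2.2.1) •
        arc (x d.1) (n d.1) ((1 - d.2.1) * p d.1 + d.2.1 * q d.1) + d.2.2.1 • d.2.2.2) ''
      {d | d.1 ∈ J ∧ d.2.1 ∈ Icc 0 1 ∧ d.2.2.1 ∈ Icc 0 1 ∧ d.2.2.2 ∈ (L d.1).space} := by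
  ext w
  simp only [mem_iUnion, mem_joinArc, uIcc_eq_image, exists_mem_image, exists_prop]
  constructor
  · rintro ⟨i, hi, t, ht, z, hz, s, hs, rfl⟩
    exact ⟨(i, t, s, z), ⟨hi, ht, hs, hz⟩, rfl⟩
  · rintro ⟨⟨i, t, s, z⟩, ⟨hi, ht, hs, hz⟩, rfl⟩
    exact ⟨i, hi, t, ht, z, hz, s, hs, rfl⟩

theorem faces_subset (A : ArcSystem Δ S n x L) (i : Fin 3) : (L i).faces ⊆ Δ.faces := by
  intro σ hσ
  rw [← A.link i 0 (A.pos i), mem_linkComplex] at hσ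
  exact hσ.1

open Classical in
/-- Straightening arcs: the union of the joins of sub-arcs with the complexes `L i` is PL
homeomorphic to the union of the joins of straight sub-arcs with them, provided that the
identifications of the end points are the same. -/
theorem exists_plBij (A : ArcSystem Δ S n x L) (J : Set (Fin 3)) (p q p' q' : Fin 3 → ℝ)
    (hp : ∀ i ∈ J, p i ∈ Icc (0 : ℝ) (n i)) (hq : ∀ i ∈ J, q i ∈ Icc (0 : ℝ) (n i))
    (hpq : ∀ i ∈ J, p i ≠ q i)
    (hedge : ∀ i ∈ J, ∃ j < n i, p' i ∈ Icc (j : ℝ) (j + 1) ∧ q' i ∈ Icc (j : ℝ) (j + 1))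
    (hsame : ∀ i ∈ J, ∀ i' ∈ J, ∀ t ∈ Icc (0 : ℝ) 1, ∀ t' ∈ Icc (0 : ℝ) 1,
      (SameParam n i ((1 - t) * p i + t * q i) i' ((1 - t') * p i' + t' * q i') ↔
        SameParam n i ((1 - t) * p' i + t * q' i) i' ((1 - t') * p' i' + t' * q' i'))) :
    ∃ f : E → E, PLBij f (⋃ i ∈ J, joinArc n x L i (uIcc (p i) (q i)))
        (⋃ i ∈ J, joinArc n x L i (uIcc (p' i) (q' i))) ∧
      ∀ i ∈ J, ∀ t ∈ Icc (0 : ℝ) 1, ∀ s ∈ Icc (0 : ℝ) 1, ∀ z ∈ (L i).space,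
        f ((1 - s) • arc (x i) (n i) ((1 - t) * p i + t * q i) + s • z) =
          (1 - s) • arc (x i) (n i) ((1 - t) * p' i + t * q' i) + s • z := by
  have hIcc : ∀ {a b c d t : ℝ}, a ∈ Icc c d → b ∈ Icc c d → t ∈ Icc (0 : ℝ) 1 →
      (1 - t) * a + t * b ∈ Icc c d := fun {a b c d t} ha hb ht =>
    convex_Icc c d ha hb (by linarith [ht.2]) ht.1 (by ring)
  have hp' : ∀ i ∈ J, p' i ∈ Icc (0 : ℝ) (n i) ∧ q' i ∈ Icc (0 : ℝ) (n i) := by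
    intro i hi
    obtain ⟨j, hj, h1, h2⟩ := hedge i hi
    have hj' : (j : ℝ) + 1 ≤ n i := by exact_mod_cast hj
    have hj0 : (0 : ℝ) ≤ j := j.cast_nonneg
    exact ⟨⟨hj0.trans h1.1, h1.2.trans hj'⟩, ⟨hj0.trans h2.1, h2.2.trans hj'⟩⟩
  obtain ⟨f, hf, hbij⟩ := exists_bijOn_of_kernel_eq
    {d : Fin 3 × ℝ × ℝ × E | d.1 ∈ J ∧ d.2.1 ∈ Icc 0 1 ∧ d.2.2.1 ∈ Icc 0 1 ∧
      d.2.2.2 ∈ (L d.1).space}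
    (fun d : Fin 3 × ℝ × ℝ × E => (1 - d.2.2.1) •
        arc (x d.1) (n d.1) ((1 - d.2.1) * p d.1 + d.2.1 * q d.1) + d.2.2.1 • d.2.2.2)
    (fun d : Fin 3 × ℝ × ℝ × E => (1 - d.2.2.1) •
        arc (x d.1) (n d.1) ((1 - d.2.1) * p' d.1 + d.2.1 * q' d.1) + d.2.2.1 • d.2.2.2) (by
      rintro ⟨i, t, s, z⟩ ⟨hi, ht, hs, hz⟩ ⟨i', t', s', z'⟩ ⟨hi', ht', hs', hz'⟩
      dsimp only at *
      rw [A.joinPoint_eq_iff (hIcc (hp i hi) (hq i hi) ht) (hIcc (hp i' hi') (hq i' hi') ht')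
        hs hs' hz hz', A.joinPoint_eq_iff (hIcc (hp' i hi).1 (hp' i hi).2 ht)
        (hIcc (hp' i' hi').1 (hp' i' hi').2 ht') hs hs' hz hz', hsame i hi i' hi' t ht t' ht'])
  rw [← iUnion_joinArc_eq_image, ← iUnion_joinArc_eq_image] at hbij
  have hf' : ∀ i ∈ J, ∀ t ∈ Icc (0 : ℝ) 1, ∀ s ∈ Icc (0 : ℝ) 1, ∀ z ∈ (L i).space,
        f ((1 - s) • arc (x i) (n i) ((1 - t) * p i + t * q i) + s • z) =
          (1 - s) • arc (x i) (n i) ((1 - t) * p' i + t * q' i) + s • z :=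
    fun i hi t ht s hs z hz => hf (i, t, s, z) ⟨hi, ht, hs, hz⟩
  refine ⟨f, ⟨hbij, ?_⟩, hf'⟩
  -- The polytopes are joins of a simplex of `L i` with the part of one edge of the arc between the
  -- cutting parameters; `lo` and `hi` are the ends of that part. The parameters `p` and `q` may
  -- come in either order.
  let lo : Fin 3 × ℕ × Finset E → ℝ := fun a => max a.2.1 (min (p a.1) (q a.1))
  let hi : Fin 3 × ℕ × Finset E → ℝ := fun a => min (a.2.1 + 1) (max (p a.1) (q a.1))
  let ι : Set (Fin 3 × ℕ × Finset E) :=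
    {a | a.1 ∈ J ∧ a.2.1 < n a.1 ∧ a.2.2 ∈ (L a.1).faces ∧ lo a ≤ hi a}
  have hfin : ι.Finite := by
    refine (finite_univ.prod ((finite_Iio (∑ i, n i)).prod A.finite)).subset ?_
    rintro ⟨i, j, σ⟩ ⟨-, h2, h3, -⟩
    exact ⟨mem_univ _, h2.trans_le (Finset.single_le_sum (fun _ _ => Nat.zero_le _)
      (Finset.mem_univ i)), A.faces_subset i h3⟩
  have : Finite ι := hfin
  have hull : ∀ a ∈ ι, convexHull ℝ ((({arc (x a.1) (n a.1) (lo a), arc (x a.1) (n a.1) (hi a)} ∪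
      a.2.2 : Finset E)) : Set E) =
      convexJoin ℝ (arc (x a.1) (n a.1) '' Icc (lo a) (hi a)) (convexHull ℝ (a.2.2 : Set E)) := by
    rintro a ⟨-, h2, h3, h4⟩
    have hne : (a.2.2 : Set E).Nonempty := (L a.1).nonempty_of_mem_faces h3
    rw [Finset.coe_union, convexHull_union (by simp) hne, Finset.coe_pair, convexHull_pair,
      ← arc_image_Icc (x a.1) h2 (t := lo a) (t' := hi a)
        ⟨le_max_left _ _, h4.trans (min_le_left _ _)⟩
        ⟨(le_max_left _ _).trans h4, min_le_left _ _⟩, uIcc_of_le h4]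
  refine PLOn.of_finite (fun a : ι => {arc (x a.1.1) (n a.1.1) (lo a),
    arc (x a.1.1) (n a.1.1) (hi a)} ∪ a.1.2.2) ?_ ?_
  · ext w
    simp only [mem_iUnion, mem_joinArc, exists_prop]
    constructor
    · rintro ⟨⟨⟨i, j, σ⟩, ha⟩, hw⟩
      rw [hull _ ha, mem_convexJoin_iff, exists_mem_image] at hw
      obtain ⟨t, ht, z, hz, s, hs, rfl⟩ := hw
      exact ⟨i, ha.1, t, ⟨(le_max_right _ _).trans ht.1, ht.2.trans (min_le_right _ _)⟩, z,
        (L i).convexHull_subset_space ha.2.2.1 hz, s, hs, rfl⟩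
    · rintro ⟨i, hi, t, ht, z, hz, s, hs, rfl⟩
      obtain ⟨σ, hσ, hzσ⟩ := (L i).mem_space_iff.1 hz
      have ht' : t ∈ Icc (0 : ℝ) (n i) :=
        ⟨(le_min (hp i hi).1 (hq i hi).1).trans ht.1, ht.2.trans (max_le (hp i hi).2 (hq i hi).2)⟩
      obtain ⟨j, hj, htj⟩ := exists_nat_of_mem_Icc (A.pos i) ht'
      have h1 : lo (i, j, σ) ≤ t := max_le htj.1 ht.1
      have h2 : t ≤ _ := le_min htj.2 ht.2
      refine ⟨⟨(i, j, σ), hi, hj, hσ, h1.trans h2⟩, ?_⟩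
      rw [hull _ ⟨hi, hj, hσ, h1.trans h2⟩, mem_convexJoin_iff, exists_mem_image]
      exact ⟨t, ⟨h1, h2⟩, z, hzσ, s, hs, rfl⟩
  · rintro ⟨⟨i, j, σ⟩, ha⟩
    obtain ⟨hi, hj, hσ, hle⟩ := id ha
    dsimp only at hi hj hσ
    obtain ⟨k, hk, hp'k, hq'k⟩ := hedge i hi
    let line : ℝ → E := fun r =>
      (1 - r) • arc (x i) (n i) (p' i) + r • arc (x i) (n i) (q' i)
    have hd : q i - p i ≠ 0 := sub_ne_zero.2 (hpq i hi).symm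
    -- The affine map fixes the vertices of `σ` and sends the ends of the edge to points of the
    -- affine extension of the target segment. These may lie beyond the segment, since the edge may
    -- reach beyond the sub-arc. The map agrees with `f` because the target stays within one edge,
    -- on which the arc is affine.
    obtain ⟨B, hB⟩ := exists_affineMap_of_affineIndependent
      (fun v => if v = x i j then line ((j - p i) / (q i - p i)) else
        if v = x i (j + 1) then line ((j + 1 - p i) / (q i - p i)) else v) _
      (Δ.indep (A.face hj hσ))
    have hxne : x i (j + 1) ≠ x i j := fun h => by
      have := A.inj_self hj hj.le h
      omega
    have hB0 : B (x i j) = line ((j - p i) / (q i - p i)) := by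
      rw [hB _ (by simp), if_pos rfl]
    have hB1 : B (x i (j + 1)) = line ((j + 1 - p i) / (q i - p i)) := by
      rw [hB _ (by simp), if_neg hxne, if_pos rfl]
    have hBσ : EqOn B (AffineMap.id ℝ E) (convexHull ℝ (σ : Set E)) := by
      refine affineMap_eqOn_convexHull fun v hv => ?_
      have hvS := A.notMem_S i σ hσ v hv
      rw [hB _ (Finset.mem_union_right _ hv), if_neg, if_neg]
      · rfl
      · rintro rfl
        exact hvS (A.mem_S i (j + 1) hj)
      · rintro rfl
        exact hvS (A.mem_S i j hj.le)
    refine ⟨B, fun w hw => ?_⟩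
    rw [hull _ ha, mem_convexJoin_iff, exists_mem_image] at hw
    obtain ⟨t, ht, z, hz, s, hs, rfl⟩ := hw
    have htj : t ∈ Icc (j : ℝ) (j + 1) :=
      ⟨(le_max_left _ _).trans ht.1, ht.2.trans (min_le_left _ _)⟩
    have htu : t ∈ uIcc (p i) (q i) :=
      ⟨(le_max_right _ _).trans ht.1, ht.2.trans (min_le_right _ _)⟩
    rw [uIcc_eq_image] at htu
    obtain ⟨r, hr, hrt⟩ := htu
    have hBt : B (arc (x i) (n i) t) = line r := by
      have hr' : r = (t - p i) / (q i - p i) := by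
        rw [eq_div_iff hd, ← hrt]
        ring
      rw [arc_of_mem _ hj htj, Convex.combo_affine_apply (by ring), hB0, hB1, hr']
      simp only [line]
      match_scalars <;> field_simp <;> ring
    dsimp only
    rw [Convex.combo_affine_apply (by ring), hBt, hBσ hz, AffineMap.id_apply]
    have := hf' i hi r hr s hs z ((L i).convexHull_subset_space hσ hz)
    dsimp only at hrt
    rw [hrt] at this
    rw [this, arc_combo (x i) hk hp'k hq'k hr]

theorem image_joinArc_singleton {f : E → E} {i : Fin 3} {a b : ℝ}
    (hf : ∀ s ∈ Icc (0 : ℝ) 1, ∀ z ∈ (L i).space,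
      f ((1 - s) • arc (x i) (n i) a + s • z) = (1 - s) • arc (x i) (n i) b + s • z) :
    f '' joinArc n x L i {a} = joinArc n x L i {b} := by
  ext w
  rw [mem_image]
  simp only [mem_joinArc, mem_singleton_iff, exists_eq_left]
  constructor
  · rintro ⟨_, ⟨z, hz, s, hs, rfl⟩, rfl⟩
    exact ⟨z, hz, s, hs, hf s hs z hz⟩
  · rintro ⟨z, hz, s, hs, rfl⟩
    exact ⟨_, ⟨z, hz, s, hs, rfl⟩, hf s hs z hz⟩

end ArcSystem

end BalancedComplex


namespace BalancedComplex

open Set PLTopology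

/-! ### Stars of vertices as cones over links. -/

section StarLink

variable {E : Type*} [NormedAddCommGroup E] [NormedSpace ℝ E]

open Classical in
theorem isConeOver_link (Δ : Geometry.SimplicialComplex ℝ E) (v : E) :
    IsConeOver v (linkComplex Δ {v}).space := by
  intro y hy y' hy' s hs s' hs' h
  obtain ⟨σ, hσ, hyσ⟩ := Geometry.SimplicialComplex.mem_space_iff.1 hy
  obtain ⟨σ', hσ', hyσ'⟩ := Geometry.SimplicialComplex.mem_space_iff.1 hy'
  rw [mem_linkComplex, Finset.union_comm] at hσ hσ'
  have := join_unique (· = v) hσ.2.1 hσ'.2.1 (by simp)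
    (by rintro u hu rfl; exact Finset.disjoint_singleton_right.1 hσ.2.2 hu) (by simp)
    (by rintro u hu rfl; exact Finset.disjoint_singleton_right.1 hσ'.2.2 hu)
    (y := v) (y' := v) (by simp) hyσ (by simp) hyσ' hs hs' h
  exact ⟨this.1, this.2.2⟩

/-- A simplex of the star with `v` removed is empty or a simplex of the link. The link must be
nonempty because `convexJoin` with the empty set is empty and would lose the apex. -/
theorem star_space_eq_cone (Δ : Geometry.SimplicialComplex ℝ E) (v : E)
    (hne : (linkComplex Δ {v}).space.Nonempty) :
    (starComplex Δ {v}).space = convexJoin ℝ {v} (linkComplex Δ {v}).space := by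
  classical
  apply Subset.antisymm
  · intro y hy
    obtain ⟨σ, hσ, hyσ⟩ := Geometry.SimplicialComplex.mem_space_iff.1 hy
    rw [mem_starComplex] at hσ
    have hv : y ∈ convexHull ℝ (insert v ((σ.erase v : Finset E) : Set E)) := by
      refine convexHull_mono ?_ hyσ
      intro u hu
      by_cases h : u = v
      · exact Or.inl h
      · exact Or.inr (Finset.mem_coe.2 (Finset.mem_erase.2 ⟨h, hu⟩))
    rcases (σ.erase v).eq_empty_or_nonempty with h | h
    · rw [h, Finset.coe_empty, insert_empty_eq, convexHull_singleton, mem_singleton_iff] at hv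
      obtain ⟨z, hz⟩ := hne
      exact mem_cone_iff.2 ⟨z, hz, 0, by simp, by simp [hv]⟩
    · rw [convexHull_insert h] at hv
      refine convexJoin_mono_right (Geometry.SimplicialComplex.convexHull_subset_space ?_) hv
      rw [mem_linkComplex]
      refine ⟨Δ.down_closed hσ.1 (Finset.erase_subset _ _) h, ?_, by simp⟩
      exact Δ.down_closed hσ.2 (Finset.union_subset_union_left (Finset.erase_subset _ _))
        (h.mono Finset.subset_union_left)
  · intro y hy
    obtain ⟨z, hz, t, ht, rfl⟩ := mem_cone_iff.1 hy
    obtain ⟨σ, hσ, hzσ⟩ := Geometry.SimplicialComplex.mem_space_iff.1 hz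
    rw [mem_linkComplex] at hσ
    refine Geometry.SimplicialComplex.mem_space_iff.2 ⟨σ ∪ {v}, ?_, ?_⟩
    · rw [mem_starComplex, Finset.union_assoc, Finset.union_self]
      exact ⟨hσ.2.1, hσ.2.1⟩
    · refine convex_convexHull ℝ _ ?_ ?_ (by linarith [ht.2]) ht.1 (by ring)
      · exact subset_convexHull ℝ _ (by simp)
      · exact convexHull_mono (by simp) hzσ

theorem isPLSphere_nonempty {m : ℕ} {X : Set E} (h : IsPLSphere m X) : X.Nonempty := by
  obtain ⟨e, -⟩ := h
  obtain ⟨y, hy⟩ := exists_mem_simplexBoundary m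
  exact ⟨e.symm ⟨y, hy⟩, (e.symm ⟨y, hy⟩).2⟩

/-- The star of a vertex whose link is a PL sphere is a PL ball. -/
theorem isPLBall_star [FiniteDimensional ℝ E] {Δ : Geometry.SimplicialComplex ℝ E} {v : E} {m : ℕ}
    (h : IsPLSphere m (linkComplex Δ {v}).space) :
    IsPLBall (m + 1) (starComplex Δ {v}).space (linkComplex Δ {v}).space := by
  rw [star_space_eq_cone Δ v (isPLSphere_nonempty h)]
  exact isPLBall_cone h (isConeOver_link Δ v)

end StarLink

/-! ### Stars and links of arc vertices as joins. -/

namespace ArcSystem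

variable {E : Type*} [NormedAddCommGroup E] [NormedSpace ℝ E]
  {Δ : Geometry.SimplicialComplex ℝ E} {S : E → Prop} {n : Fin 3 → ℕ} {x : Fin 3 → ℕ → E}
  {L : Fin 3 → Geometry.SimplicialComplex ℝ E}

open Classical in
theorem mem_joinArc_edge {i : Fin 3} {j : ℕ} (hj : j < n i) {w : E} :
    w ∈ joinArc n x L i (Icc j (j + 1)) ↔ ∃ σ ∈ (L i).faces,
      w ∈ convexHull ℝ ((({x i j, x i (j + 1)} ∪ σ : Finset E)) : Set E) := by
  have h : ∀ σ ∈ (L i).faces, convexHull ℝ ((({x i j, x i (j + 1)} ∪ σ : Finset E)) : Set E) =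
      convexJoin ℝ (arc (x i) (n i) '' Icc j (j + 1)) (convexHull ℝ (σ : Set E)) := by
    intro σ hσ
    have hne : (σ : Set E).Nonempty := (L i).nonempty_of_mem_faces hσ
    have h0 : (j : ℝ) ≤ j + 1 := by linarith
    rw [Finset.coe_union, convexHull_union (by simp) hne, Finset.coe_pair, convexHull_pair,
      ← uIcc_of_le h0, arc_image_Icc (x i) hj (by simp) (by simp), arc_natCast _ hj.le (by omega)]
    have := arc_natCast (x i) hj (by omega : 1 ≤ n i)
    push_cast at this
    rw [this]
  rw [joinArc, mem_convexJoin_iff]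
  constructor
  · rintro ⟨y, hy, z, hz, t, ht, rfl⟩
    obtain ⟨σ, hσ, hzσ⟩ := Geometry.SimplicialComplex.mem_space_iff.1 hz
    refine ⟨σ, hσ, ?_⟩
    rw [h σ hσ, mem_convexJoin_iff]
    exact ⟨y, hy, z, hzσ, t, ht, rfl⟩
  · rintro ⟨σ, hσ, hw⟩
    rw [h σ hσ, mem_convexJoin_iff] at hw
    obtain ⟨y, hy, z, hz, t, ht, rfl⟩ := hw
    exact ⟨y, hy, z, (L i).convexHull_subset_space hσ hz, t, ht, rfl⟩

open Classical in
theorem mem_joinArc_vertex {i : Fin 3} {j : ℕ} (hj : j ≤ n i) (hn : 1 ≤ n i) {w : E} :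
    w ∈ joinArc n x L i {(j : ℝ)} ↔ ∃ σ ∈ (L i).faces,
      w ∈ convexHull ℝ (((insert (x i j) σ : Finset E)) : Set E) := by
  rw [joinArc, image_singleton, arc_natCast _ hj hn, mem_cone_iff]
  constructor
  · rintro ⟨z, hz, t, ht, rfl⟩
    obtain ⟨σ, hσ, hzσ⟩ := Geometry.SimplicialComplex.mem_space_iff.1 hz
    refine ⟨σ, hσ, ?_⟩
    rw [Finset.coe_insert, convexHull_insert ((L i).nonempty_of_mem_faces hσ), mem_cone_iff]
    exact ⟨z, hzσ, t, ht, rfl⟩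
  · rintro ⟨σ, hσ, hw⟩
    rw [Finset.coe_insert, convexHull_insert ((L i).nonempty_of_mem_faces hσ), mem_cone_iff] at hw
    obtain ⟨z, hz, t, ht, rfl⟩ := hw
    exact ⟨z, (L i).convexHull_subset_space hσ hz, t, ht, rfl⟩

/-- By `cover`, a simplex together with `v` lies in the join of an edge of an arc with a simplex of
some `L i`. The latter has no vertex satisfying `S`, so `v` is an end of the edge. -/
theorem mem_star_space (A : ArcSystem Δ S n x L) {v : E} (hv : S v) {w : E} :
    w ∈ (starComplex Δ {v}).space ↔ ∃ i, ∃ j < n i, (x i j = v ∨ x i (j + 1) = v) ∧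
      w ∈ joinArc n x L i (Icc j (j + 1)) := by
  classical
  rw [Geometry.SimplicialComplex.mem_space_iff]
  constructor
  · rintro ⟨σ, hσ, hw⟩
    rw [mem_starComplex] at hσ
    obtain ⟨i, j, hj, τ, hτ, hsub⟩ := A.cover _ hσ.2
    refine ⟨i, j, hj, ?_, (mem_joinArc_edge hj).2 ⟨τ, hτ, convexHull_mono ?_ hw⟩⟩
    · rcases Finset.mem_union.1 (hsub (Finset.mem_union_right σ (Finset.mem_singleton_self v)))
        with h | h
      · rcases Finset.mem_insert.1 h with h | h
        · exact Or.inl h.symm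
        · exact Or.inr (Finset.mem_singleton.1 h).symm
      · exact (A.notMem_S i τ hτ v h hv).elim
    · exact_mod_cast Finset.subset_union_left.trans hsub
  · rintro ⟨i, j, hj, hor, hw⟩
    obtain ⟨τ, hτ, hw⟩ := (mem_joinArc_edge hj).1 hw
    refine ⟨_, ?_, hw⟩
    have hvm : ({v} : Finset E) ⊆ {x i j, x i (j + 1)} ∪ τ := by
      rw [Finset.singleton_subset_iff]
      rcases hor with rfl | rfl <;> simp
    rw [mem_starComplex, Finset.union_eq_left.2 hvm]
    exact ⟨A.face hj hτ, A.face hj hτ⟩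

/-- As for the star; deleting `v` from the join of an edge with a simplex of `L i` leaves the cone
from the opposite end of the edge. -/
theorem mem_link_space (A : ArcSystem Δ S n x L) {v : E} (hv : S v) {w : E} :
    w ∈ (linkComplex Δ {v}).space ↔ ∃ i, ∃ j < n i,
      (x i j = v ∧ w ∈ joinArc n x L i {((j + 1 : ℕ) : ℝ)}) ∨
        (x i (j + 1) = v ∧ w ∈ joinArc n x L i {(j : ℝ)}) := by
  classical
  rw [Geometry.SimplicialComplex.mem_space_iff]
  have hne : ∀ i j, j < n i → x i j ≠ x i (j + 1) := fun i j hj h => by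
    have := A.inj_self hj.le hj h
    omega
  constructor
  · rintro ⟨σ, hσ, hw⟩
    rw [mem_linkComplex, Finset.disjoint_singleton_right] at hσ
    obtain ⟨i, j, hj, τ, hτ, hsub⟩ := A.cover _ hσ.2.1
    refine ⟨i, j, hj, ?_⟩
    rcases Finset.mem_union.1 (hsub (Finset.mem_union_right σ (Finset.mem_singleton_self v)))
      with h | h
    · rcases Finset.mem_insert.1 h with rfl | h
      · refine Or.inl ⟨rfl, (mem_joinArc_vertex hj (A.pos i)).2 ⟨τ, hτ, convexHull_mono ?_ hw⟩⟩
        intro u hu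
        have := hsub (Finset.mem_union_left _ hu)
        have hux : u ≠ x i j := by
          rintro rfl
          exact hσ.2.2 hu
        simp only [Finset.mem_union, Finset.mem_insert, Finset.mem_singleton, hux, false_or] at this
        simpa using this
      · have h := Finset.mem_singleton.1 h
        subst h
        refine Or.inr ⟨rfl, (mem_joinArc_vertex hj.le (A.pos i)).2
          ⟨τ, hτ, convexHull_mono ?_ hw⟩⟩
        intro u hu
        have := hsub (Finset.mem_union_left _ hu)
        have hux : u ≠ x i (j + 1) := by
          rintro rfl
          exact hσ.2.2 hu
        simp only [Finset.mem_union, Finset.mem_insert, Finset.mem_singleton, hux, or_false] at this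
        simpa using this
    · exact (A.notMem_S i τ hτ v h hv).elim
  · rintro ⟨i, j, hj, ⟨rfl, hw⟩ | ⟨rfl, hw⟩⟩
    · obtain ⟨τ, hτ, hw⟩ := (mem_joinArc_vertex hj (A.pos i)).1 hw
      refine ⟨_, mem_linkComplex.2 ⟨?_, ?_, ?_⟩, hw⟩
      · refine Δ.down_closed (A.face hj hτ) ?_ (by simp)
        intro u hu
        rcases Finset.mem_insert.1 hu with rfl | hu <;> simp [*]
      · convert A.face hj hτ using 1
        ext u
        simp
        tauto
      · rw [Finset.disjoint_singleton_right, Finset.mem_insert, not_or]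
        exact ⟨hne i j hj, fun h => A.notMem_S i τ hτ _ h (A.mem_S i j hj.le)⟩
    · obtain ⟨τ, hτ, hw⟩ := (mem_joinArc_vertex hj.le (A.pos i)).1 hw
      refine ⟨_, mem_linkComplex.2 ⟨?_, ?_, ?_⟩, hw⟩
      · refine Δ.down_closed (A.face hj hτ) ?_ (by simp)
        intro u hu
        rcases Finset.mem_insert.1 hu with rfl | hu <;> simp [*]
      · convert A.face hj hτ using 1
        ext u
        simp
      · rw [Finset.disjoint_singleton_right, Finset.mem_insert, not_or]
        exact ⟨(hne i j hj).symm, fun h => A.notMem_S i τ hτ _ h (A.mem_S i (j + 1) hj)⟩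

theorem space_eq (A : ArcSystem Δ S n x L) : Δ.space = ⋃ i, joinArc n x L i (Icc 0 (n i)) := by
  classical
  ext w
  rw [Geometry.SimplicialComplex.mem_space_iff, mem_iUnion]
  constructor
  · rintro ⟨σ, hσ, hw⟩
    obtain ⟨i, j, hj, τ, hτ, hsub⟩ := A.cover _ hσ
    have hj' : (j : ℝ) + 1 ≤ n i := by exact_mod_cast hj
    refine ⟨i, joinArc_mono (Icc_subset_Icc j.cast_nonneg hj')
      ((mem_joinArc_edge hj).2 ⟨τ, hτ, convexHull_mono ?_ hw⟩)⟩
    exact_mod_cast hsub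
  · rintro ⟨i, hw⟩
    obtain ⟨t, ht, z, hz, s, hs, rfl⟩ := mem_joinArc.1 hw
    obtain ⟨j, hj, htj⟩ := exists_nat_of_mem_Icc (A.pos i) ht
    obtain ⟨σ, hσ, h⟩ := (mem_joinArc_edge hj).1 (mem_joinArc.2 ⟨t, htj, z, hz, s, hs, rfl⟩)
    exact ⟨_, A.face hj hσ, h⟩

theorem eq_start_iff (A : ArcSystem Δ S n x L) {i k : Fin 3} {j : ℕ} (hj : j ≤ n i) :
    x i j = x k 0 ↔ j = 0 := by
  constructor
  · intro h
    have h1 := A.pos k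
    rcases A.inj i k j 0 hj (Nat.zero_le _) h with h | h | h <;> omega
  · rintro rfl
    exact A.start i k

theorem eq_finish_iff (A : ArcSystem Δ S n x L) {i k : Fin 3} {j : ℕ} (hj : j ≤ n i) :
    x i j = x k (n k) ↔ j = n i := by
  constructor
  · intro h
    have h1 := A.pos k
    rcases A.inj i k j (n k) hj le_rfl h with h | h | h
    · rw [h.2, h.1]
    · omega
    · exact h.1
  · rintro rfl
    exact A.finish i k

theorem eq_inner_iff (A : ArcSystem Δ S n x L) {i k : Fin 3} {j l : ℕ} (hj : j ≤ n i)
    (h0 : 0 < l) (hl : l < n k) : x i j = x k l ↔ i = k ∧ j = l := by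
  constructor
  · intro h
    rcases A.inj i k j l hj hl.le h with h | h | h
    · exact h
    · omega
    · omega
  · rintro ⟨rfl, rfl⟩
    rfl

theorem star_start (A : ArcSystem Δ S n x L) (k : Fin 3) :
    (starComplex Δ {x k 0}).space = ⋃ i, joinArc n x L i (Icc 0 1) := by
  ext w
  rw [A.mem_star_space (A.mem_S k 0 (Nat.zero_le _)), mem_iUnion]
  constructor
  · rintro ⟨i, j, hj, h, hw⟩
    rw [A.eq_start_iff hj.le, A.eq_start_iff hj] at h
    have : j = 0 := by omega
    subst this
    exact ⟨i, by simpa using hw⟩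
  · rintro ⟨i, hw⟩
    exact ⟨i, 0, A.pos i, Or.inl (A.start i k), by simpa using hw⟩

theorem link_start (A : ArcSystem Δ S n x L) (k : Fin 3) :
    (linkComplex Δ {x k 0}).space = ⋃ i, joinArc n x L i {1} := by
  ext w
  rw [A.mem_link_space (A.mem_S k 0 (Nat.zero_le _)), mem_iUnion]
  constructor
  · rintro ⟨i, j, hj, ⟨h, hw⟩ | ⟨h, hw⟩⟩
    · rw [A.eq_start_iff hj.le] at h
      subst h
      exact ⟨i, by simpa using hw⟩
    · rw [A.eq_start_iff hj] at h
      omega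
  · rintro ⟨i, hw⟩
    exact ⟨i, 0, A.pos i, Or.inl ⟨A.start i k, by simpa using hw⟩⟩

theorem star_finish (A : ArcSystem Δ S n x L) (k : Fin 3) :
    (starComplex Δ {x k (n k)}).space = ⋃ i, joinArc n x L i (Icc (n i - 1) (n i)) := by
  ext w
  rw [A.mem_star_space (A.mem_S k (n k) le_rfl), mem_iUnion]
  constructor
  · rintro ⟨i, j, hj, h, hw⟩
    rw [A.eq_finish_iff hj.le, A.eq_finish_iff hj] at h
    have : n i = j + 1 := by omega
    refine ⟨i, ?_⟩
    rw [this]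
    push_cast
    simpa using hw
  · rintro ⟨i, hw⟩
    have h1 := A.pos i
    refine ⟨i, n i - 1, by omega, Or.inr ?_, ?_⟩
    · rw [A.eq_finish_iff (by omega)]
      omega
    · rw [Nat.cast_sub h1]
      simpa using hw

theorem link_finish (A : ArcSystem Δ S n x L) (k : Fin 3) :
    (linkComplex Δ {x k (n k)}).space = ⋃ i, joinArc n x L i {(n i : ℝ) - 1} := by
  ext w
  rw [A.mem_link_space (A.mem_S k (n k) le_rfl), mem_iUnion]
  constructor
  · rintro ⟨i, j, hj, ⟨h, hw⟩ | ⟨h, hw⟩⟩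
    · rw [A.eq_finish_iff hj.le] at h
      omega
    · rw [A.eq_finish_iff hj] at h
      refine ⟨i, ?_⟩
      rw [← h]
      push_cast
      simpa using hw
  · rintro ⟨i, hw⟩
    have h1 := A.pos i
    refine ⟨i, n i - 1, by omega, Or.inr ⟨?_, ?_⟩⟩
    · rw [A.eq_finish_iff (by omega)]
      omega
    · rw [Nat.cast_sub h1]
      simpa using hw

theorem star_inner (A : ArcSystem Δ S n x L) {k : Fin 3} (hk : 1 < n k) :
    (starComplex Δ {x k 1}).space = joinArc n x L k (Icc 0 2) := by
  ext w
  rw [A.mem_star_space (A.mem_S k 1 hk.le)]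
  constructor
  · rintro ⟨i, j, hj, h, hw⟩
    rw [A.eq_inner_iff hj.le one_pos hk, A.eq_inner_iff hj one_pos hk] at h
    have hi : i = k := by tauto
    subst hi
    refine joinArc_mono (Icc_subset_Icc j.cast_nonneg ?_) hw
    have : j ≤ 1 := by omega
    have : (j : ℝ) ≤ 1 := by exact_mod_cast this
    linarith
  · intro hw
    obtain ⟨t, ht, z, hz, s, hs, rfl⟩ := mem_joinArc.1 hw
    rcases le_total t 1 with h | h
    · exact ⟨k, 0, by omega, Or.inr rfl,
        mem_joinArc.2 ⟨t, by simpa using ⟨ht.1, h⟩, z, hz, s, hs, rfl⟩⟩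
    · exact ⟨k, 1, by omega, Or.inl rfl,
        mem_joinArc.2 ⟨t, ⟨by simpa using h, by norm_num; exact ht.2⟩, z, hz, s, hs, rfl⟩⟩

theorem link_inner (A : ArcSystem Δ S n x L) {k : Fin 3} (hk : 1 < n k) :
    (linkComplex Δ {x k 1}).space = joinArc n x L k {0} ∪ joinArc n x L k {2} := by
  ext w
  rw [A.mem_link_space (A.mem_S k 1 hk.le), mem_union]
  constructor
  · rintro ⟨i, j, hj, ⟨h, hw⟩ | ⟨h, hw⟩⟩
    · rw [A.eq_inner_iff hj.le one_pos hk] at h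
      obtain ⟨rfl, rfl⟩ := h
      right
      simpa using hw
    · rw [A.eq_inner_iff hj one_pos hk] at h
      obtain ⟨rfl, h⟩ := h
      have : j = 0 := by omega
      subst this
      left
      simpa using hw
  · rintro (hw | hw)
    · exact ⟨k, 0, by omega, Or.inr ⟨rfl, by simpa using hw⟩⟩
    · exact ⟨k, 1, hk, Or.inl ⟨rfl, by simpa using hw⟩⟩

end ArcSystem

end BalancedComplex


/-! ### Balls and spheres assembled from joins. -/

namespace BalancedComplex

open Set PLTopology

theorem plBij_isPLBall_image {E F : Type*} [NormedAddCommGroup E] [NormedSpace ℝ E]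
    [NormedAddCommGroup F] [NormedSpace ℝ F] [FiniteDimensional ℝ E] [FiniteDimensional ℝ F]
    {d : ℕ} {f : E → F} {X Y : Set E} {X' : Set F} (hf : PLBij f X X') (h : IsPLBall d X Y) :
    IsPLBall d X' (f '' Y) := by
  have hY := h.1
  refine hf.invFunOn.isPLBall h ?_ ?_
  · rintro _ ⟨y, hy, rfl⟩
    exact hf.bijOn.mapsTo (hY hy)
  · exact (hf.bijOn.injOn.leftInvOn_invFunOn).image_image' hY

namespace ArcSystem

variable {E : Type*} [NormedAddCommGroup E] [NormedSpace ℝ E]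
  {Δ : Geometry.SimplicialComplex ℝ E} {S : E → Prop} {n : Fin 3 → ℕ} {x : Fin 3 → ℕ → E}
  {L : Fin 3 → Geometry.SimplicialComplex ℝ E}

theorem joinArc_union (i : Fin 3) (I I' : Set ℝ) :
    joinArc n x L i (I ∪ I') = joinArc n x L i I ∪ joinArc n x L i I' := by
  rw [joinArc, image_union, convexJoin_union_left]
  rfl

theorem joinArc_inter_subset (A : ArcSystem Δ S n x L) {i i' : Fin 3} {I I' : Set ℝ}
    (hI : I ⊆ Icc 0 (n i)) (hI' : I' ⊆ Icc 0 (n i')) {c : ℝ}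
    (h : ∀ t ∈ I, ∀ t' ∈ I', SameParam n i t i' t' → i = i' ∧ t' = c) :
    joinArc n x L i I ∩ joinArc n x L i' I' ⊆ joinArc n x L i' {c} := by
  rintro w ⟨hw, hw'⟩
  obtain ⟨t, ht, z, hz, s, hs, rfl⟩ := mem_joinArc.1 hw
  obtain ⟨t', ht', z', hz', s', hs', e⟩ := mem_joinArc.1 hw'
  obtain ⟨rfl, h1, h2⟩ := (A.joinPoint_eq_iff (hI ht) (hI' ht') hs hs' hz hz').1 e
  refine mem_joinArc.2 ⟨c, rfl, z', hz', s, hs, ?_⟩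
  rw [e]
  rcases h1 with rfl | h1
  · simp
  · rw [(h t ht t' ht' h1).2]

theorem isConeOver_arc (A : ArcSystem Δ S n x L) {i : Fin 3} {t : ℝ} (ht : t ∈ Icc (0 : ℝ) (n i)) :
    IsConeOver (arc (x i) (n i) t) (L i).space := by
  intro z hz z' hz' s hs s' hs' h
  have := (A.joinPoint_eq_iff ht ht hs hs' hz hz').1 h
  exact ⟨this.1, this.2.2⟩

variable {d : ℕ}

theorem isPLSphere_branch (A : ArcSystem Δ S n x L) (hM : IsPLManifold d Δ) (hd : 2 ≤ d)
    (i : Fin 3) : IsPLSphere (d - 2) (L i).space := by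
  classical
  have hne : x i 0 ≠ x i (0 + 1) := fun h => by
    have := A.inj_self (Nat.zero_le _) (A.pos i) h
    omega
  have hcard := Finset.card_pair hne
  have h := hM.link_sphere _ (A.edge_face (A.pos i)) (by rw [hcard]; exact hd)
  rwa [hcard, A.link i 0 (A.pos i)] at h

theorem isPLSphere_link_vertex (A : ArcSystem Δ S n x L) (hM : IsPLManifold d Δ) (hd : 2 ≤ d)
    {i : Fin 3} {j : ℕ} (hj : j ≤ n i) : IsPLSphere (d - 1) (linkComplex Δ {x i j}).space := by
  classical
  have hv : {x i j} ∈ Δ.faces := by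
    rcases hj.eq_or_lt with rfl | h
    · have h1 := A.pos i
      have h2 := A.edge_face (i := i) (j := n i - 1) (by omega)
      rw [Nat.sub_add_cancel h1] at h2
      exact Δ.down_closed h2 (by simp) (by simp)
    · exact Δ.down_closed (A.edge_face h) (by simp) (by simp)
  have := hM.link_sphere _ hv (by rw [Finset.card_singleton]; omega)
  rwa [Finset.card_singleton] at this

/-- The join of a point of an arc with its complex is a PL ball. -/
theorem isPLBall_joinArc_singleton [FiniteDimensional ℝ E] (A : ArcSystem Δ S n x L)
    (hM : IsPLManifold d Δ) (hd : 2 ≤ d)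
    {i : Fin 3} {t : ℝ} (ht : t ∈ Icc (0 : ℝ) (n i)) :
    IsPLBall (d - 1) (joinArc n x L i {t}) (L i).space := by
  have h := isPLBall_cone (A.isPLSphere_branch hM hd i) (A.isConeOver_arc ht)
  rw [joinArc, image_singleton]
  rwa [show d - 2 + 1 = d - 1 by omega] at h

theorem image_iUnion_joinArc {f : E → E} {a b : Fin 3 → ℝ}
    (hf : ∀ i, ∀ s ∈ Icc (0 : ℝ) 1, ∀ z ∈ (L i).space,
      f ((1 - s) • arc (x i) (n i) (a i) + s • z) = (1 - s) • arc (x i) (n i) (b i) + s • z) :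
    f '' (⋃ i, joinArc n x L i {a i}) = ⋃ i, joinArc n x L i {b i} := by
  rw [image_iUnion]
  exact iUnion_congr fun i => image_joinArc_singleton (hf i)

/-- The joins of initial segments of the arcs with the complexes `L i` form a PL ball. -/
theorem isPLBall_initial [FiniteDimensional ℝ E] (A : ArcSystem Δ S n x L)
    (hM : IsPLManifold d Δ) (hd : 2 ≤ d)
    {c : Fin 3 → ℝ} (hc0 : ∀ i, 0 < c i) (hc : ∀ i, c i < n i) :
    IsPLBall d (⋃ i, joinArc n x L i (Icc 0 (c i))) (⋃ i, joinArc n x L i {c i}) := by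
  have hn : ∀ i, (1 : ℝ) ≤ n i := fun i => by exact_mod_cast A.pos i
  -- All initial segments are rescaled to the first edges, whose joins form the star of the start.
  -- The identifications correspond: parameters coincide only on the same arc or at the start.
  obtain ⟨f, hf, hft⟩ := A.exists_plBij univ (fun _ => 0) c (fun _ => 0) (fun _ => 1)
    (fun i _ => ⟨le_rfl, (n i).cast_nonneg⟩) (fun i _ => ⟨(hc0 i).le, (hc i).le⟩)
    (fun i _ => (hc0 i).ne) (fun i _ => ⟨0, A.pos i, by simp, by simp⟩) (by
      rintro i - i' - t ht t' ht'
      simp only [SameParam, mul_zero, zero_add, mul_one]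
      have e : ∀ i, ∀ t ∈ Icc (0 : ℝ) 1, t * c i ≠ n i := fun i t ht e => by
        nlinarith [hc0 i, hc i, ht.1, ht.2]
      constructor
      · rintro (⟨rfl, h⟩ | h | h)
        · exact Or.inl ⟨rfl, mul_right_cancel₀ (hc0 i).ne' h⟩
        · exact Or.inr (Or.inl ⟨(mul_eq_zero.1 h.1).resolve_right (hc0 i).ne',
            (mul_eq_zero.1 h.2).resolve_right (hc0 i').ne'⟩)
        · exact (e i t ht h.1).elim
      · rintro (⟨rfl, h⟩ | h | h)
        · exact Or.inl ⟨rfl, by rw [h]⟩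
        · exact Or.inr (Or.inl ⟨by rw [h.1, zero_mul], by rw [h.2, zero_mul]⟩)
        -- The rescaled segments reach the end only on arcs with a single edge. There is at most one
        -- such arc, so no new identification arises.
        · have h1 : n i = 1 := by
            have : (n i : ℝ) = 1 := le_antisymm (h.1 ▸ ht.2) (hn i)
            exact_mod_cast this
          have h2 : n i' = 1 := by
            have : (n i' : ℝ) = 1 := le_antisymm (h.2 ▸ ht'.2) (hn i')
            exact_mod_cast this
          have hii := A.long i i' h1 h2
          subst hii
          exact Or.inl ⟨rfl, by rw [h.1, h.2]⟩)
  simp only [mem_univ, iUnion_true, uIcc_of_le (zero_le_one' ℝ)] at hf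
  have e1 : ∀ i, uIcc 0 (c i) = Icc 0 (c i) := fun i => uIcc_of_le (hc0 i).le
  simp only [e1] at hf
  have hball := isPLBall_star (A.isPLSphere_link_vertex hM hd (Nat.zero_le (n 0)))
  rw [A.star_start, A.link_start, show d - 1 + 1 = d by omega] at hball
  refine hf.isPLBall hball (iUnion_mono fun i => joinArc_mono ?_)
    (image_iUnion_joinArc fun i s hs z hz => ?_)
  · simpa using (hc0 i).le
  · have := hft i (mem_univ i) 1 (by simp) s hs z hz
    simpa using this

/-- The joins of final segments of the arcs with the complexes `L i` form a PL ball. -/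
theorem isPLBall_final [FiniteDimensional ℝ E] (A : ArcSystem Δ S n x L)
    (hM : IsPLManifold d Δ) (hd : 2 ≤ d)
    {c : Fin 3 → ℝ} (hc0 : ∀ i, 0 < c i) (hc : ∀ i, c i < n i) :
    IsPLBall d (⋃ i, joinArc n x L i (Icc (c i) (n i))) (⋃ i, joinArc n x L i {c i}) := by
  have hn : ∀ i, (1 : ℝ) ≤ n i := fun i => by exact_mod_cast A.pos i
  -- Final segments are parametrised backwards from the end, so that the common point of the arcs
  -- has parameter `0` on all of them; the target consists of the last edges, that is, the star of
  -- the end.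
  obtain ⟨f, hf, hft⟩ := A.exists_plBij univ (fun i => n i) c (fun i => n i) (fun i => n i - 1)
    (fun i _ => ⟨(n i).cast_nonneg, le_rfl⟩) (fun i _ => ⟨(hc0 i).le, (hc i).le⟩)
    (fun i _ => (hc i).ne') (fun i _ => ⟨n i - 1, by have := A.pos i; omega, by
      rw [Nat.cast_sub (A.pos i)]; simp, by rw [Nat.cast_sub (A.pos i)]; simp⟩) (by
      rintro i - i' - t ht t' ht'
      have e0 : ∀ i, ∀ t ∈ Icc (0 : ℝ) 1, (1 - t) * n i + t * c i ≠ 0 := fun i t ht e => by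
        nlinarith [hc0 i, hc i, ht.1, ht.2]
      have e1 : ∀ i (t : ℝ), (1 - t) * n i + t * c i = n i ↔ t = 0 := fun i t => by
        have h0 : (c i - n i : ℝ) ≠ 0 := by linarith [hc i]
        constructor
        · intro h
          have : t * (c i - n i) = 0 := by linarith
          exact (mul_eq_zero.1 this).resolve_right h0
        · rintro rfl
          ring
      have e2 : ∀ i (t : ℝ), (1 - t) * n i + t * (n i - 1) = n i - t := fun i t => by ring
      simp only [SameParam, e1, e2]
      constructor
      · rintro (⟨rfl, h⟩ | h | ⟨rfl, rfl⟩)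
        · left
          refine ⟨rfl, ?_⟩
          have h0 : (c i - n i : ℝ) ≠ 0 := by linarith [hc i]
          have : t = t' := mul_right_cancel₀ h0 (by linarith)
          rw [this]
        · exact (e0 i t ht h.1).elim
        · simp
      · rintro (⟨rfl, h⟩ | h | h)
        · left
          refine ⟨rfl, ?_⟩
          have : t = t' := by linarith
          rw [this]
        · have h1 : n i = 1 := by
            have : (n i : ℝ) = 1 := le_antisymm (by linarith [ht.2]) (hn i)
            exact_mod_cast this
          have h2 : n i' = 1 := by
            have : (n i' : ℝ) = 1 := le_antisymm (by linarith [ht'.2]) (hn i')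
            exact_mod_cast this
          have hii := A.long i i' h1 h2
          subst hii
          left
          refine ⟨rfl, ?_⟩
          have : t = t' := by linarith
          rw [this]
        · right
          right
          exact ⟨by linarith, by linarith⟩)
  simp only [mem_univ, iUnion_true] at hf
  have e1 : ∀ i, uIcc (n i : ℝ) (c i) = Icc (c i) (n i) := fun i => uIcc_of_ge (hc i).le
  have e2 : ∀ i, uIcc (n i : ℝ) (n i - 1) = Icc (n i - 1 : ℝ) (n i) :=
    fun i => uIcc_of_ge (by linarith)
  simp only [e1, e2] at hf
  have hball := isPLBall_star (A.isPLSphere_link_vertex hM hd (le_refl (n 0)))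
  rw [A.star_finish, A.link_finish, show d - 1 + 1 = d by omega] at hball
  refine hf.isPLBall hball (iUnion_mono fun i => joinArc_mono ?_)
    (image_iUnion_joinArc fun i s hs z hz => ?_)
  · simpa using (hc i).le
  · have := hft i (mem_univ i) 1 (by simp) s hs z hz
    simpa using this

/-- The join of a segment of an arc with its complex is PL homeomorphic to the join of the first
edge with it. -/
theorem exists_plBij_middle (A : ArcSystem Δ S n x L) {k : Fin 3} {p q : ℝ} (hp : 0 ≤ p)
    (hq : q ≤ n k) (hpq : p < q) :
    ∃ f : E → E, PLBij f (joinArc n x L k (Icc p q)) (joinArc n x L k (Icc 0 1)) ∧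
      f '' (joinArc n x L k {p} ∪ joinArc n x L k {q}) =
        joinArc n x L k {0} ∪ joinArc n x L k {1} := by
  obtain ⟨f, hf, hft⟩ := A.exists_plBij {k} (fun _ => p) (fun _ => q) (fun _ => 0) (fun _ => 1)
    (by rintro i rfl; exact ⟨hp, hpq.le.trans hq⟩) (by rintro i rfl; exact ⟨hp.trans hpq.le, hq⟩)
    (fun _ _ => hpq.ne) (fun i _ => ⟨0, A.pos i, by simp, by simp⟩) (by
      rintro i rfl i' rfl t ht t' ht'
      have hself : ∀ a b : ℝ, SameParam n i' a i' b ↔ a = b := by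
        intro a b
        constructor
        · rintro (h | h | h)
          exacts [h.2, h.1.trans h.2.symm, h.1.trans h.2.symm]
        · exact fun h => Or.inl ⟨rfl, h⟩
      rw [hself, hself]
      have h0 : q - p ≠ 0 := by linarith
      constructor
      · intro h
        have : t = t' := mul_right_cancel₀ h0 (by linarith)
        rw [this]
      · intro h
        have : t = t' := by linarith
        rw [this])
  simp only [mem_singleton_iff, iUnion_iUnion_eq_left, uIcc_of_le (zero_le_one' ℝ),
    uIcc_of_le hpq.le] at hf
  refine ⟨f, hf, ?_⟩
  rw [image_union, image_joinArc_singleton (b := 0), image_joinArc_singleton (b := 1)]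
  · intro s hs z hz
    have := hft k rfl 1 (by simp) s hs z hz
    simpa using this
  · intro s hs z hz
    have := hft k rfl 0 (by simp) s hs z hz
    simpa using this

/-- The join of a proper inner segment of an arc with its complex is a PL ball. -/
theorem isPLBall_middle [FiniteDimensional ℝ E] (A : ArcSystem Δ S n x L)
    (hM : IsPLManifold d Δ) (hd : 2 ≤ d)
    {k : Fin 3} (hk : 1 < n k) {p q : ℝ} (hp : 0 ≤ p) (hq : q ≤ n k) (hpq : p < q) :
    IsPLBall d (joinArc n x L k (Icc p q)) (joinArc n x L k {p} ∪ joinArc n x L k {q}) := by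
  -- The star of vertex `1` is the join with the segment from `0` to `2`. Both this segment and the
  -- given one straighten to the first edge, which serves as the common model.
  have hball := isPLBall_star (A.isPLSphere_link_vertex hM hd hk.le)
  rw [A.star_inner hk, A.link_inner hk, show d - 1 + 1 = d by omega] at hball
  obtain ⟨g, hg, hgb⟩ := A.exists_plBij_middle (k := k) le_rfl
    (by exact_mod_cast hk : (2 : ℝ) ≤ n k) two_pos
  obtain ⟨f, hf, hfb⟩ := A.exists_plBij_middle (k := k) hp hq hpq
  have h := plBij_isPLBall_image hg hball
  rw [hgb] at h
  refine hf.isPLBall h (union_subset (joinArc_mono ?_) (joinArc_mono ?_)) hfb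
  · simpa using hpq.le
  · simpa using hpq.le

/-- Since the cuts are strictly between the ends, the identifications at the start and at the end
cannot involve points of both parts. -/
theorem initial_inter_final (A : ArcSystem Δ S n x L) {c : Fin 3 → ℝ} (hc0 : ∀ i, 0 < c i)
    (hc : ∀ i, c i < n i) :
    (⋃ i, joinArc n x L i (Icc 0 (c i))) ∩ (⋃ i, joinArc n x L i (Icc (c i) (n i))) =
      ⋃ i, joinArc n x L i {c i} := by
  apply Subset.antisymm
  · rintro w ⟨h, h'⟩
    obtain ⟨i, hw⟩ := mem_iUnion.1 h
    obtain ⟨i', hw'⟩ := mem_iUnion.1 h'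
    refine mem_iUnion.2 ⟨i', A.joinArc_inter_subset (Icc_subset_Icc le_rfl (hc i).le)
      (Icc_subset_Icc (hc0 i').le le_rfl) ?_ ⟨hw, hw'⟩⟩
    rintro t ht t' ht' (⟨rfl, rfl⟩ | h | h)
    · exact ⟨rfl, le_antisymm ht.2 ht'.1⟩
    · linarith [hc0 i', ht'.1, h.2]
    · linarith [hc i, ht.2, h.1]
  · refine iUnion_subset fun i => subset_inter ?_ ?_
    · exact (joinArc_mono (by simpa using (hc0 i).le)).trans
        (subset_iUnion (fun i => joinArc n x L i (Icc 0 (c i))) i)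
    · exact (joinArc_mono (by simpa using (hc i).le)).trans
        (subset_iUnion (fun i => joinArc n x L i (Icc (c i) (n i))) i)

theorem initial_union_final (A : ArcSystem Δ S n x L) {c : Fin 3 → ℝ} (hc0 : ∀ i, 0 < c i)
    (hc : ∀ i, c i < n i) :
    (⋃ i, joinArc n x L i (Icc 0 (c i))) ∪ (⋃ i, joinArc n x L i (Icc (c i) (n i))) = Δ.space := by
  rw [A.space_eq, ← iUnion_union_distrib]
  refine iUnion_congr fun i => ?_
  rw [← joinArc_union, Icc_union_Icc_eq_Icc (hc0 i).le (hc i).le]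

theorem initial_inter_middle (A : ArcSystem Δ S n x L) {c : Fin 3 → ℝ} (hc0 : ∀ i, 0 < c i)
    (hc : ∀ i, c i < n i) {k : Fin 3} {b : ℝ} (hcb : c k ≤ b) (hb : b < n k) :
    (⋃ i, joinArc n x L i (Icc 0 (c i))) ∩ joinArc n x L k (Icc (c k) b) =
      joinArc n x L k {c k} := by
  apply Subset.antisymm
  · rintro w ⟨h, hw'⟩
    obtain ⟨i, hw⟩ := mem_iUnion.1 h
    refine A.joinArc_inter_subset (Icc_subset_Icc le_rfl (hc i).le)
      (Icc_subset_Icc (hc0 k).le hb.le) ?_ ⟨hw, hw'⟩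
    rintro t ht t' ht' (⟨rfl, rfl⟩ | h | h)
    · exact ⟨rfl, le_antisymm ht.2 ht'.1⟩
    · linarith [hc0 k, ht'.1, h.2]
    · linarith [hc i, ht.2, h.1]
  · refine subset_inter ?_ (joinArc_mono (by simpa using hcb))
    exact (joinArc_mono (by simpa using (hc0 k).le)).trans
      (subset_iUnion (fun i => joinArc n x L i (Icc 0 (c i))) k)

/-- A PL manifold with an arc system is a PL sphere. -/
theorem isPLSphere_space [FiniteDimensional ℝ E] (A : ArcSystem Δ S n x L)
    (hM : IsPLManifold d Δ) (hd : 2 ≤ d) :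
    IsPLSphere d Δ.space := by
  have hn : ∀ i, (1 : ℝ) ≤ n i := fun i => by exact_mod_cast A.pos i
  -- Any cut strictly inside the arcs will do; `1 / 2` is inside every arc since all lengths are at
  -- least `1`.
  have hc0 : ∀ i : Fin 3, (0 : ℝ) < (fun _ => 1 / 2 : Fin 3 → ℝ) i := fun _ => by norm_num
  have hc : ∀ i : Fin 3, (fun _ => 1 / 2 : Fin 3 → ℝ) i < n i := fun i => by
    have := hn i
    dsimp only
    linarith
  obtain ⟨m, rfl⟩ : ∃ m, d = m + 1 := ⟨d - 1, by omega⟩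
  rw [← A.initial_union_final hc0 hc]
  exact isPLSphere_union (A.isPLBall_initial hM hd hc0 hc) (A.isPLBall_final hM hd hc0 hc)
    (A.initial_inter_final hc0 hc)

end ArcSystem

end BalancedComplex


namespace BalancedComplex

open Set PLTopology

theorem _root_.SimpleGraph.Walk.mem_edges_iff_getVert {V : Type*} {G : SimpleGraph V} {a b : V}
    (p : G.Walk a b) (e : Sym2 V) :
    e ∈ p.edges ↔ ∃ j < p.length, e = s(p.getVert j, p.getVert (j + 1)) := by
  induction p with
  | nil => simp
  | cons h p ih =>
    rw [SimpleGraph.Walk.edges_cons, List.mem_cons, ih]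
    constructor
    · rintro (rfl | ⟨j, hj, rfl⟩)
      · exact ⟨0, by simp, by simp⟩
      · exact ⟨j + 1, by simpa using hj, by simp⟩
    · rintro ⟨j, hj, rfl⟩
      rcases j with _ | j
      · left
        simp
      · right
        exact ⟨j, by simpa using hj, by simp⟩

/-! ### Translation of the ball decomposition into joins over arc parameters. -/

section Decomposition

variable {E : Type*} [NormedAddCommGroup E] [NormedSpace ℝ E]
  {Δ K : Geometry.SimplicialComplex ℝ E} {S : E → Prop} {a b : K.vertices}
  {P : Fin 3 → (graph K).Path a b}

/-- The lengths of the paths. -/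
def pathLength (P : Fin 3 → (graph K).Path a b) (i : Fin 3) : ℕ := (P i).1.length

/-- The vertices of the paths. -/
def pathVertex (P : Fin 3 → (graph K).Path a b) (i : Fin 3) (j : ℕ) : E := (P i).1.getVert j

/-- The parameter of `firstPt` on the `i`-th path. -/
noncomputable def firstParam (P : Fin 3 → (graph K).Path a b) (i : Fin 3) : ℝ :=
  if pathLength P i = 1 then 1 / 2 else 1

/-- The parameter of `lastPt` on the `i`-th path. -/
noncomputable def lastParam (P : Fin 3 → (graph K).Path a b) (i : Fin 3) : ℝ :=
  if pathLength P i = 1 then 1 / 2 else pathLength P i - 1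

theorem pathVertex_zero (P : Fin 3 → (graph K).Path a b) (i : Fin 3) : pathVertex P i 0 = a := by
  simp [pathVertex]

theorem pathVertex_length (P : Fin 3 → (graph K).Path a b) (i : Fin 3) :
    pathVertex P i (pathLength P i) = b := by
  simp [pathVertex, pathLength]

theorem two_le_cast
    (A : ArcSystem Δ S (pathLength P) (pathVertex P) (branchLink Δ P))
    (i : Fin 3) (h : pathLength P i ≠ 1) : (2 : ℝ) ≤ pathLength P i := by
  have := A.pos i
  exact_mod_cast (by omega : 2 ≤ pathLength P i)

theorem firstParam_pos (P : Fin 3 → (graph K).Path a b) (i : Fin 3) : 0 < firstParam P i := by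
  unfold firstParam
  split_ifs <;> norm_num

theorem firstParam_le
    (A : ArcSystem Δ S (pathLength P) (pathVertex P) (branchLink Δ P))
    (i : Fin 3) : firstParam P i ≤ lastParam P i := by
  unfold firstParam lastParam
  split_ifs with h
  · norm_num
  · linarith [two_le_cast A i h]

theorem lastParam_lt (P : Fin 3 → (graph K).Path a b) (i : Fin 3) : lastParam P i < pathLength P i := by
  unfold lastParam
  split_ifs with h
  · rw [h]
    norm_num
  · linarith

theorem arc_firstParam
    (A : ArcSystem Δ S (pathLength P) (pathVertex P) (branchLink Δ P))
    (i : Fin 3) :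
    arc (pathVertex P i) (pathLength P i) (firstParam P i) = firstPt P i := by
  unfold firstParam firstPt
  by_cases h : pathLength P i = 1
  · rw [if_pos h, if_pos (show (P i).1.length = 1 from h),
      arc_of_mem (j := 0) _ (by omega) (by norm_num)]
    have := pathVertex_length P i
    rw [h] at this
    rw [pathVertex_zero, zero_add, this, midpoint_eq_smul_add]
    norm_num
  · rw [if_neg h, if_neg (show ¬ (P i).1.length = 1 from h)]
    have := arc_natCast (pathVertex P i) (A.pos i) (A.pos i)
    rw [Nat.cast_one] at this
    exact this

theorem arc_lastParam
    (A : ArcSystem Δ S (pathLength P) (pathVertex P) (branchLink Δ P))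
    (i : Fin 3) :
    arc (pathVertex P i) (pathLength P i) (lastParam P i) = lastPt P i := by
  by_cases h : pathLength P i = 1
  · have := arc_firstParam A i
    simp only [firstParam, firstPt, if_pos h, if_pos (show (P i).1.length = 1 from h)] at this
    rwa [lastParam, lastPt, if_pos h, if_pos (show (P i).1.length = 1 from h)]
  · rw [lastParam, lastPt, if_neg h, if_neg (show ¬ (P i).1.length = 1 from h)]
    have := arc_natCast (pathVertex P i) (Nat.sub_le (pathLength P i) 1) (A.pos i)
    rw [Nat.cast_sub (A.pos i), Nat.cast_one] at this
    exact this

theorem firstPt_eq_lastPt_iff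
    (A : ArcSystem Δ S (pathLength P) (pathVertex P) (branchLink Δ P))
    (i : Fin 3) :
    firstPt P i = lastPt P i ↔ firstParam P i = lastParam P i := by
  have h0 := firstParam_pos P i
  have h1 := firstParam_le A i
  have h2 := lastParam_lt P i
  rw [← arc_firstParam A, ← arc_lastParam A, A.arc_eq_iff ⟨h0.le, h1.trans h2.le⟩
    ⟨h0.le.trans h1, h2.le⟩]
  constructor
  · rintro (h | h | h)
    · exact h.2
    · linarith [h.1]
    · linarith [h.2]
  · exact fun h => Or.inl ⟨rfl, h⟩

theorem convexJoin_firstPt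
    (A : ArcSystem Δ S (pathLength P) (pathVertex P) (branchLink Δ P))
    (i : Fin 3) : convexJoin ℝ {firstPt P i} (branchLink Δ P i).space =
    joinArc (pathLength P) (pathVertex P) (branchLink Δ P) i {firstParam P i} := by
  rw [joinArc, image_singleton, arc_firstParam A]

theorem convexJoin_lastPt
    (A : ArcSystem Δ S (pathLength P) (pathVertex P) (branchLink Δ P))
    (i : Fin 3) : convexJoin ℝ {lastPt P i} (branchLink Δ P i).space =
    joinArc (pathLength P) (pathVertex P) (branchLink Δ P) i {lastParam P i} := by
  rw [joinArc, image_singleton, arc_lastParam A]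

theorem startBall_eq
    (A : ArcSystem Δ S (pathLength P) (pathVertex P) (branchLink Δ P))
    : startBall Δ P =
    ⋃ i, joinArc (pathLength P) (pathVertex P) (branchLink Δ P) i (Icc 0 (firstParam P i)) := by
  refine iUnion_congr fun i => ?_
  have h0 := firstParam_pos P i
  rw [joinArc, ← uIcc_of_le h0.le, arc_image_Icc (j := 0) _ (A.pos i) (by norm_num), A.arc_zero,
    arc_firstParam A, pathVertex_zero]
  refine ⟨by simpa using h0.le, ?_⟩
  unfold firstParam
  split_ifs <;> norm_num

theorem endBall_eq
    (A : ArcSystem Δ S (pathLength P) (pathVertex P) (branchLink Δ P))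
    : endBall Δ P =
    ⋃ i, joinArc (pathLength P) (pathVertex P) (branchLink Δ P) i
      (Icc (lastParam P i) (pathLength P i)) := by
  refine iUnion_congr fun i => ?_
  have h0 := lastParam_lt P i
  have h1 := A.pos i
  rw [joinArc, ← uIcc_of_le h0.le, arc_image_Icc (j := pathLength P i - 1) _ (by omega) ?_ ?_,
    A.arc_end, arc_lastParam A, pathVertex_length]
  · rw [Nat.cast_sub h1]
    refine ⟨?_, by simpa using h0.le⟩
    unfold lastParam
    split_ifs with h
    · rw [h]
      norm_num
    · simp
  · rw [Nat.cast_sub h1]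
    simp

theorem innerArc_eq
    (A : ArcSystem Δ S (pathLength P) (pathVertex P) (branchLink Δ P))
    (i : Fin 3) : innerArc P i =
    arc (pathVertex P i) (pathLength P i) '' Icc (firstParam P i) (lastParam P i) := by
  have hle := firstParam_le A i
  rw [innerArc, ← arc_firstParam A]
  have hlt : ∀ j : ℕ, j + 1 < pathLength P i → segment ℝ ((P i).1.getVert j : E)
      ((P i).1.getVert (j + 1) : E) =
        arc (pathVertex P i) (pathLength P i) '' Icc (j : ℝ) (j + 1) := by
    intro j hj
    rw [← uIcc_of_le (by linarith : (j : ℝ) ≤ j + 1), arc_image_Icc (j := j) _ (by omega) (by simp)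
      (by simp), arc_natCast _ (by omega) (A.pos i)]
    have := arc_natCast (pathVertex P i) hj.le (A.pos i)
    push_cast at this
    rw [this]
    rfl
  apply Subset.antisymm
  · refine union_subset ?_ (iUnion₂_subset ?_)
    · rw [singleton_subset_iff]
      exact ⟨_, ⟨le_rfl, hle⟩, rfl⟩
    · rintro j ⟨h1, h2⟩
      have h2' : j + 1 < pathLength P i := h2
      rw [hlt j h2']
      refine image_mono (Icc_subset_Icc ?_ ?_)
      · have : pathLength P i ≠ 1 := by omega
        rw [firstParam, if_neg this]
        exact_mod_cast h1
      · have : pathLength P i ≠ 1 := by omega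
        rw [lastParam, if_neg this, le_sub_iff_add_le]
        exact_mod_cast h2'
  · rintro _ ⟨t, ht, rfl⟩
    by_cases hn : pathLength P i ≤ 2
    · left
      have h1 := A.pos i
      have : firstParam P i = lastParam P i := by
        unfold firstParam lastParam
        split_ifs with h
        · rfl
        · have : pathLength P i = 2 := by omega
          rw [this]
          norm_num
      rw [← this] at ht
      rw [mem_singleton_iff, le_antisymm ht.2 ht.1]
    · right
      have hne : pathLength P i ≠ 1 := by omega
      rw [firstParam, lastParam, if_neg hne, if_neg hne] at ht
      -- The inner arc omits the first and the last edge, hence the shift by `1` and the length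
      -- reduced by `2`.
      obtain ⟨j, hj, htj⟩ := exists_nat_of_mem_Icc (n := pathLength P i - 2) (t := t - 1)
        (by omega) ⟨by linarith [ht.1], by
          rw [Nat.cast_sub (by omega)]
          push_cast
          linarith [ht.2]⟩
      refine mem_iUnion₂.2 ⟨j + 1, ⟨by omega, show j + 1 + 1 < pathLength P i by omega⟩, ?_⟩
      rw [hlt (j + 1) (by omega)]
      refine ⟨t, ?_, rfl⟩
      push_cast
      constructor <;> linarith [htj.1, htj.2]

theorem middlePiece_eq
    (A : ArcSystem Δ S (pathLength P) (pathVertex P) (branchLink Δ P))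
    (i : Fin 3) : middlePiece Δ P i =
    joinArc (pathLength P) (pathVertex P) (branchLink Δ P) i
      (Icc (firstParam P i) (lastParam P i)) := by
  rw [middlePiece, innerArc_eq A, joinArc]

theorem partialUnion_eq
    (A : ArcSystem Δ S (pathLength P) (pathVertex P) (branchLink Δ P))
    (k : ℕ) : partialUnion Δ P k =
    ⋃ i : Fin 3, joinArc (pathLength P) (pathVertex P) (branchLink Δ P) i
      (Icc 0 (if (i : ℕ) < k then lastParam P i else firstParam P i)) := by
  have h : ∀ i, Icc 0 (lastParam P i) =
      Icc 0 (firstParam P i) ∪ Icc (firstParam P i) (lastParam P i) := fun i =>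
    (Icc_union_Icc_eq_Icc (firstParam_pos P i).le (firstParam_le A i)).symm
  rw [partialUnion, startBall_eq A]
  simp only [middlePiece_eq A]
  ext w
  simp only [mem_union, mem_iUnion]
  constructor
  · rintro (⟨i, hw⟩ | ⟨i, hi, hw⟩)
    · refine ⟨i, ArcSystem.joinArc_mono (Icc_subset_Icc le_rfl ?_) hw⟩
      split_ifs
      exacts [firstParam_le A i, le_rfl]
    · refine ⟨i, ?_⟩
      rw [if_pos (show (i : ℕ) < k from hi), h, ArcSystem.joinArc_union]
      exact Or.inr hw
  · rintro ⟨i, hw⟩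
    split_ifs at hw with hi
    · rw [h, ArcSystem.joinArc_union] at hw
      rcases hw with hw | hw
      exacts [Or.inl ⟨i, hw⟩, Or.inr ⟨i, hi, hw⟩]
    · exact Or.inl ⟨i, hw⟩

theorem partialBoundary_eq
    (A : ArcSystem Δ S (pathLength P) (pathVertex P) (branchLink Δ P))
    (k : ℕ) : partialBoundary Δ P k =
    ⋃ i : Fin 3, joinArc (pathLength P) (pathVertex P) (branchLink Δ P) i
      {if (i : ℕ) < k then lastParam P i else firstParam P i} := by
  refine iUnion_congr fun i => ?_
  split_ifs
  · exact convexJoin_lastPt A i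
  · exact convexJoin_firstPt A i

/-- The union of the first ball with `k` middle pieces consists of the joins of initial segments,
cut at the last inner parameter on the first `k` arcs and at the first one on the others. So each
clause is an instance of the results on initial, middle and final segments. -/
theorem isBallDecomposition
    (A : ArcSystem Δ S (pathLength P) (pathVertex P) (branchLink Δ P))
    [FiniteDimensional ℝ E] {d : ℕ} (hM : IsPLManifold d Δ) (hd : 2 ≤ d)
    (hinj : Function.Injective (branchLink Δ P)) : IsBallDecomposition Δ P d := by
  classical
  have hlast0 : ∀ i, 0 < lastParam P i := fun i => (firstParam_pos P i).trans_le (firstParam_le A i)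
  have hfirst : ∀ i, firstParam P i < pathLength P i :=
    fun i => (firstParam_le A i).trans_lt (lastParam_lt P i)
  have hc0 : ∀ (k : ℕ) (i : Fin 3), 0 < if (i : ℕ) < k then lastParam P i else firstParam P i := by
    intro k i
    split_ifs
    exacts [hlast0 i, firstParam_pos P i]
  have hc : ∀ (k : ℕ) (i : Fin 3),
      (if (i : ℕ) < k then lastParam P i else firstParam P i) < pathLength P i := by
    intro k i
    split_ifs
    exacts [lastParam_lt P i, hfirst i]
  have h3 : ∀ i : Fin 3, (if (i : ℕ) < 3 then lastParam P i else firstParam P i) = lastParam P i :=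
    fun i => if_pos i.2
  have hadj : ¬ (graph K).Adj a b → ∀ i, pathLength P i ≠ 1 := by
    intro h i h1
    have hi : (P i).1.length = 1 := h1
    have := (P i).1.adj_getVert_succ (i := 0) (by omega)
    rw [SimpleGraph.Walk.getVert_zero, zero_add] at this
    have hb := (P i).1.getVert_length
    rw [hi] at hb
    rw [hb] at this
    exact h this
  refine ⟨?_, A.isPLSphere_branch hM hd, hinj, ?_, ?_, ?_, ?_, ?_, ?_, ?_, ?_, ?_, ?_⟩
  · intro i u v huv
    obtain ⟨j, hj, e⟩ := ((P i).1.mem_edges_iff_getVert _).1 huv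
    rw [← A.link i j hj]
    rcases Sym2.eq_iff.1 e with ⟨rfl, rfl⟩ | ⟨rfl, rfl⟩
    · rfl
    · rw [Finset.pair_comm]
      rfl
  · rw [partialUnion_eq A, endBall_eq A]
    simp only [h3]
    exact A.initial_union_final hlast0 (lastParam_lt P)
  · intro h
    rw [startBall_eq A, ← pathVertex_zero P 0, A.star_start]
    refine iUnion_congr fun i => ?_
    rw [firstParam, if_neg (hadj h i)]
  · intro h
    rw [endBall_eq A, ← pathVertex_length P 0, A.star_finish]
    refine iUnion_congr fun i => ?_
    rw [lastParam, if_neg (hadj h i)]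
  · intro k _
    rw [partialUnion_eq A, partialBoundary_eq A]
    exact A.isPLBall_initial hM hd (hc0 k) (hc k)
  · intro i hne
    have hlt := lt_of_le_of_ne (firstParam_le A i) fun h => hne ((firstPt_eq_lastPt_iff A i).2 h)
    -- On a single edge, subdivided at its midpoint, the first and last inner parameters coincide.
    have hlen : 1 < pathLength P i := by
      have h1 := A.pos i
      by_contra hcon
      have : pathLength P i = 1 := by omega
      simp [firstParam, lastParam, this] at hlt
    rw [middlePiece_eq A, insert_eq, convexJoin_union_left, convexJoin_firstPt A,
      convexJoin_lastPt A]
    exact A.isPLBall_middle hM hd hlen (firstParam_pos P i).le (lastParam_lt P i).le hlt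
  · intro i h
    rw [middlePiece_eq A, convexJoin_firstPt A, (firstPt_eq_lastPt_iff A i).1 h, Icc_self]
  · intro i
    -- Before the `i`-th middle piece is added, arc `i` is still cut at its first inner parameter,
    -- as `i < i` fails.
    have h := A.initial_inter_middle (hc0 i) (hc i) (k := i) (b := lastParam P i)
      (by simpa using firstParam_le A i) (lastParam_lt P i)
    rw [if_neg (lt_irrefl (i : ℕ))] at h
    rw [partialUnion_eq A, middlePiece_eq A, convexJoin_firstPt A, h]
  · intro i
    rw [convexJoin_firstPt A]
    exact A.isPLBall_joinArc_singleton hM hd ⟨(firstParam_pos P i).le, (hfirst i).le⟩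
  · rw [endBall_eq A, partialBoundary_eq A]
    simp only [h3]
    exact A.isPLBall_final hM hd hlast0 (lastParam_lt P)
  · rw [partialUnion_eq A, endBall_eq A, partialBoundary_eq A]
    simp only [h3]
    exact A.initial_inter_final hlast0 (lastParam_lt P)

end Decomposition

end BalancedComplex


namespace PLTopology

open Set unitInterval

/-! ### Criteria for simple connectivity and for homotopy of paths. -/

section Paths

variable {X : Type*} [TopologicalSpace X]

/-- A space is simply connected if it has an open cover by sets whose pairwise intersections are
path connected and contain a common point, such that paths in one of the sets are determined up to
homotopy in the space by their ends. -/
theorem simplyConnectedSpace_of_openCover {ι : Type*} (U : ι → Set X) (hU : ∀ i, IsOpen (U i))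
    (hcov : ⋃ i, U i = univ) (x₀ : X)
    (hconn : ∀ i j, ∀ y ∈ U i ∩ U j, JoinedIn (U i ∩ U j) x₀ y)
    (hpath : ∀ i, ∀ y z, ∀ p q : Path y z, (∀ t, p t ∈ U i) → (∀ t, q t ∈ U i) →
      p.Homotopic q) : SimplyConnectedSpace X := by
  have hmem : ∀ y, ∃ i, y ∈ U i := fun y => mem_iUnion.1 (hcov ▸ mem_univ y)
  have hJ : ∀ i, ∀ y ∈ U i, ∃ p : Path x₀ y, ∀ t, p t ∈ U i := by
    intro i y hy
    obtain ⟨p, hp⟩ := hconn i i y ⟨hy, hy⟩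
    exact ⟨p, fun t => (hp t).1⟩
  choose k hk using hmem
  choose r hr using fun y => hJ (k y) y (hk y)
  -- `c y` is the class of a path from `x₀` to `y` inside one set of the cover. It depends neither
  -- on the set nor on the path: two choices are compared with a path in the intersection of the two
  -- sets.
  let c : ∀ y, Path.Homotopic.Quotient x₀ y := fun y => .mk (r y)
  have claim1 : ∀ i y (s : Path x₀ y), (∀ t, s t ∈ U i) → .mk s = c y := by
    intro i y s hs
    have hy : y ∈ U i := by simpa using hs 1
    obtain ⟨s', hs'⟩ := hconn i (k y) y ⟨hy, hk y⟩
    refine Path.Homotopic.Quotient.eq.2 ((hpath i _ _ s s' hs fun t => (hs' t).1).trans ?_)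
    exact hpath (k y) _ _ s' (r y) (fun t => (hs' t).2) (hr y)
  have claim2 : ∀ i y z (s : Path y z), (∀ t, s t ∈ U i) → (c y).trans (.mk s) = c z := by
    intro i y z s hs
    have hy : y ∈ U i := by simpa using hs 0
    obtain ⟨p, hp⟩ := hJ i y hy
    rw [← claim1 i y p hp, ← Path.Homotopic.Quotient.mk_trans]
    refine claim1 i z _ fun t => ?_
    rw [Path.trans_apply]
    split_ifs
    exacts [hp _, hs _]
  have claim3 : ∀ y z (p : Path y z), (c y).trans (.mk p) = c z := by
    intro y z p
    -- By compactness the path is cut into pieces, each inside one set of the cover. Induction along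
    -- the pieces shows that `c` is transported by the path, so its class is determined by its ends.
    obtain ⟨t, ht0, hmono, ⟨m, hm⟩, ht⟩ := exists_monotone_Icc_subset_open_cover_unitInterval
      (c := fun i => p ⁻¹' U i) (fun i => (hU i).preimage p.continuous)
      (fun s _ => mem_iUnion.2 ⟨k (p s), hk (p s)⟩)
    have h0 : ∀ s, s = 0 → (c (p 0)).trans (.mk (p.subpath 0 s)) = c (p s) := by
      rintro s rfl
      rw [Path.subpath_self, Path.Homotopic.Quotient.mk_refl, Path.Homotopic.Quotient.trans_refl]
    have hind : ∀ l, (c (p 0)).trans (.mk (p.subpath 0 (t l))) = c (p (t l)) := by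
      intro l
      induction l with
      | zero => exact h0 _ ht0
      | succ l ih =>
        have e : Path.Homotopic.Quotient.mk (p.subpath 0 (t (l + 1))) =
            (Path.Homotopic.Quotient.mk (p.subpath 0 (t l))).trans
              (.mk (p.subpath (t l) (t (l + 1)))) := by
          rw [← Path.Homotopic.Quotient.mk_trans]
          exact (Path.Homotopic.Quotient.eq.2 ⟨Path.Homotopy.subpathTransSubpath p _ _ _⟩).symm
        rw [e, ← Path.Homotopic.Quotient.trans_assoc, ih]
        obtain ⟨i, hi⟩ := ht l
        refine claim2 i _ _ _ fun s => ?_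
        have : (p.subpath (t l) (t (l + 1))) s ∈ range (p.subpath (t l) (t (l + 1))) := ⟨s, rfl⟩
        rw [Path.range_subpath_of_le _ _ _ (hmono (Nat.le_succ l))] at this
        obtain ⟨s', hs', e'⟩ := this
        rw [← e']
        exact hi hs'
    have h1 : ∀ s, s = 1 → (c (p 0)).trans (.mk (p.subpath 0 s)) = c (p s) →
        (c (p 0)).trans (.mk (p.cast p.source p.target)) = c (p 1) := by
      rintro s rfl h
      rwa [Path.subpath_zero_one] at h
    -- Only transport along `p 0 = y` and `p 1 = z`, which are not definitional equalities.
    have h2 : ∀ y' z' (hy : y' = y) (hz : z' = z), (c y').trans (.mk (p.cast hy hz)) = c z' →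
        (c y).trans (.mk p) = c z := by
      rintro _ _ rfl rfl h
      exact h
    exact h2 _ _ _ _ (h1 _ (hm m le_rfl) (hind m))
  rw [simply_connected_iff_paths_homotopic']
  refine ⟨⟨⟨x₀⟩, fun y z => ⟨(r y).symm.trans (r z)⟩⟩, fun {y z} p q => ?_⟩
  have h := (claim3 y z p).trans (claim3 y z q).symm
  have h' := congrArg (fun e => (Path.Homotopic.Quotient.symm (c y)).trans e) h
  simp only [← Path.Homotopic.Quotient.trans_assoc, Path.Homotopic.Quotient.symm_trans,
    Path.Homotopic.Quotient.refl_trans] at h'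
  exact Path.Homotopic.Quotient.eq.1 h'

/-- Paths in a set whose inclusion is homotopic to a constant map are determined up to homotopy
by their ends. -/
theorem homotopic_of_homotopy_const {A : Set X} {f : C(A, X)} (hf : ∀ a, f a = a) {x₀ : X}
    (H : f.Homotopic (ContinuousMap.const A x₀)) {y z : X} (p q : Path y z)
    (hp : ∀ t, p t ∈ A) (hq : ∀ t, q t ∈ A) : p.Homotopic q := by
  obtain ⟨H⟩ := H
  have hy : y ∈ A := by simpa using hp 0
  have hz : z ∈ A := by simpa using hp 1
  have lift : ∀ s : Path y z, (∀ t, s t ∈ A) → ∃ s' : Path (⟨y, hy⟩ : A) ⟨z, hz⟩,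
      (s'.map f.continuous) = s.cast (hf _) (hf _) := by
    intro s hs
    refine ⟨⟨⟨fun t => ⟨s t, hs t⟩, by fun_prop⟩, by simp, by simp⟩, ?_⟩
    ext t
    exact hf _
  obtain ⟨p', hp'⟩ := lift p hp
  obtain ⟨q', hq'⟩ := lift q hq
  -- A homotopy to a constant map moves the ends along fixed tracks. Following a path and then the
  -- track of `z` is homotopic to following the track of `y`, whatever the path; the track of `z`
  -- cancels.
  have key : ∀ s s' : Path (⟨y, hy⟩ : A) ⟨z, hz⟩,
      (s.map f.continuous).Homotopic (s'.map f.continuous) := by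
    intro s s'
    have h1 := Path.Homotopic.Quotient.eq.2 (Path.Homotopic.map_trans_evalAt H s)
    have h2 := Path.Homotopic.Quotient.eq.2 (Path.Homotopic.map_trans_evalAt H s')
    have e : s.map (map_continuous (ContinuousMap.const A x₀)) =
        s'.map (map_continuous (ContinuousMap.const A x₀)) := by
      ext t
      rfl
    rw [e, ← h2, Path.Homotopic.Quotient.mk_trans, Path.Homotopic.Quotient.mk_trans] at h1
    have h3 := congrArg (fun e => Path.Homotopic.Quotient.trans e
      (.symm (.mk (H.evalAt ⟨z, hz⟩)))) h1
    simp only [Path.Homotopic.Quotient.trans_assoc, Path.Homotopic.Quotient.trans_symm,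
      Path.Homotopic.Quotient.trans_refl] at h3
    exact Path.Homotopic.Quotient.eq.1 h3
  have h := key p' q'
  rw [hp', hq'] at h
  exact h.pathCast (hf _).symm (hf _).symm

end Paths

end PLTopology


/-! ### Contraction of the complement of an end, and simple connectivity. -/

namespace PLTopology

open Set unitInterval

/-- A homotopy on a compact space that is constant on the fibres of a map `α` onto `Y`, outside a
subset of `Y`, descends to the complement of this subset. -/
theorem exists_continuous_lift {D Y Z : Type*} [TopologicalSpace D] [CompactSpace D]
    [TopologicalSpace Y] [T2Space Y] [TopologicalSpace Z] {α : D → Y} (hα : Continuous α)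
    (hs : Function.Surjective α) (A : Set Y) (β : I × D → Z)
    (hβ : ContinuousOn β {e | α e.2 ∈ A})
    (hker : ∀ τ d d', α d = α d' → α d ∈ A → β (τ, d) = β (τ, d')) :
    ∃ H : C(I × A, Z), ∀ τ d, ∀ hd : α d ∈ A, H (τ, ⟨α d, hd⟩) = β (τ, d) := by
  choose g hg using hs
  let π : I × (α ⁻¹' A) → I × A := Prod.map id (A.restrictPreimage α)
  -- A map from a compact to a Hausdorff space is proper. Properness survives restriction to the
  -- preimage of `A` and the product with the interval, so the result is closed and a quotient map.
  have hπ : Topology.IsQuotientMap π := by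
    have hp : IsProperMap π := isProperMap_id.prodMap (hα.isProperMap.restrictPreimage A)
    refine hp.isClosedMap.isQuotientMap hp.continuous ?_
    rintro ⟨τ, y, hy⟩
    refine ⟨⟨τ, ⟨g y, by simpa [hg] using hy⟩⟩, Prod.ext rfl (Subtype.ext (hg y))⟩
  have e : ∀ τ d, α d ∈ A → β (τ, g (α d)) = β (τ, d) := fun τ d hd =>
    hker τ _ _ (hg _) (by rwa [hg])
  refine ⟨⟨fun e => β (e.1, g e.2), ?_⟩, fun τ d hd => e τ d hd⟩
  rw [hπ.continuous_iff]
  have : (fun e : I × A => β (e.1, g e.2)) ∘ π = fun e : I × (α ⁻¹' A) => β (e.1, e.2) := by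
    funext ⟨τ, d, hd⟩
    exact e τ d hd
  rw [this]
  exact hβ.comp_continuous (by fun_prop) fun e => e.2.2

end PLTopology

namespace BalancedComplex

open Set PLTopology

namespace ArcSystem

variable {E : Type*} [NormedAddCommGroup E] [NormedSpace ℝ E]
  {Δ : Geometry.SimplicialComplex ℝ E} {S : E → Prop} {n : Fin 3 → ℕ} {x : Fin 3 → ℕ → E}
  {L : Fin 3 → Geometry.SimplicialComplex ℝ E}

-- Reversal exchanges start and end, so that statements about the complement of the end apply to the
-- complement of the start.
open Classical in
theorem reverse (A : ArcSystem Δ S n x L) : ArcSystem Δ S n (fun i j => x i (n i - j)) L where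
  finite := A.finite
  pos := A.pos
  start i i' := A.finish i i'
  finish i i' := by
    simp only [Nat.sub_self]
    exact A.start i i'
  inj i i' j j' hj hj' h := by
    have := A.inj i i' (n i - j) (n i' - j') (Nat.sub_le _ _) (Nat.sub_le _ _) h
    by_cases hi : i = i'
    · subst hi
      omega
    · simp only [hi, false_and, false_or] at this ⊢
      omega
  long := A.long
  mem_S i j _ := A.mem_S i _ (Nat.sub_le _ _)
  notMem_S := A.notMem_S
  link i j hj := by
    have h : n i - j = n i - (j + 1) + 1 := by omega
    simp only [h]
    rw [Finset.pair_comm]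
    exact A.link i _ (by omega)
  nonempty := A.nonempty
  cover σ hσ := by
    obtain ⟨i, j, hj, τ, hτ, h⟩ := A.cover σ hσ
    refine ⟨i, n i - (j + 1), by omega, τ, hτ, ?_⟩
    have h1 : n i - (n i - (j + 1)) = j + 1 := by omega
    have h2 : n i - (n i - (j + 1) + 1) = j := by omega
    simp only [h1, h2]
    rwa [Finset.pair_comm]
  meet := A.meet

/-- The point of the join of the `i`-th arc with its complex with given parameters. -/
noncomputable def joinPoint (n : Fin 3 → ℕ) (x : Fin 3 → ℕ → E) (i : Fin 3) (t s : ℝ) (z : E) : E :=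
  (1 - s) • arc (x i) (n i) t + s • z

theorem joinPoint_mem (A : ArcSystem Δ S n x L) {i : Fin 3} {t s : ℝ} {z : E}
    (ht : t ∈ Icc (0 : ℝ) (n i)) (hs : s ∈ Icc (0 : ℝ) 1) (hz : z ∈ (L i).space) :
    joinPoint n x i t s z ∈ Δ.space := by
  rw [A.space_eq]
  exact mem_iUnion.2 ⟨i, mem_joinArc.2 ⟨t, ht, z, hz, s, hs, rfl⟩⟩

theorem isCompact_space {K : Geometry.SimplicialComplex ℝ E} (h : K.faces.Finite) :
    IsCompact K.space :=
  h.isCompact_biUnion fun σ _ => σ.finite_toSet.isCompact_convexHull ℝ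

/-- The parameter space of the joins. -/
abbrev Param (n : Fin 3 → ℕ) (L : Fin 3 → Geometry.SimplicialComplex ℝ E) : Type _ :=
  Σ i, Icc (0 : ℝ) (n i) × unitInterval × (L i).space

/-- The projection of the parameter space to the complex. -/
noncomputable def paramMap (A : ArcSystem Δ S n x L) (e : Param n L) : Δ.space :=
  ⟨joinPoint n x e.1 e.2.1 e.2.2.1 e.2.2.2, A.joinPoint_mem e.2.1.2 e.2.2.1.2 e.2.2.2.2⟩

theorem continuous_paramMap (A : ArcSystem Δ S n x L) : Continuous A.paramMap := by
  refine continuous_sigma fun i => Continuous.subtype_mk ?_ _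
  have := continuous_arc (x i) (n i)
  change Continuous fun e : Icc (0 : ℝ) (n i) × unitInterval × (L i).space =>
    (1 - (e.2.1 : ℝ)) • arc (x i) (n i) e.1 + (e.2.1 : ℝ) • (e.2.2 : E)
  fun_prop

theorem surjective_paramMap (A : ArcSystem Δ S n x L) : Function.Surjective A.paramMap := by
  rintro ⟨y, hy⟩
  rw [A.space_eq] at hy
  obtain ⟨i, hy⟩ := mem_iUnion.1 hy
  obtain ⟨t, ht, z, hz, s, hs, rfl⟩ := mem_joinArc.1 hy
  exact ⟨⟨i, ⟨t, ht⟩, ⟨s, hs⟩, ⟨z, hz⟩⟩, rfl⟩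

theorem compactSpace_param (A : ArcSystem Δ S n x L) : CompactSpace (Param n L) := by
  have : ∀ i, CompactSpace (L i).space := fun i =>
    isCompact_iff_compactSpace.1 (isCompact_space (A.finite.subset (A.faces_subset i)))
  infer_instance

theorem joinPoint_eq_vertex_iff (A : ArcSystem Δ S n x L) {i k : Fin 3} {j : ℕ} (hj : j ≤ n k)
    {t s : ℝ} {z : E} (ht : t ∈ Icc (0 : ℝ) (n i)) (hs : s ∈ Icc (0 : ℝ) 1)
    (hz : z ∈ (L i).space) :
    joinPoint n x i t s z = x k j ↔ s = 0 ∧ SameParam n i t k j := by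
  obtain ⟨σ, hσ⟩ := A.nonempty k
  obtain ⟨v, hv⟩ := (L k).nonempty_of_mem_faces hσ
  have hv' : v ∈ (L k).space :=
    (L k).convexHull_subset_space hσ (subset_convexHull ℝ _ (Finset.mem_coe.2 hv))
  have h := A.joinPoint_eq_iff (i' := k) (t' := j) (s' := 0) (z' := v) ht
    ⟨by positivity, by exact_mod_cast hj⟩ hs ⟨le_rfl, zero_le_one⟩ hz hv'
  rw [arc_natCast _ hj (A.pos k)] at h
  simp only [sub_zero, one_smul, zero_smul, add_zero] at h
  rw [joinPoint, h]
  constructor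
  · rintro ⟨rfl, h1 | h1, -⟩
    · norm_num at h1
    · exact ⟨rfl, h1⟩
  · rintro ⟨rfl, h1⟩
    exact ⟨rfl, Or.inr h1, Or.inl rfl⟩

theorem joinPoint_eq_finish_iff (A : ArcSystem Δ S n x L) {i : Fin 3}
    {t s : ℝ} {z : E} (ht : t ∈ Icc (0 : ℝ) (n i)) (hs : s ∈ Icc (0 : ℝ) 1)
    (hz : z ∈ (L i).space) :
    joinPoint n x i t s z = x 0 (n 0) ↔ s = 0 ∧ t = n i := by
  rw [A.finish 0 i, A.joinPoint_eq_vertex_iff le_rfl ht hs hz]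
  have := A.pos i
  refine and_congr_right fun _ => ⟨?_, fun h => Or.inl ⟨rfl, h⟩⟩
  rintro (h | h | h)
  · exact h.2
  · have h2 : n i = 0 := by exact_mod_cast h.2
    omega
  · exact h.1

theorem joinPoint_eq_start_iff (A : ArcSystem Δ S n x L) {i : Fin 3}
    {t s : ℝ} {z : E} (ht : t ∈ Icc (0 : ℝ) (n i)) (hs : s ∈ Icc (0 : ℝ) 1)
    (hz : z ∈ (L i).space) :
    joinPoint n x i t s z = x 0 0 ↔ s = 0 ∧ t = 0 := by
  rw [A.start 0 i, A.joinPoint_eq_vertex_iff (Nat.zero_le _) ht hs hz]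
  have := A.pos i
  rw [Nat.cast_zero]
  refine and_congr_right fun _ => ⟨?_, fun h => Or.inl ⟨rfl, h⟩⟩
  rintro (h | h | h)
  · exact h.2
  · exact h.1
  · have h2 : n i = 0 := by exact_mod_cast h.2.symm
    omega

/-- The `k`-th of three consecutive stages of a homotopy. -/
noncomputable def stage (k τ : ℝ) : ℝ := max 0 (min 1 (3 * τ - k))

theorem continuous_stage (k : ℝ) : Continuous (stage k) := by
  unfold stage
  fun_prop

theorem stage_mem (k τ : ℝ) : stage k τ ∈ Icc (0 : ℝ) 1 :=
  ⟨le_max_left _ _, max_le zero_le_one (min_le_left _ _)⟩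

theorem stage_eq_zero {k τ : ℝ} (h : 3 * τ ≤ k) : stage k τ = 0 :=
  max_eq_left ((min_le_right _ _).trans (by linarith))

theorem stage_eq_one {k τ : ℝ} (h : k + 1 ≤ 3 * τ) : stage k τ = 1 := by
  rw [stage, min_eq_left (by linarith), max_eq_right zero_le_one]

theorem stage_succ (k τ : ℝ) : stage (k + 1) τ = 0 ∨ stage k τ = 1 := by
  rcases le_total (3 * τ) (k + 1) with h | h
  exacts [Or.inl (stage_eq_zero h), Or.inr (stage_eq_one h)]

/-- The radial projection onto the complement of the open star of the end of an arc. -/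
noncomputable def radial (m s : ℝ) : ℝ := s / (s + (1 - s) * min 1 m)

theorem radial_mem {m s : ℝ} (hm : 0 ≤ m) (hs : s ∈ Icc (0 : ℝ) 1) : radial m s ∈ Icc (0 : ℝ) 1 := by
  have h : 0 ≤ (1 - s) * min 1 m := mul_nonneg (by linarith [hs.2]) (le_min zero_le_one hm)
  exact ⟨div_nonneg hs.1 (by linarith [hs.1]), div_le_one_of_le₀ (by linarith) (by linarith [hs.1])⟩

theorem radial_zero_right (m : ℝ) : radial m 0 = 0 := by simp [radial]

theorem radial_one_right (m : ℝ) : radial m 1 = 1 := by simp [radial]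

theorem radial_zero_left {s : ℝ} (h : s ≠ 0) : radial 0 s = 1 := by simp [radial, h]

/-- A contraction of the complement of the end of the arcs: points are moved radially away from
the end, then along the arcs to the start of the arcs. -/
noncomputable def contraction (n : Fin 3 → ℕ) (x : Fin 3 → ℕ → E) (τ : ℝ) (i : Fin 3) (t s : ℝ)
    (z : E) : E :=
  joinPoint n x i ((1 - stage 1 τ) * t)
    ((1 - stage 2 τ) * ((1 - stage 0 τ) * s + stage 0 τ * radial (n i - t) s)) z

theorem contraction_param_mem {i : Fin 3} {τ t s : ℝ} (ht : t ∈ Icc (0 : ℝ) (n i))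
    (hs : s ∈ Icc (0 : ℝ) 1) : (1 - stage 1 τ) * t ∈ Icc (0 : ℝ) (n i) ∧
    (1 - stage 2 τ) * ((1 - stage 0 τ) * s + stage 0 τ * radial (n i - t) s) ∈ Icc (0 : ℝ) 1 := by
  have h0 := stage_mem 0 τ
  have h1 := stage_mem 1 τ
  have h2 := stage_mem 2 τ
  have hr := radial_mem (m := n i - t) (by linarith [ht.2]) hs
  have h3 := (convex_Icc (0 : ℝ) 1) hs hr (a := 1 - stage 0 τ) (b := stage 0 τ)
    (by linarith [h0.2]) h0.1 (by ring)
  simp only [smul_eq_mul] at h3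
  refine ⟨⟨mul_nonneg (by linarith [h1.2]) ht.1, ?_⟩, mul_nonneg (by linarith [h2.2]) h3.1, ?_⟩
  · exact (mul_le_of_le_one_left ht.1 (by linarith [h1.1])).trans ht.2
  · exact mul_le_one₀ (by linarith [h2.1]) h3.1 h3.2

/-- Distinct coordinates describe the same point when `s = 0` (the link point is irrelevant), `s =
1` (the arc point is irrelevant) or at a common end of the arcs. The order of the stages respects
this. At the end of the arcs the first stage raises `s` to `1` before the arc parameter moves; when
the last stage lowers `s`, all arc points have reached the start. `stage_succ` provides the
separation of the stages. -/
theorem contraction_eq (A : ArcSystem Δ S n x L) {i i' : Fin 3} {t t' s s' τ : ℝ} {z z' : E}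
    (ht : t ∈ Icc (0 : ℝ) (n i)) (ht' : t' ∈ Icc (0 : ℝ) (n i')) (hs : s ∈ Icc (0 : ℝ) 1)
    (hs' : s' ∈ Icc (0 : ℝ) 1) (hz : z ∈ (L i).space) (hz' : z' ∈ (L i').space)
    (h : joinPoint n x i t s z = joinPoint n x i' t' s' z')
    (hne : joinPoint n x i t s z ≠ x 0 (n 0)) :
    contraction n x τ i t s z = contraction n x τ i' t' s' z' := by
  obtain ⟨rfl, hp, hzz⟩ := (A.joinPoint_eq_iff ht ht' hs hs' hz hz').1 h
  rw [Ne, A.joinPoint_eq_finish_iff ht hs hz] at hne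
  have hm := contraction_param_mem (τ := τ) ht hs
  have hm' := contraction_param_mem (τ := τ) ht' hs
  refine (A.joinPoint_eq_iff hm.1 hm'.1 hm.2 hm'.2 hz hz').2 ?_
  have s01 := stage_succ 0 τ
  have s12 := stage_succ 1 τ
  rw [zero_add] at s01
  rw [one_add_one_eq_two] at s12
  have hstart : stage 1 τ = 1 →
      SameParam n i ((1 - stage 1 τ) * t) i' ((1 - stage 1 τ) * t') := fun e =>
    Or.inr (Or.inl (by simp [e]))
  have hone : ∀ (i : Fin 3), (1 : ℝ) ≤ n i := fun i => by exact_mod_cast A.pos i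
  rcases eq_or_ne s 1 with rfl | hs1
  · simp only [radial_one_right]
    refine ⟨trivial, ?_, Or.inr (hzz.resolve_left one_ne_zero)⟩
    rcases s12 with e | e
    · left
      rw [e]
      ring
    · exact Or.inr (hstart e)
  rcases hp.resolve_left hs1 with ⟨rfl, rfl⟩ | ⟨rfl, rfl⟩ | ⟨rfl, rfl⟩
  · refine ⟨rfl, Or.inr (Or.inl ⟨rfl, rfl⟩), ?_⟩
    rcases hzz with rfl | hzz
    · left
      rw [radial_zero_right]
      ring
    · exact Or.inr hzz
  · have e : radial (n i - 0) s = radial (n i' - 0) s := by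
      simp [radial, min_eq_left (hone _)]
    rw [e]
    refine ⟨rfl, Or.inr (Or.inr (Or.inl (by simp))), ?_⟩
    rcases hzz with rfl | hzz
    · left
      rw [radial_zero_right]
      ring
    · exact Or.inr hzz
  · have h0 : s ≠ 0 := fun h0 => hne ⟨h0, rfl⟩
    simp only [sub_self, radial_zero_left h0, mul_one]
    refine ⟨trivial, ?_, Or.inr (hzz.resolve_left h0)⟩
    rcases s01 with e | e
    · right
      right
      right
      simp [e]
    · rcases s12 with e' | e'
      · left
        rw [e, e']
        ring
      · exact Or.inr (hstart e')

/-- Paths that avoid the end of the arcs are determined up to homotopy by their ends. -/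
theorem homotopic_of_ne_finish (A : ArcSystem Δ S n x L) {y z : Δ.space} (p q : Path y z)
    (hp : ∀ t, (p t : E) ≠ x 0 (n 0)) (hq : ∀ t, (q t : E) ≠ x 0 (n 0)) : p.Homotopic q := by
  have := A.compactSpace_param
  let U : Set Δ.space := {y | (y : E) ≠ x 0 (n 0)}
  let β : unitInterval × Param n L → Δ.space := fun e =>
    ⟨contraction n x e.1 e.2.1 e.2.2.1 e.2.2.2.1 e.2.2.2.2, by
      have h := contraction_param_mem (τ := e.1) e.2.2.1.2 e.2.2.2.1.2
      exact A.joinPoint_mem h.1 h.2 e.2.2.2.2.2⟩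
  have hβ : ContinuousOn β {e | A.paramMap e.2 ∈ U} := by
    rintro ⟨τ, i, d⟩ hd
    refine ContinuousAt.continuousWithinAt ?_
    have hj := (Topology.IsOpenEmbedding.id (X := unitInterval)).prodMap
      (Topology.IsOpenEmbedding.sigmaMk (σ := fun i => Icc (0 : ℝ) (n i) × unitInterval × (L i).space)
        (i := i))
    change ContinuousAt β (Prod.map id (Sigma.mk i) (τ, d))
    rw [← hj.continuousAt_iff (x := (τ, d)), Topology.IsInducing.subtypeVal.continuousAt_iff]
    change ContinuousAt (fun e : unitInterval × Icc (0 : ℝ) (n i) × unitInterval × (L i).space =>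
      contraction n x e.1 i e.2.1 e.2.2.1 e.2.2.2) (τ, d)
    -- The denominator of the radial projection vanishes only for `s = 0` and `t = n i`, that is, at
    -- the removed point.
    have hden : (d.2.1 : ℝ) + (1 - (d.2.1 : ℝ)) * min 1 (n i - (d.1 : ℝ)) ≠ 0 := by
      intro h0
      have hd' : ¬ joinPoint n x i d.1 d.2.1 d.2.2 = x 0 (n 0) := hd
      rw [A.joinPoint_eq_finish_iff d.1.2 d.2.1.2 d.2.2.2] at hd'
      have h1 : (0 : ℝ) ≤ min 1 (n i - (d.1 : ℝ)) := le_min zero_le_one (by linarith [d.1.2.2])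
      have h2 : 0 ≤ (1 - (d.2.1 : ℝ)) * min 1 (n i - (d.1 : ℝ)) :=
        mul_nonneg (by linarith [d.2.1.2.2]) h1
      have h3 : (d.2.1 : ℝ) = 0 := by linarith [d.2.1.2.1]
      rw [h3] at h0
      refine hd' ⟨h3, ?_⟩
      rcases min_choice (1 : ℝ) (n i - (d.1 : ℝ)) with h | h <;> rw [h] at h0 <;> linarith
    have hc := continuous_arc (x i) (n i)
    have hst := continuous_stage
    have hr : ContinuousAt (fun e : unitInterval × Icc (0 : ℝ) (n i) × unitInterval × (L i).space =>
        radial (n i - (e.2.1 : ℝ)) e.2.2.1) (τ, d) := by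
      unfold radial
      refine ContinuousAt.div ?_ ?_ hden <;> fun_prop
    unfold contraction joinPoint
    fun_prop
  obtain ⟨H, hH⟩ := exists_continuous_lift A.continuous_paramMap A.surjective_paramMap U β hβ
    (fun τ d d' h hd => Subtype.ext (A.contraction_eq d.2.1.2 d'.2.1.2 d.2.2.1.2 d'.2.2.1.2
      d.2.2.2.2 d'.2.2.2.2 (congrArg Subtype.val h) hd))
  have hstart : x 0 0 ∈ Δ.space := by
    obtain ⟨σ, hσ⟩ := A.nonempty 0
    exact Δ.convexHull_subset_space (A.face (A.pos 0) hσ) (subset_convexHull ℝ _ (by simp))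
  refine homotopic_of_homotopy_const (A := U) (f := ⟨Subtype.val, continuous_subtype_val⟩)
    (fun _ => rfl) (x₀ := ⟨x 0 0, hstart⟩) ⟨⟨H, ?_, ?_⟩⟩ p q hp hq
  · rintro ⟨y, hy⟩
    obtain ⟨d, rfl⟩ := A.surjective_paramMap y
    refine (hH 0 d hy).trans (Subtype.ext ?_)
    simp only [β, paramMap, contraction]
    rw [stage_eq_zero (by simp), stage_eq_zero (by simp), stage_eq_zero (by simp)]
    simp
  · rintro ⟨y, hy⟩
    obtain ⟨d, rfl⟩ := A.surjective_paramMap y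
    refine (hH 1 d hy).trans (Subtype.ext ?_)
    simp only [β, contraction]
    rw [stage_eq_one (by norm_num), stage_eq_one (by norm_num), stage_eq_one (by norm_num)]
    simp [joinPoint, A.arc_zero, A.start d.1 0]

theorem joinedIn_of_param (A : ArcSystem Δ S n x L) (W : Set Δ.space) {i : Fin 3} {t t' s s' : ℝ}
    {z : E} (ht : t ∈ Icc (0 : ℝ) (n i)) (ht' : t' ∈ Icc (0 : ℝ) (n i)) (hs : s ∈ Icc (0 : ℝ) 1)
    (hs' : s' ∈ Icc (0 : ℝ) 1) (hz : z ∈ (L i).space)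
    (hW : ∀ τ ∈ Icc (0 : ℝ) 1, ∀ h,
      (⟨joinPoint n x i ((1 - τ) * t + τ * t') ((1 - τ) * s + τ * s') z, h⟩ : Δ.space) ∈ W) :
    JoinedIn W ⟨joinPoint n x i t s z, A.joinPoint_mem ht hs hz⟩
      ⟨joinPoint n x i t' s' z, A.joinPoint_mem ht' hs' hz⟩ := by
  have hm : ∀ τ ∈ Icc (0 : ℝ) 1,
      joinPoint n x i ((1 - τ) * t + τ * t') ((1 - τ) * s + τ * s') z ∈ Δ.space := by
    intro τ hτ
    have h1 := (convex_Icc (0 : ℝ) (n i)) ht ht' (a := 1 - τ) (b := τ) (by linarith [hτ.2]) hτ.1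
      (by ring)
    have h2 := (convex_Icc (0 : ℝ) 1) hs hs' (a := 1 - τ) (b := τ) (by linarith [hτ.2]) hτ.1
      (by ring)
    exact A.joinPoint_mem h1 h2 hz
  have hc := continuous_arc (x i) (n i)
  have hcont : Continuous fun τ : unitInterval =>
      joinPoint n x i ((1 - (τ : ℝ)) * t + τ * t') ((1 - (τ : ℝ)) * s + τ * s') z := by
    unfold joinPoint
    fun_prop
  exact ⟨⟨⟨fun τ => ⟨_, hm τ τ.2⟩, hcont.subtype_mk _⟩, by simp, by simp⟩,
    fun τ => hW τ τ.2 _⟩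

/-- An equivalence class with at least two of three elements leaves at most one element, which would
be isolated. -/
theorem forall_of_no_isolated (R : Fin 3 → Fin 3 → Prop) (hs : ∀ {i j}, R i j → R j i)
    (ht : ∀ {i j k}, R i j → R j k → R i k) (step : ∀ i, ∃ j ≠ i, R i j) (i : Fin 3) : R 0 i := by
  obtain ⟨i0, n0, h0⟩ := step 0
  obtain ⟨i1, n1, h1⟩ := step 1
  obtain ⟨i2, n2, h2⟩ := step 2
  have h00 := ht h0 (hs h0)
  fin_cases i0 <;> fin_cases i1 <;> fin_cases i2 <;> fin_cases i <;> simp at * <;> grind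

/-- The open cover consists of the complements of the start and of the end. Every point of the
intersection can be moved along its arc coordinate to the middle of the arc. The middles of
different arcs are connected through simplices that their complexes share. -/
theorem simplyConnectedSpace (A : ArcSystem Δ S n x L) : SimplyConnectedSpace Δ.space := by
  let v : Bool → E := fun e => if e then x 0 (n 0) else x 0 0
  let U : Bool → Set Δ.space := fun e => {y | (y : E) ≠ v e}
  have hone : ∀ i, (1 : ℝ) ≤ n i := fun i => by exact_mod_cast A.pos i
  have hhalf : ∀ i, (n i : ℝ) / 2 ∈ Icc (0 : ℝ) (n i) := fun i =>
    ⟨by linarith [hone i], by linarith [hone i]⟩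
  have hv : ∀ {e i t s z}, t ∈ Icc (0 : ℝ) (n i) → s ∈ Icc (0 : ℝ) 1 → z ∈ (L i).space →
      (joinPoint n x i t s z = v e ↔ s = 0 ∧ t = if e then (n i : ℝ) else 0) := by
    intro e i t s z ht hs hz
    cases e
    · exact A.joinPoint_eq_start_iff ht hs hz
    · exact A.joinPoint_eq_finish_iff ht hs hz
  choose ζ hζ using fun i => (L i).nonempty_of_mem_faces (A.nonempty i).choose_spec
  have hζ' : ∀ i, ζ i ∈ (L i).space := fun i =>
    (L i).convexHull_subset_space (A.nonempty i).choose_spec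
      (subset_convexHull ℝ _ (Finset.mem_coe.2 (hζ i)))
  let m : Fin 3 → Δ.space := fun i =>
    ⟨joinPoint n x i (n i / 2) 0 (ζ i), A.joinPoint_mem (hhalf i) ⟨le_rfl, zero_le_one⟩ (hζ' i)⟩
  let W : Set Δ.space := U true ∩ U false
  have hWU : ∀ e, W ⊆ U e := by
    rintro (_ | _)
    exacts [inter_subset_right, inter_subset_left]
  have hmem : ∀ {i t s z}, ∀ h, t ∈ Icc (0 : ℝ) (n i) → s ∈ Icc (0 : ℝ) 1 → z ∈ (L i).space →
      t ≠ 0 → t ≠ n i → (⟨joinPoint n x i t s z, h⟩ : Δ.space) ∈ W := by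
    intro i t s z h ht hs hz h0 h1
    refine ⟨fun e => h1 ?_, fun e => h0 ?_⟩
    · exact ((hv ht hs hz).1 e).2
    · exact ((hv ht hs hz).1 e).2
  have vert : ∀ i s z, ∀ hs : s ∈ Icc (0 : ℝ) 1, ∀ hz : z ∈ (L i).space, JoinedIn W (m i)
      ⟨joinPoint n x i (n i / 2) s z, A.joinPoint_mem (hhalf i) hs hz⟩ := by
    intro i s z hs hz
    have e : m i = ⟨joinPoint n x i (n i / 2) 0 z,
        A.joinPoint_mem (hhalf i) ⟨le_rfl, zero_le_one⟩ hz⟩ := by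
      simp [m, joinPoint]
    rw [e]
    refine A.joinedIn_of_param W (hhalf i) (hhalf i) ⟨le_rfl, zero_le_one⟩ hs hz fun τ hτ h => ?_
    have e' : (1 - τ) * ((n i : ℝ) / 2) + τ * (n i / 2) = n i / 2 := by ring
    refine hmem _ (by rw [e']; exact hhalf i) ?_ hz ?_ ?_
    · exact (convex_Icc (0 : ℝ) 1) ⟨le_rfl, zero_le_one⟩ hs (a := 1 - τ) (b := τ)
        (by linarith [hτ.2]) hτ.1 (by ring)
    · rw [e']
      linarith [hone i]
    · rw [e']
      linarith [hone i]
  have hm : ∀ i, JoinedIn W (m 0) (m i) := by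
    have step : ∀ i, ∃ i' ≠ i, JoinedIn W (m i) (m i') := by
      intro i
      obtain ⟨i', hne, σ, hσ, hσ'⟩ := A.meet i
      obtain ⟨z, hz⟩ := (L i).nonempty_of_mem_faces hσ
      have h1 : z ∈ (L i).space :=
        (L i).convexHull_subset_space hσ (subset_convexHull ℝ _ (Finset.mem_coe.2 hz))
      have h2 : z ∈ (L i').space :=
        (L i').convexHull_subset_space hσ' (subset_convexHull ℝ _ (Finset.mem_coe.2 hz))
      have j1 := vert i 1 z ⟨zero_le_one, le_rfl⟩ h1
      have j2 := vert i' 1 z ⟨zero_le_one, le_rfl⟩ h2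
      have e : joinPoint n x i (n i / 2) 1 z = joinPoint n x i' (n i' / 2) 1 z := by
        simp [joinPoint]
      simp only [e] at j1
      exact ⟨i', hne, j1.trans j2.symm⟩
    exact forall_of_no_isolated (fun i i' => JoinedIn W (m i) (m i')) (fun h => h.symm)
      (fun h h' => h.trans h') step
  refine simplyConnectedSpace_of_openCover U (fun e => ?_) ?_ (m 0) ?_ ?_
  · exact isOpen_ne_fun continuous_subtype_val continuous_const
  · refine eq_univ_of_forall fun y => mem_iUnion.2 ?_
    by_cases h : (y : E) = x 0 0
    · refine ⟨true, fun h' => ?_⟩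
      have := A.inj_self (Nat.zero_le _) le_rfl (h.symm.trans h')
      have := A.pos 0
      omega
    · exact ⟨false, h⟩
  · rintro e e' y ⟨hy, hy'⟩
    obtain ⟨⟨i, ⟨t, ht⟩, ⟨s, hs⟩, ⟨z, hz⟩⟩, rfl⟩ := A.surjective_paramMap y
    refine ((hm i).trans (vert i s z hs hz)).mono (subset_inter (hWU e) (hWU e')) |>.trans
      (JoinedIn.symm ?_)
    -- With the link coordinates fixed, moving the arc parameter linearly to the middle meets an end
    -- only if the motion starts there.
    have key : ∀ e, A.paramMap ⟨i, ⟨t, ht⟩, ⟨s, hs⟩, ⟨z, hz⟩⟩ ∈ U e → ∀ τ ∈ Icc (0 : ℝ) 1, ∀ h,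
        (⟨joinPoint n x i ((1 - τ) * t + τ * (n i / 2)) ((1 - τ) * s + τ * s) z, h⟩ : Δ.space) ∈
          U e := by
      intro e he τ hτ h heq
      have e' : (1 - τ) * s + τ * s = s := by ring
      have htτ := (convex_Icc (0 : ℝ) (n i)) ht (hhalf i) (a := 1 - τ) (b := τ)
        (by linarith [hτ.2]) hτ.1 (by ring)
      change joinPoint n x i _ _ z = v e at heq
      simp only [smul_eq_mul] at htτ
      rw [e', hv htτ hs hz] at heq
      refine he ((hv ht hs hz).2 ⟨heq.1, ?_⟩)
      have h2 := heq.2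
      have hn := hone i
      have hτ0 : τ = 0 := by
        cases e
        · simp only [Bool.false_eq_true, if_false] at h2
          nlinarith [mul_nonneg (sub_nonneg.2 hτ.2) ht.1, hτ.1]
        · simp only [if_true] at h2
          nlinarith [mul_nonneg (sub_nonneg.2 hτ.2) (sub_nonneg.2 ht.2), hτ.1]
      simpa [hτ0] using h2
    exact A.joinedIn_of_param _ ht (hhalf i) hs hs hz fun τ hτ h =>
      ⟨key e hy τ hτ h, key e' hy' τ hτ h⟩
  · rintro (_ | _) y z p q hp hq
    · refine A.reverse.homotopic_of_ne_finish p q (fun t => ?_) (fun t => ?_)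
      · simp only [Nat.sub_self]
        exact hp t
      · simp only [Nat.sub_self]
        exact hq t
    · exact A.homotopic_of_ne_finish p q hp hq

end ArcSystem

theorem groupRank_eq_zero {G : Type*} [Group G] [Subsingleton G] : groupRank G = 0 := by
  refine le_antisymm ?_ zero_le
  have h : Subgroup.closure (∅ : Set G) = ⊤ := Subgroup.ext fun g => by simp [Subsingleton.elim g 1]
  exact (iInf₂_le ∅ h).trans (by simp)

theorem groupRank_fundamentalGroup {X : Type*} [TopologicalSpace X] [SimplyConnectedSpace X]
    (x : X) : groupRank (FundamentalGroup X x) = 0 := by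
  have : Subsingleton (FundamentalGroup X x) :=
    inferInstanceAs (Subsingleton (Path.Homotopic.Quotient x x))
  exact groupRank_eq_zero

end BalancedComplex


namespace BalancedComplex

open Set PLTopology

/-! ### Facets of balanced normal pseudomanifolds: exchange and strong connectivity. -/

section Facets

variable {E : Type*} [NormedAddCommGroup E] [NormedSpace ℝ E] {d : ℕ}
  {Δ : Geometry.SimplicialComplex ℝ E} {κ : E → Fin (d + 1)}

theorem IsNormalPseudomanifold.exists_facet (h : IsNormalPseudomanifold d Δ) {σ : Finset E}
    (hσ : IsSimplex Δ σ) : ∃ τ ∈ Δ.facets, σ ⊆ τ := by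
  have key : ∀ σ ∈ Δ.faces, ∃ τ ∈ Δ.facets, σ ⊆ τ := by
    intro σ hσ
    obtain ⟨τ, hστ, hτ⟩ := h.finite.exists_le_maximal hσ
    exact ⟨τ, ⟨hτ.prop, fun ρ hρ hle => hτ.eq_of_le hρ hle⟩, hστ⟩
  rcases hσ with rfl | hσ
  · obtain ⟨σ, hσ⟩ := h.pure.1
    obtain ⟨τ, hτ, -⟩ := key σ hσ
    exact ⟨τ, hτ, Finset.empty_subset _⟩
  · exact key σ hσ

theorem IsNormalPseudomanifold.mem_facets (h : IsNormalPseudomanifold d Δ) {σ : Finset E}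
    (hσ : σ ∈ Δ.faces) (hc : d + 1 ≤ σ.card) : σ ∈ Δ.facets := by
  obtain ⟨τ, hτ, hστ⟩ := h.exists_facet (Or.inr hσ)
  rwa [Finset.eq_of_subset_of_card_le hστ (by rw [h.pure.2 τ hτ]; exact hc)]

theorem isSimplex_of_subset {σ τ : Finset E} (hτ : τ ∈ Δ.faces) (h : σ ⊆ τ) : IsSimplex Δ σ := by
  rcases σ.eq_empty_or_nonempty with h0 | h0
  exacts [Or.inl h0, Or.inr (Δ.down_closed hτ h h0)]

theorem IsBalancedColoring.eq (hκ : IsBalancedColoring Δ κ) {τ : Finset E} (hτ : τ ∈ Δ.faces)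
    {u v : E} (hu : u ∈ τ) (hv : v ∈ τ) (h : κ u = κ v) : u = v :=
  hκ τ hτ hu hv h

theorem IsNormalPseudomanifold.exists_color (h : IsNormalPseudomanifold d Δ)
    (hκ : IsBalancedColoring Δ κ) {τ : Finset E} (hτ : τ ∈ Δ.facets) (c : Fin (d + 1)) :
    ∃ v ∈ τ, κ v = c := by
  have h1 : (τ.image κ).card = d + 1 := by
    rw [Finset.card_image_of_injOn (hκ τ hτ.1), h.pure.2 τ hτ]
  have h2 : τ.image κ = Finset.univ := Finset.eq_univ_of_card _ (by rw [h1, Fintype.card_fin])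
  have h3 : c ∈ τ.image κ := h2 ▸ Finset.mem_univ c
  simpa using h3

theorem IsNormalPseudomanifold.facet_unique (h : IsNormalPseudomanifold d Δ) {σ τ τ₁ τ₂ : Finset E}
    (hc : σ.card = d) (hτ : τ ∈ Δ.facets) (hτ₁ : τ₁ ∈ Δ.facets) (hτ₂ : τ₂ ∈ Δ.facets)
    (hσ : σ ⊆ τ) (hσ₁ : σ ⊆ τ₁) (hσ₂ : σ ⊆ τ₂) (h₁ : τ₁ ≠ τ) (h₂ : τ₂ ≠ τ) : τ₁ = τ₂ := by
  obtain ⟨α, β, -, hαβ⟩ := Set.ncard_eq_two.1 (h.ridge σ (isSimplex_of_subset hτ.1 hσ) hc)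
  have m : ∀ ρ, ρ ∈ Δ.facets → σ ⊆ ρ → ρ = α ∨ ρ = β := fun ρ h1 h2 => by
    have : ρ ∈ ({α, β} : Set (Finset E)) := hαβ ▸ ⟨h1, h2⟩
    simpa using this
  rcases m τ hτ hσ with e | e <;> rcases m τ₁ hτ₁ hσ₁ with e₁ | e₁ <;>
    rcases m τ₂ hτ₂ hσ₂ with e₂ | e₂ <;> subst_vars <;> first | rfl | contradiction

open Classical in
/-- A vertex of a facet can be exchanged for another vertex of the same colour. -/
theorem IsNormalPseudomanifold.exists_exchange (h : IsNormalPseudomanifold d Δ)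
    (hκ : IsBalancedColoring Δ κ) {τ : Finset E} (hτ : τ ∈ Δ.facets) {u : E} (hu : u ∈ τ) :
    ∃ u', u' ≠ u ∧ κ u' = κ u ∧ insert u' (τ.erase u) ∈ Δ.facets := by
  have hcard : (τ.erase u).card = d := by
    rw [Finset.card_erase_of_mem hu, h.pure.2 τ hτ, Nat.add_sub_cancel]
  obtain ⟨α, β, hne, hαβ⟩ := Set.ncard_eq_two.1
    (h.ridge (τ.erase u) (isSimplex_of_subset hτ.1 (Finset.erase_subset _ _)) hcard)
  have key : ∃ τ', τ' ≠ τ ∧ τ' ∈ Δ.facets ∧ τ.erase u ⊆ τ' := by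
    have hα : α ∈ {τ' | τ' ∈ Δ.facets ∧ τ.erase u ⊆ τ'} := by simp [hαβ]
    have hβ : β ∈ {τ' | τ' ∈ Δ.facets ∧ τ.erase u ⊆ τ'} := by simp [hαβ]
    rcases eq_or_ne α τ with rfl | h1
    exacts [⟨β, hne.symm, hβ⟩, ⟨α, h1, hα⟩]
  obtain ⟨τ', hne', hτ', hsub⟩ := key
  obtain ⟨u', hu', hc⟩ := h.exists_color hκ hτ' (κ u)
  have hu'' : u' ∉ τ.erase u := fun hm =>
    (Finset.mem_erase.1 hm).1 (hκ.eq hτ.1 (Finset.mem_erase.1 hm).2 hu hc)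
  have he : insert u' (τ.erase u) = τ' := by
    refine Finset.eq_of_subset_of_card_le (Finset.insert_subset hu' hsub) ?_
    rw [Finset.card_insert_of_notMem hu'', hcard, h.pure.2 τ' hτ']
  refine ⟨u', ?_, hc, he ▸ hτ'⟩
  rintro rfl
  exact hne' (by rw [← he, Finset.insert_erase hu])

open Classical in
/-- The facets that contain a given simplex are connected through facets
that share all but one of their vertices. -/
theorem IsNormalPseudomanifold.exists_adjacent_facets (h : IsNormalPseudomanifold d Δ)
    {σ₀ : Finset E} (Q : Finset E → Prop) {τ₁ τ₂ : Finset E}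
    (hτ₁ : τ₁ ∈ Δ.facets) (hτ₂ : τ₂ ∈ Δ.facets) (hσ₁ : σ₀ ⊆ τ₁) (hσ₂ : σ₀ ⊆ τ₂) (hQ₁ : Q τ₁)
    (hQ₂ : ¬ Q τ₂) : ∃ ρ₁ ∈ Δ.facets, ∃ ρ₂ ∈ Δ.facets, σ₀ ⊆ ρ₁ ∧ σ₀ ⊆ ρ₂ ∧ Q ρ₁ ∧ ¬ Q ρ₂ ∧
      d ≤ (ρ₁ ∩ ρ₂).card := by
  by_contra! hcon
  -- If no two such facets were adjacent, a simplex lying in facets of both kinds could be enlarged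
  -- again and again, until two facets of different kinds share `d` vertices after all.
  have key : ∀ m, ∃ σ, σ₀ ⊆ σ ∧ m ≤ σ.card ∧ (∃ ρ₁ ∈ Δ.facets, σ ⊆ ρ₁ ∧ Q ρ₁) ∧
      ∃ ρ₂ ∈ Δ.facets, σ ⊆ ρ₂ ∧ ¬ Q ρ₂ := by
    intro m
    induction m with
    | zero => exact ⟨σ₀, subset_rfl, Nat.zero_le _, ⟨τ₁, hτ₁, hσ₁, hQ₁⟩, τ₂, hτ₂, hσ₂, hQ₂⟩
    | succ m ih =>
      obtain ⟨σ, h0, hm, ⟨ρ₁, hρ₁, h1, hQ1⟩, ρ₂, hρ₂, h2, hQ2⟩ := ih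
      rcases hm.lt_or_eq with hm | rfl
      · exact ⟨σ, h0, hm, ⟨ρ₁, hρ₁, h1, hQ1⟩, ρ₂, hρ₂, h2, hQ2⟩
      have hcard : σ.card + 2 ≤ d + 1 := by
        have := hcon ρ₁ hρ₁ ρ₂ hρ₂ (h0.trans h1) (h0.trans h2) hQ1 hQ2
        have := Finset.card_le_card (Finset.subset_inter h1 h2)
        omega
      -- The part of the link of `σ` covered by facets of kind `R`. The parts for `Q` and its
      -- negation are closed, meet the link and cover it, so they intersect because the link is
      -- connected.
      let C : (Finset E → Prop) → Set E := fun R =>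
        ⋃ γ ∈ {γ | γ ∈ (linkComplex Δ σ).faces ∧ ∃ ρ ∈ Δ.facets, γ ∪ σ ⊆ ρ ∧ R ρ},
          convexHull ℝ (γ : Set E)
      have hC : ∀ R, IsClosed (C R) := fun R =>
        Set.Finite.isClosed_biUnion (h.finite.subset fun γ hγ => (mem_linkComplex.1 hγ.1).1)
          fun γ _ => (γ.finite_toSet.isCompact_convexHull ℝ).isClosed
      have hne : ∀ R : Finset E → Prop, (∃ ρ ∈ Δ.facets, σ ⊆ ρ ∧ R ρ) →
          ((linkComplex Δ σ).space ∩ C R).Nonempty := by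
        rintro R ⟨ρ, hρ, hσρ, hR⟩
        have hlt : (ρ \ σ).Nonempty := by
          rw [← Finset.card_pos, Finset.card_sdiff_of_subset hσρ, h.pure.2 ρ hρ]
          omega
        have hmem : ρ \ σ ∈ (linkComplex Δ σ).faces := by
          rw [mem_linkComplex, Finset.sdiff_union_of_subset hσρ]
          exact ⟨Δ.down_closed hρ.1 Finset.sdiff_subset hlt, hρ.1, Finset.sdiff_disjoint⟩
        obtain ⟨v, hv⟩ := hlt
        have hv' := subset_convexHull ℝ ((ρ \ σ : Finset E) : Set E) (Finset.mem_coe.2 hv)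
        refine ⟨v, Geometry.SimplicialComplex.convexHull_subset_space hmem hv', ?_⟩
        refine mem_iUnion₂.2 ⟨ρ \ σ, ⟨hmem, ρ, hρ, ?_, hR⟩, hv'⟩
        rw [Finset.sdiff_union_of_subset hσρ]
      have hconn := (h.link_connected σ (isSimplex_of_subset hρ₁.1 h1) hcard).isPreconnected
      rw [isPreconnected_closed_iff] at hconn
      obtain ⟨y, -, hy1, hy2⟩ := hconn (C Q) (C fun ρ => ¬ Q ρ) (hC _) (hC _) (by
        intro y hy
        obtain ⟨γ, hγ, hyγ⟩ := Geometry.SimplicialComplex.mem_space_iff.1 hy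
        obtain ⟨ρ, hρ, hγρ⟩ := h.exists_facet (Or.inr (mem_linkComplex.1 hγ).2.1)
        by_cases hQ : Q ρ
        · exact Or.inl (mem_iUnion₂.2 ⟨γ, ⟨hγ, ρ, hρ, hγρ, hQ⟩, hyγ⟩)
        · exact Or.inr (mem_iUnion₂.2 ⟨γ, ⟨hγ, ρ, hρ, hγρ, hQ⟩, hyγ⟩))
        (hne _ ⟨ρ₁, hρ₁, h1, hQ1⟩) (hne _ ⟨ρ₂, hρ₂, h2, hQ2⟩)
      obtain ⟨γ₁, ⟨hγ₁, α₁, hα₁, hs₁, hR₁⟩, hy1⟩ := mem_iUnion₂.1 hy1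
      obtain ⟨γ₂, ⟨hγ₂, α₂, hα₂, hs₂, hR₂⟩, hy2⟩ := mem_iUnion₂.1 hy2
      -- A common point of two simplices of the link forces a common vertex, which is then added to
      -- `σ`.
      have hy := (linkComplex Δ σ).inter_subset_convexHull hγ₁ hγ₂ ⟨hy1, hy2⟩
      obtain ⟨v, hv⟩ := convexHull_nonempty_iff.1 ⟨y, hy⟩
      have hv1 := Finset.mem_coe.1 hv.1
      have hv2 := Finset.mem_coe.1 hv.2
      refine ⟨insert v σ, h0.trans (Finset.subset_insert _ _), ?_, ⟨α₁, hα₁, ?_, hR₁⟩, α₂, hα₂, ?_,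
        hR₂⟩
      · rw [Finset.card_insert_of_notMem
          (Finset.disjoint_left.1 (mem_linkComplex.1 hγ₁).2.2 hv1)]
      · exact Finset.insert_subset (hs₁ (Finset.mem_union_left _ hv1))
          (Finset.subset_union_right.trans hs₁)
      · exact Finset.insert_subset (hs₂ (Finset.mem_union_left _ hv2))
          (Finset.subset_union_right.trans hs₂)
  obtain ⟨σ, h0, hm, ⟨ρ₁, hρ₁, h1, hQ1⟩, ρ₂, hρ₂, h2, hQ2⟩ := key d
  have := hcon ρ₁ hρ₁ ρ₂ hρ₂ (h0.trans h1) (h0.trans h2) hQ1 hQ2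
  have := Finset.card_le_card (Finset.subset_inter h1 h2)
  omega

end Facets

end BalancedComplex


namespace BalancedComplex

open Set PLTopology

/-! ### The graph of a rank-two subcomplex and the links of its edges. -/

section RankTwo

variable {E : Type*} [NormedAddCommGroup E] [NormedSpace ℝ E] {d : ℕ}
  {Δ : Geometry.SimplicialComplex ℝ E} {κ : E → Fin (d + 1)} {p q : Fin (d + 1)}

theorem mem_rankSelected {S : Finset (Fin (d + 1))} {σ : Finset E} :
    σ ∈ (rankSelected Δ κ S).faces ↔ σ ∈ Δ.faces ∧ ∀ v ∈ σ, κ v ∈ S := Iff.rfl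

theorem vertex_color (u : (rankSelected Δ κ {p, q}).vertices) : κ u = p ∨ κ u = q := by
  simpa using (mem_rankSelected.1 u.2).2 u (Finset.mem_singleton_self _)

theorem mem_vertices_of_mem {τ : Finset E} (hτ : τ ∈ Δ.faces) {u : E} (hu : u ∈ τ)
    (hc : κ u = p ∨ κ u = q) : u ∈ (rankSelected Δ κ {p, q}).vertices :=
  ⟨Δ.down_closed hτ (Finset.singleton_subset_iff.2 hu) (Finset.singleton_nonempty u), by
    simpa using hc⟩

theorem adj_of_mem {τ : Finset E} (hτ : τ ∈ Δ.faces) {u v : (rankSelected Δ κ {p, q}).vertices}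
    (hu : (u : E) ∈ τ) (hv : (v : E) ∈ τ) (h : u ≠ v) :
    (graph (rankSelected Δ κ {p, q})).Adj u v := by
  classical
  refine ⟨h, {(u : E), (v : E)}, ⟨Δ.down_closed hτ ?_ (by simp), ?_⟩, by simp, by simp⟩
  · simp [Finset.insert_subset_iff, hu, hv]
  · intro w hw
    rcases Finset.mem_insert.1 hw with rfl | hw
    · simpa using vertex_color u
    · rw [Finset.mem_singleton.1 hw]
      simpa using vertex_color v

open Classical in
theorem adj_face {u v : (rankSelected Δ κ {p, q}).vertices}
    (h : (graph (rankSelected Δ κ {p, q})).Adj u v) : {(u : E), (v : E)} ∈ Δ.faces := by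
  obtain ⟨-, σ, hσ, hu, hv⟩ := h
  exact Δ.down_closed hσ.1 (by simp [Finset.insert_subset_iff, hu, hv]) (by simp)

theorem adj_color (hκ : IsBalancedColoring Δ κ) {u v : (rankSelected Δ κ {p, q}).vertices}
    (h : (graph (rankSelected Δ κ {p, q})).Adj u v) : κ u ≠ κ v := by
  obtain ⟨hne, σ, hσ, hu, hv⟩ := h
  exact fun e => hne (Subtype.ext (hκ.eq hσ.1 hu hv e))

theorem adj_adj_color (hκ : IsBalancedColoring Δ κ) {w u v : (rankSelected Δ κ {p, q}).vertices}
    (hu : (graph (rankSelected Δ κ {p, q})).Adj w u)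
    (hv : (graph (rankSelected Δ κ {p, q})).Adj w v) : κ u = κ v := by
  have h1 := adj_color hκ hu
  have h2 := adj_color hκ hv
  rcases vertex_color u with a | a <;> rcases vertex_color v with b | b <;>
    rcases vertex_color w with c | c <;> simp_all

open Classical in
/-- Along a facet, a neighbour `u` of `w` can be exchanged for another neighbour of `w`. -/
theorem IsNormalPseudomanifold.exists_exchange_adj (h : IsNormalPseudomanifold d Δ)
    (hκ : IsBalancedColoring Δ κ) {w u : (rankSelected Δ κ {p, q}).vertices}
    (hu : (graph (rankSelected Δ κ {p, q})).Adj w u) {τ : Finset E} (hτ : τ ∈ Δ.facets)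
    (hwτ : (w : E) ∈ τ) (huτ : (u : E) ∈ τ) :
    ∃ u' : (rankSelected Δ κ {p, q}).vertices, (graph (rankSelected Δ κ {p, q})).Adj w u' ∧
      u' ≠ u ∧ insert (u' : E) (τ.erase u) ∈ Δ.facets := by
  obtain ⟨u', hne, hc, hf⟩ := h.exists_exchange hκ hτ huτ
  have hu' : u' ∈ (rankSelected Δ κ {p, q}).vertices :=
    mem_vertices_of_mem hf.1 (Finset.mem_insert_self _ _) (by
      rw [hc]
      exact vertex_color u)
  have hwu : w ≠ u := hu.1
  refine ⟨⟨u', hu'⟩, adj_of_mem hf.1 ?_ (Finset.mem_insert_self _ _) ?_, ?_, hf⟩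
  · exact Finset.mem_insert_of_mem (Finset.mem_erase.2 ⟨fun e => hwu (Subtype.ext e), hwτ⟩)
  · rintro rfl
    exact adj_color hκ hu hc
  · exact fun e => hne (congrArg Subtype.val e)

-- In a facet containing `γ`, `w` and `u`, exchange `u`. The new vertex is a neighbour of `w` other
-- than `u`, hence `u'`, and the new facet still contains `γ`.
open Classical in
theorem link_subset_of_two_neighbors (h : IsNormalPseudomanifold d Δ)
    (hκ : IsBalancedColoring Δ κ) {w u u' : (rankSelected Δ κ {p, q}).vertices}
    (hu : (graph (rankSelected Δ κ {p, q})).Adj w u)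
    (hw : ∀ y, (graph (rankSelected Δ κ {p, q})).Adj w y → y = u ∨ y = u') :
    (linkComplex Δ {(w : E), (u : E)}).faces ⊆ (linkComplex Δ {(w : E), (u' : E)}).faces := by
  intro γ hγ
  rw [mem_linkComplex] at hγ
  obtain ⟨hγΔ, hγu, hdisj⟩ := hγ
  obtain ⟨τ, hτ, hγτ⟩ := h.exists_facet (Or.inr hγu)
  have hwτ : (w : E) ∈ τ := hγτ (by simp)
  have huτ : (u : E) ∈ τ := hγτ (by simp)
  obtain ⟨y, hy, hne, hf⟩ := h.exists_exchange_adj hκ hu hτ hwτ huτ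
  obtain rfl := (hw y hy).resolve_left hne
  have hwu : w ≠ u := hu.1
  rw [mem_linkComplex]
  rw [Finset.disjoint_right] at hdisj ⊢
  refine ⟨hγΔ, Δ.down_closed hf.1 ?_ ?_, ?_⟩
  · refine Finset.union_subset (fun v hv => ?_) ?_
    · refine Finset.mem_insert_of_mem (Finset.mem_erase.2 ⟨?_, hγτ (Finset.mem_union_left _ hv)⟩)
      rintro rfl
      exact hdisj (by simp) hv
    · rw [Finset.insert_subset_iff, Finset.singleton_subset_iff]
      refine ⟨Finset.mem_insert_of_mem (Finset.mem_erase.2 ⟨?_, hwτ⟩), Finset.mem_insert_self _ _⟩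
      exact fun e => hwu (Subtype.ext e)
  · simp
  · intro v hv hvγ
    rcases Finset.mem_insert.1 hv with rfl | hv
    · exact hdisj (by simp) hvγ
    · rw [Finset.mem_singleton.1 hv] at hvγ
      exact hne (Subtype.ext (hκ.eq hτ.1 (hγτ (Finset.mem_union_left _ hvγ)) huτ
        (adj_adj_color hκ hy hu)))

open Classical in
/-- The two edges at a vertex of degree two have the same link. -/
theorem link_eq_of_two_neighbors (h : IsNormalPseudomanifold d Δ)
    (hκ : IsBalancedColoring Δ κ) {w u u' : (rankSelected Δ κ {p, q}).vertices}
    (hu : (graph (rankSelected Δ κ {p, q})).Adj w u)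
    (hu' : (graph (rankSelected Δ κ {p, q})).Adj w u')
    (hw : ∀ y, (graph (rankSelected Δ κ {p, q})).Adj w y → y = u ∨ y = u') :
    linkComplex Δ {(w : E), (u : E)} = linkComplex Δ {(w : E), (u' : E)} :=
  Geometry.SimplicialComplex.ext (Subset.antisymm (link_subset_of_two_neighbors h hκ hu hw)
    (link_subset_of_two_neighbors h hκ hu' fun y hy => (hw y hy).symm))

open Classical in
/-- If two edges at a vertex have the same link, there is no third edge. -/
theorem eq_or_eq_of_link_eq (h : IsNormalPseudomanifold d Δ) (hd : 2 ≤ d)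
    (hκ : IsBalancedColoring Δ κ) {a u w : (rankSelected Δ κ {p, q}).vertices}
    (hu : (graph (rankSelected Δ κ {p, q})).Adj a u)
    (hw : (graph (rankSelected Δ κ {p, q})).Adj a w) (huw : u ≠ w)
    (hL : linkComplex Δ {(a : E), (u : E)} = linkComplex Δ {(a : E), (w : E)})
    {y : (rankSelected Δ κ {p, q}).vertices}
    (hy : (graph (rankSelected Δ κ {p, q})).Adj a y) : y = u ∨ y = w := by
  by_contra! hcon
  obtain ⟨τ₁, hτ₁, h₁⟩ := h.exists_facet (Or.inr (adj_face hu))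
  obtain ⟨τ₂, hτ₂, h₂⟩ := h.exists_facet (Or.inr (adj_face hy))
  rw [Finset.insert_subset_iff, Finset.singleton_subset_iff] at h₁ h₂
  -- Among the facets at `a`, those containing `u` or `w` are separated from those containing a
  -- third neighbour; so some adjacent pair crosses from the former to facets containing neither.
  obtain ⟨ρ₁, hρ₁, ρ₂, hρ₂, ha₁, ha₂, hQ₁, hQ₂, hcard⟩ := h.exists_adjacent_facets (σ₀ := {(a : E)})
    (fun τ => (u : E) ∈ τ ∨ (w : E) ∈ τ) hτ₁ hτ₂ (by simpa using h₁.1) (by simpa using h₂.1)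
    (Or.inl h₁.2) (by
      rintro (e | e)
      · exact hcon.1 (Subtype.ext (hκ.eq hτ₂.1 h₂.2 e (adj_adj_color hκ hy hu)))
      · exact hcon.2 (Subtype.ext (hκ.eq hτ₂.1 h₂.2 e (adj_adj_color hκ hy hw))))
  rw [Finset.singleton_subset_iff] at ha₁ ha₂
  push Not at hQ₂
  -- The common ridge is the first facet without `v`. Equality of the links makes the ridge together
  -- with `v'` a facet as well, so the ridge would lie in three facets. The simplex `γ` is nonempty
  -- because `2 ≤ d`.
  have key : ∀ v v' : (rankSelected Δ κ {p, q}).vertices,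
      (graph (rankSelected Δ κ {p, q})).Adj a v → (graph (rankSelected Δ κ {p, q})).Adj a v' →
      v ≠ v' → linkComplex Δ {(a : E), (v : E)} = linkComplex Δ {(a : E), (v' : E)} →
      (v : E) ∈ ρ₁ → (v : E) ∉ ρ₂ → (v' : E) ∉ ρ₂ → False := by
    intro v v' hv hv' hne hL hm hm2 hm2'
    have hav : (a : E) ≠ v := fun e => hv.1 (Subtype.ext e)
    have hce : (ρ₁.erase (v : E)).card = d := by
      rw [Finset.card_erase_of_mem hm, h.pure.2 _ hρ₁, Nat.add_sub_cancel]
    have hsub : ρ₁ ∩ ρ₂ = ρ₁.erase (v : E) := by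
      refine Finset.eq_of_subset_of_card_le (fun y hy => ?_) (by omega)
      rw [Finset.mem_inter] at hy
      refine Finset.mem_erase.2 ⟨?_, hy.1⟩
      rintro rfl
      exact hm2 hy.2
    have hsub2 : ρ₁.erase (v : E) ⊆ ρ₂ := hsub ▸ Finset.inter_subset_right
    let γ := ρ₁ \ {(a : E), (v : E)}
    have hpair : {(a : E), (v : E)} ⊆ ρ₁ := by simp [Finset.insert_subset_iff, ha₁, hm]
    have hγc : γ.card = d - 1 := by
      rw [Finset.card_sdiff_of_subset hpair, h.pure.2 _ hρ₁, Finset.card_pair hav]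
      omega
    have hγ : γ ∈ (linkComplex Δ {(a : E), (v : E)}).faces := by
      rw [mem_linkComplex, Finset.sdiff_union_of_subset hpair]
      refine ⟨Δ.down_closed hρ₁.1 Finset.sdiff_subset ?_, hρ₁.1, Finset.sdiff_disjoint⟩
      rw [← Finset.card_pos, hγc]
      omega
    rw [hL, mem_linkComplex] at hγ
    have hav' : (a : E) ≠ v' := fun e => hv'.1 (Subtype.ext e)
    have hfac : γ ∪ {(a : E), (v' : E)} ∈ Δ.facets := by
      refine h.mem_facets hγ.2.1 ?_
      rw [Finset.card_union_of_disjoint hγ.2.2, hγc, Finset.card_pair hav']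
      omega
    have hsub3 : ρ₁.erase (v : E) ⊆ γ ∪ {(a : E), (v' : E)} := by
      intro y hy
      rw [Finset.mem_erase] at hy
      by_cases hya : y = a
      · simp [hya]
      · exact Finset.mem_union_left _ (by simp [γ, hy.1, hy.2, hya])
    have e := h.facet_unique hce hρ₁ hfac hρ₂ (Finset.erase_subset _ _) hsub3 hsub2 ?_ ?_
    · exact hm2' (e ▸ by simp)
    · intro e
      have : (v' : E) ∈ ρ₁ := e ▸ by simp
      exact hne (Subtype.ext (hκ.eq hρ₁.1 hm this (adj_adj_color hκ hv hv')))
    · rintro rfl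
      exact hm2 hm
  rcases hQ₁ with hm | hm
  · exact key u w hu hw huw hL hm hQ₂.1 hQ₂.2
  · exact key w u hw hu huw.symm hL.symm hm hQ₂.2 hQ₂.1

/-- In dimension one the edges are facets and a vertex is a ridge, which lies in only two of them.
-/
theorem two_le_of_three_neighbors (h : IsNormalPseudomanifold d Δ)
    {a u w y : (rankSelected Δ κ {p, q}).vertices}
    (hu : (graph (rankSelected Δ κ {p, q})).Adj a u)
    (hw : (graph (rankSelected Δ κ {p, q})).Adj a w)
    (hy : (graph (rankSelected Δ κ {p, q})).Adj a y) (huw : u ≠ w) (huy : u ≠ y) (hwy : w ≠ y) :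
    2 ≤ d := by
  classical
  have hcard : ∀ {v : (rankSelected Δ κ {p, q}).vertices},
      (graph (rankSelected Δ κ {p, q})).Adj a v → ({(a : E), (v : E)} : Finset E).card = 2 :=
    fun hv => Finset.card_pair fun e => hv.1 (Subtype.ext e)
  have h1 : 1 ≤ d := by
    obtain ⟨τ, hτ, hsub⟩ := h.exists_facet (Or.inr (adj_face hu))
    have := Finset.card_le_card hsub
    rw [hcard hu, h.pure.2 τ hτ] at this
    omega
  by_contra! hd
  have hf : ∀ {v : (rankSelected Δ κ {p, q}).vertices},
      (graph (rankSelected Δ κ {p, q})).Adj a v → {(a : E), (v : E)} ∈ Δ.facets := fun hv =>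
    h.mem_facets (adj_face hv) (by rw [hcard hv]; omega)
  have hne : ∀ {v v' : (rankSelected Δ κ {p, q}).vertices},
      (graph (rankSelected Δ κ {p, q})).Adj a v → (graph (rankSelected Δ κ {p, q})).Adj a v' →
      v ≠ v' → ({(a : E), (v : E)} : Finset E) ≠ {(a : E), (v' : E)} := by
    intro v v' hv hv' hne heq
    have : (v : E) ∈ ({(a : E), (v' : E)} : Finset E) := heq ▸ by simp
    rw [Finset.mem_insert, Finset.mem_singleton] at this
    rcases this with e | e
    exacts [hv.1 (Subtype.ext e.symm), hne (Subtype.ext e)]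
  exact hne hw hy hwy (h.facet_unique (σ := {(a : E)}) (by simp; omega) (hf hu) (hf hw) (hf hy)
    (by simp) (by simp) (by simp) (hne hw hu huw.symm) (hne hy hu huy.symm))

theorem exists_two_neighbors (h : IsNormalPseudomanifold d Δ) (hκ : IsBalancedColoring Δ κ)
    (hpq : p ≠ q) (w : (rankSelected Δ κ {p, q}).vertices) :
    ∃ u u', (graph (rankSelected Δ κ {p, q})).Adj w u ∧
      (graph (rankSelected Δ κ {p, q})).Adj w u' ∧ u ≠ u' := by
  obtain ⟨τ, hτ, hwτ⟩ := h.exists_facet (Or.inr (mem_rankSelected.1 w.2).1)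
  rw [Finset.singleton_subset_iff] at hwτ
  obtain ⟨c, hc, hcw⟩ : ∃ c, (c = p ∨ c = q) ∧ c ≠ κ w := by
    rcases vertex_color w with e | e
    exacts [⟨q, Or.inr rfl, by rw [e]; exact hpq.symm⟩, ⟨p, Or.inl rfl, by rw [e]; exact hpq⟩]
  obtain ⟨u, hu, huc⟩ := h.exists_color hκ hτ c
  have hadj : (graph (rankSelected Δ κ {p, q})).Adj w
      ⟨u, mem_vertices_of_mem hτ.1 hu (huc ▸ hc)⟩ := by
    refine adj_of_mem hτ.1 hwτ hu ?_
    rintro rfl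
    exact hcw huc.symm
  obtain ⟨u', hu', hne, -⟩ := h.exists_exchange_adj hκ hadj hτ hwτ hu
  exact ⟨_, _, hadj, hu', hne.symm⟩

/-- Adjacent facets differ in at most one vertex, so they share a vertex of colour `p` or one of
colour `q`. Any two vertices of these colours in one facet are equal or adjacent. -/
theorem connected_graph (h : IsNormalPseudomanifold d Δ) (hκ : IsBalancedColoring Δ κ)
    (hpq : p ≠ q) : (graph (rankSelected Δ κ {p, q})).Connected := by
  classical
  obtain ⟨τ₀, hτ₀, -⟩ := h.exists_facet (Or.inl rfl)
  obtain ⟨v₀, hv₀, hc₀⟩ := h.exists_color hκ hτ₀ p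
  let x₀ : (rankSelected Δ κ {p, q}).vertices := ⟨v₀, mem_vertices_of_mem hτ₀.1 hv₀ (Or.inl hc₀)⟩
  have : Nonempty (rankSelected Δ κ {p, q}).vertices := ⟨x₀⟩
  have key : ∀ u v : (rankSelected Δ κ {p, q}).vertices,
      (graph (rankSelected Δ κ {p, q})).Reachable u v := by
    intro u v
    by_contra hcon
    obtain ⟨τ₁, hτ₁, h₁⟩ := h.exists_facet (Or.inr (mem_rankSelected.1 u.2).1)
    obtain ⟨τ₂, hτ₂, h₂⟩ := h.exists_facet (Or.inr (mem_rankSelected.1 v.2).1)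
    rw [Finset.singleton_subset_iff] at h₁ h₂
    have hin : ∀ τ ∈ Δ.facets, ∀ y z : (rankSelected Δ κ {p, q}).vertices, (y : E) ∈ τ →
        (z : E) ∈ τ → (graph (rankSelected Δ κ {p, q})).Reachable y z := by
      intro τ hτ y z hy hz
      rcases eq_or_ne y z with rfl | hne
      exacts [SimpleGraph.Reachable.refl _, (adj_of_mem hτ.1 hy hz hne).reachable]
    obtain ⟨ρ₁, hρ₁, ρ₂, hρ₂, -, -, ⟨y, hy, hQ₁⟩, hQ₂, hcard⟩ :=
      h.exists_adjacent_facets (σ₀ := ∅)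
        (fun τ => ∃ y : (rankSelected Δ κ {p, q}).vertices, (y : E) ∈ τ ∧
          (graph (rankSelected Δ κ {p, q})).Reachable u y) hτ₁ hτ₂ (by simp) (by simp)
        ⟨u, h₁, SimpleGraph.Reachable.refl _⟩ (by
          rintro ⟨y, hy, hr⟩
          exact hcon (hr.trans (hin τ₂ hτ₂ y v hy h₂)))
    -- If the second facet contained the vertex of colour `c` of the first, it would meet the
    -- component of `u`. So both coloured vertices are lost, too many for adjacent facets.
    have hno : ∀ c, c = p ∨ c = q → ∃ z ∈ ρ₁ \ ρ₂, κ z = c := by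
      intro c hc
      obtain ⟨z, hz, hzc⟩ := h.exists_color hκ hρ₁ c
      refine ⟨z, Finset.mem_sdiff.2 ⟨hz, fun hz' => hQ₂ ⟨⟨z, mem_vertices_of_mem hρ₁.1 hz
        (by rwa [hzc])⟩, hz', hQ₁.trans (hin ρ₁ hρ₁ _ _ hy hz)⟩⟩, hzc⟩
    obtain ⟨z, hz, hzc⟩ := hno p (Or.inl rfl)
    obtain ⟨z', hz', hzc'⟩ := hno q (Or.inr rfl)
    have hzz : z ≠ z' := by
      rintro rfl
      exact hpq (hzc.symm.trans hzc')
    have h2 : 2 ≤ (ρ₁ \ ρ₂).card := by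
      rw [← Finset.card_pair hzz]
      exact Finset.card_le_card (by simp [Finset.insert_subset_iff, hz, hz'])
    have := Finset.card_sdiff_add_card_inter ρ₁ ρ₂
    rw [h.pure.2 _ hρ₁] at this
    omega
  exact ⟨key⟩

end RankTwo

end BalancedComplex


namespace BalancedComplex

open Set PLTopology

/-! ### Flag numbers as numbers of vertices and edges of the graph. -/

section Counting

variable {E : Type*} [NormedAddCommGroup E] [NormedSpace ℝ E] {d : ℕ}
  {Δ : Geometry.SimplicialComplex ℝ E} {κ : E → Fin (d + 1)} {p q : Fin (d + 1)}

theorem finite_vertices (h : Δ.faces.Finite) {S : Finset (Fin (d + 1))} :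
    Finite (rankSelected Δ κ S).vertices := by
  have : (rankSelected Δ κ S).vertices ⊆ (fun v : E => ({v} : Finset E)) ⁻¹' Δ.faces :=
    fun v hv => hv.1
  exact ((h.preimage (Finset.singleton_injective.injOn)).subset this).to_subtype

theorem flagF_singleton (hκ : IsBalancedColoring Δ κ) (c : Fin (d + 1)) :
    flagF Δ κ {c} = {v | {v} ∈ Δ.faces ∧ κ v = c}.ncard := by
  rw [flagF]
  refine (Set.ncard_congr (fun v _ => {v}) ?_ ?_ ?_).symm
  · rintro v ⟨hv, hc⟩
    exact ⟨hv, by simp [hc]⟩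
  · intro v v' _ _ e
    exact Finset.singleton_injective e
  · rintro σ ⟨hσ, hc⟩
    obtain ⟨v, hv⟩ := Δ.nonempty_of_mem_faces hσ
    have hcol : ∀ u ∈ σ, κ u = c := fun u hu => by
      have : κ u ∈ σ.image κ := Finset.mem_image_of_mem κ hu
      rw [hc] at this
      exact Finset.mem_singleton.1 this
    have e : {v} = σ := by
      refine (Finset.eq_singleton_iff_unique_mem.2 ⟨hv, fun u hu => ?_⟩).symm
      exact hκ.eq hσ hu hv ((hcol u hu).trans (hcol v hv).symm)
    exact ⟨v, ⟨e ▸ hσ, hcol v hv⟩, e⟩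

theorem flagF_add_flagF (hfin : Δ.faces.Finite) (hκ : IsBalancedColoring Δ κ) (hpq : p ≠ q) :
    flagF Δ κ {p} + flagF Δ κ {q} = Nat.card (rankSelected Δ κ {p, q}).vertices := by
  have hf : ∀ c, {v | {v} ∈ Δ.faces ∧ κ v = c}.Finite := fun c =>
    (hfin.preimage (Finset.singleton_injective.injOn)).subset fun v hv => hv.1
  rw [flagF_singleton hκ, flagF_singleton hκ, ← Set.ncard_union_eq _ (hf p) (hf q),
    Nat.card_coe_set_eq]
  · congr 1
    ext v
    simp only [mem_union, mem_ofPred_eq, Geometry.SimplicialComplex.mem_vertices, mem_rankSelected,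
      Finset.mem_singleton, forall_eq, Finset.mem_insert]
    tauto
  · rw [Set.disjoint_left]
    rintro v ⟨-, h1⟩ ⟨-, h2⟩
    exact hpq (h1.symm.trans h2)

open Classical in
theorem flagF_pair (hκ : IsBalancedColoring Δ κ) (hpq : p ≠ q) :
    flagF Δ κ {p, q} = (graph (rankSelected Δ κ {p, q})).edgeSet.ncard := by
  rw [flagF]
  refine (Set.ncard_congr (fun e _ => (e.map Subtype.val).toFinset) ?_ ?_ ?_).symm
  · intro e
    induction e with | _ u v =>
    intro he
    rw [SimpleGraph.mem_edgeSet] at he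
    simp only [Sym2.map_mk, Sym2.toFinset_mk_eq]
    refine ⟨adj_face he, ?_⟩
    have hc := adj_color hκ he
    rw [Finset.image_insert, Finset.image_singleton]
    rcases vertex_color u with a | a <;> rcases vertex_color v with b | b <;> rw [a, b] at hc ⊢
    exacts [(hc rfl).elim, Finset.pair_comm q p, (hc rfl).elim]
  · intro e e' _ _ h
    refine Sym2.map.injective Subtype.val_injective (Sym2.ext fun v => ?_)
    rw [← Sym2.mem_toFinset, ← Sym2.mem_toFinset, h]
  · rintro σ ⟨hσ, hc⟩
    have hcol : ∀ u ∈ σ, κ u = p ∨ κ u = q := fun u hu => by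
      have : κ u ∈ σ.image κ := Finset.mem_image_of_mem κ hu
      rw [hc] at this
      simpa using this
    have hex : ∀ c, c = p ∨ c = q → ∃ u ∈ σ, κ u = c := fun c h => by
      have : c ∈ σ.image κ := by
        rw [hc]
        simpa using h
      simpa using this
    obtain ⟨u, hu, huc⟩ := hex p (Or.inl rfl)
    obtain ⟨v, hv, hvc⟩ := hex q (Or.inr rfl)
    have hne : u ≠ v := by
      rintro rfl
      exact hpq (huc.symm.trans hvc)
    refine ⟨s(⟨u, mem_vertices_of_mem hσ hu (Or.inl huc)⟩, ⟨v, mem_vertices_of_mem hσ hv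
      (Or.inr hvc)⟩), ?_, ?_⟩
    · exact adj_of_mem hσ hu hv fun e => hne (congrArg Subtype.val e)
    · simp only [Sym2.map_mk, Sym2.toFinset_mk_eq]
      ext w
      rw [Finset.mem_insert, Finset.mem_singleton]
      constructor
      · rintro (rfl | rfl)
        exacts [hu, hv]
      · intro hw
        rcases hcol w hw with e | e
        · exact Or.inl (hκ.eq hσ hw hu (e.trans huc.symm))
        · exact Or.inr (hκ.eq hσ hw hv (e.trans hvc.symm))

/-- By balancedness, simplices with colour set `{p, q}` are edges, and those with a single colour
are vertices; `Γ` is the difference of the two counts. -/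
theorem ncard_edgeSet (hfin : Δ.faces.Finite) (hκ : IsBalancedColoring Δ κ) (hpq : p ≠ q)
    (hΓ : Gam Δ κ p q = 1) : (graph (rankSelected Δ κ {p, q})).edgeSet.ncard =
      Nat.card (rankSelected Δ κ {p, q}).vertices + 1 := by
  rw [← flagF_pair hκ hpq, ← flagF_add_flagF hfin hκ hpq]
  rw [Gam] at hΓ
  omega

end Counting

end BalancedComplex


namespace BalancedComplex

/-! ### Recognition of theta graphs by edge labels. -/

section Threads

variable {V : Type*} [Fintype V] (G : SimpleGraph V) [DecidableRel G.Adj]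

/-- The vertices `x 0, …, x m` form a path whose interior vertices have degree two. -/
structure IsThread (m : ℕ) (x : ℕ → V) : Prop where
  one_le : 1 ≤ m
  adj : ∀ j < m, G.Adj (x j) (x (j + 1))
  inj : ∀ j k, j ≤ m → k ≤ m → x j = x k → j = k
  degree : ∀ j, 0 < j → j < m → G.degree (x j) = 2

variable {G}

theorem eq_or_eq_of_degree_eq_two {w u u' y : V} (h : G.degree w = 2) (hu : G.Adj w u)
    (hu' : G.Adj w u') (hne : u ≠ u') (hy : G.Adj w y) : y = u ∨ y = u' := by
  classical
  have hs : {u, u'} ⊆ G.neighborFinset w := by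
    simp [Finset.insert_subset_iff, hu, hu']
  have e := Finset.eq_of_subset_of_card_le hs (by
    rw [G.card_neighborFinset_eq_degree, h, Finset.card_pair hne])
  have : y ∈ ({u, u'} : Finset V) := e ▸ (G.mem_neighborFinset w y).2 hy
  simpa using this

theorem exists_ne_adj_of_two_le_degree {w : V} (h : 2 ≤ G.degree w) (u : V) :
    ∃ y, y ≠ u ∧ G.Adj w y := by
  rw [← G.card_neighborFinset_eq_degree] at h
  obtain ⟨y, hy, hne⟩ := Finset.exists_mem_ne (by omega : 1 < (G.neighborFinset w).card) u
  exact ⟨y, hne, (G.mem_neighborFinset w y).1 hy⟩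

variable {α : Type*} {ℓ : V → V → α}

theorem IsThread.label_eq {m : ℕ} {x : ℕ → V} (T : IsThread G m x) (hℓ : ∀ u v, ℓ u v = ℓ v u)
    (h2 : ∀ w u u', G.degree w = 2 → u ≠ u' → G.Adj w u → G.Adj w u' → ℓ w u = ℓ w u') :
    ∀ j < m, ℓ (x j) (x (j + 1)) = ℓ (x 0) (x 1) := by
  intro j
  induction j with
  | zero => intro _; rfl
  | succ j ih =>
    intro hj
    rw [← ih (by omega), hℓ (x j)]
    refine h2 _ _ _ (T.degree _ (by omega) hj) (fun e => ?_) (T.adj _ hj) (T.adj j (by omega)).symm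
    have := T.inj _ _ (by omega) (by omega) e
    omega

/-- The next vertex is new. It is not an interior vertex of the thread, whose two edges are already
used. It is not the start either: the label is constant along the thread, so two edges at the start
would carry the same label, which its degree forbids. -/
theorem IsThread.extend {m : ℕ} {x : ℕ → V} (T : IsThread G m x) (hℓ : ∀ u v, ℓ u v = ℓ v u)
    (h2 : ∀ w u u', G.degree w = 2 → u ≠ u' → G.Adj w u → G.Adj w u' → ℓ w u = ℓ w u')
    (h3 : ∀ w u u', u ≠ u' → G.Adj w u → G.Adj w u' → ℓ w u = ℓ w u' → G.degree w ≤ 2)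
    (ha : 3 ≤ G.degree (x 0)) (hm : G.degree (x m) = 2) :
    ∃ x', IsThread G (m + 1) x' ∧ x' 0 = x 0 ∧ x' 1 = x 1 := by
  obtain ⟨k, rfl⟩ := Nat.exists_eq_add_of_le' T.one_le
  obtain ⟨w, hw, hadj⟩ := exists_ne_adj_of_two_le_degree hm.ge (x k)
  have hprev := (T.adj k (Nat.lt_succ_self k)).symm
  have hnew : ∀ j ≤ k + 1, x j ≠ w := by
    rintro j hj rfl
    have hjk : j ≠ k := fun e => hw (e ▸ rfl)
    have hjm : j ≠ k + 1 := by
      rintro rfl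
      exact hadj.ne rfl
    rcases Nat.eq_zero_or_pos j with rfl | h0
    · have e1 : ℓ (x 0) (x (k + 1)) = ℓ (x 0) (x 1) := by
        rw [← T.label_eq hℓ h2 k (Nat.lt_succ_self k), hℓ (x 0), hℓ (x k)]
        exact h2 _ _ _ hm hw hadj hprev
      have := h3 _ _ _ (fun e => ?_) hadj.symm (T.adj 0 (by omega)) e1
      · omega
      · have := T.inj _ _ le_rfl (by omega) e
        omega
    · obtain ⟨i, rfl⟩ := Nat.exists_eq_add_of_le' h0
      have hne : x i ≠ x (i + 1 + 1) := fun e => by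
        have := T.inj _ _ (by omega) (by omega) e
        omega
      rcases eq_or_eq_of_degree_eq_two (T.degree (i + 1) h0 (by omega)) (T.adj i (by omega)).symm
        (T.adj (i + 1) (by omega)) hne hadj.symm with e | e
      · have := T.inj _ _ le_rfl (by omega) e
        omega
      · have := T.inj _ _ le_rfl (by omega) e
        omega
  refine ⟨fun j => if j ≤ k + 1 then x j else w, ⟨by omega, ?_, ?_, ?_⟩, by simp, by simp⟩
  · intro j hj
    rcases (Nat.lt_succ_iff.1 hj).lt_or_eq with h | rfl
    · simpa [h.le, Nat.succ_le_of_lt h] using T.adj j h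
    · simpa using hadj
  · intro i j hi hj
    by_cases h1 : i ≤ k + 1 <;> by_cases h2 : j ≤ k + 1 <;> simp only [h1, h2, if_true, if_false]
    · exact T.inj i j h1 h2
    · exact fun e => (hnew i h1 e).elim
    · exact fun e => (hnew j h2 e.symm).elim
    · omega
  · intro j h0 hj
    rw [if_pos (by omega)]
    rcases (Nat.lt_succ_iff.1 hj).lt_or_eq with h | rfl
    exacts [T.degree j h0 h, hm]

/-- A thread ending at a vertex of degree two can be prolonged. As its vertices are distinct, this
cannot continue forever. -/
theorem exists_thread (hdeg : ∀ v, 2 ≤ G.degree v) (hℓ : ∀ u v, ℓ u v = ℓ v u)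
    (h2 : ∀ w u u', G.degree w = 2 → u ≠ u' → G.Adj w u → G.Adj w u' → ℓ w u = ℓ w u')
    (h3 : ∀ w u u', u ≠ u' → G.Adj w u → G.Adj w u' → ℓ w u = ℓ w u' → G.degree w ≤ 2)
    {a u : V} (ha : 3 ≤ G.degree a) (hu : G.Adj a u) :
    ∃ m x, IsThread G m x ∧ x 0 = a ∧ x 1 = u ∧ 3 ≤ G.degree (x m) := by
  by_contra! hcon
  have key : ∀ m, ∃ x, IsThread G (m + 1) x ∧ x 0 = a ∧ x 1 = u := by
    intro m
    induction m with
    | zero =>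
      refine ⟨fun j => if j = 0 then a else u, ⟨le_rfl, ?_, ?_, ?_⟩, by simp, by simp⟩
      · intro j hj
        obtain rfl : j = 0 := by omega
        simpa using hu
      · intro i j hi hj
        rcases (by omega : i = 0 ∨ i = 1) with rfl | rfl <;>
          rcases (by omega : j = 0 ∨ j = 1) with rfl | rfl <;> simp [hu.ne, hu.ne.symm]
      · intro j h0 hj
        omega
    | succ m ih =>
      obtain ⟨x, T, h0, h1⟩ := ih
      have hm := hcon _ _ T h0 h1
      obtain ⟨x', T', h0', h1'⟩ := T.extend hℓ h2 h3 (by rwa [h0])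
        (le_antisymm (by omega) (hdeg _))
      exact ⟨x', T', h0'.trans h0, h1'.trans h1⟩
  obtain ⟨x, T, -⟩ := key (Fintype.card V)
  have hinj : Function.Injective fun j : Fin (Fintype.card V + 1) => x j := fun i j e =>
    Fin.ext (T.inj _ _ (by omega) (by omega) e)
  have := Fintype.card_le_of_injective _ hinj
  simp at this

theorem exists_walk_getVert {V : Type*} {G : SimpleGraph V} (m : ℕ) {x : ℕ → V} {a b : V}
    (h0 : x 0 = a) (hm : x m = b) (h : ∀ j < m, G.Adj (x j) (x (j + 1))) :
    ∃ p : G.Walk a b, p.length = m ∧ ∀ j ≤ m, p.getVert j = x j := by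
  induction m generalizing x a with
  | zero =>
    obtain rfl : a = b := h0.symm.trans hm
    exact ⟨.nil, rfl, fun j hj => by simp [Nat.le_zero.1 hj, h0]⟩
  | succ m ih =>
    obtain ⟨p, hp, hv⟩ := ih (x := fun j => x (j + 1)) (a := x 1) rfl hm
      fun j hj => h (j + 1) (by omega)
    refine ⟨.cons (h0 ▸ h 0 (Nat.succ_pos m)) p, by simp [hp], fun j hj => ?_⟩
    rcases j with _ | j
    · simp [h0]
    · simpa using hv j (by omega)

/-- A connected graph without vertices of degree one that has one edge more than it has vertices is
a theta graph, provided that its edges carry labels, equal ones on the two edges at a vertex of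
degree two, and different ones on the edges at a vertex of higher degree. -/
theorem exists_isTheta (hconn : G.Connected) (hdeg : ∀ v, 2 ≤ G.degree v)
    (hE : G.edgeSet.ncard = Fintype.card V + 1) (hℓ : ∀ u v, ℓ u v = ℓ v u)
    (h2 : ∀ w u u', G.degree w = 2 → u ≠ u' → G.Adj w u → G.Adj w u' → ℓ w u = ℓ w u')
    (h3 : ∀ w u u', u ≠ u' → G.Adj w u → G.Adj w u' → ℓ w u = ℓ w u' → G.degree w ≤ 2) :
    ∃ (a b : V) (P : Fin 3 → G.Path a b), IsTheta G a b P := by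
  classical
  -- The degrees add up to twice the number of edges, which is twice the number of vertices plus
  -- two.
  have hsum : ∑ v, (G.degree v - 2) = 2 := by
    have e1 := G.sum_degrees_eq_twice_card_edges
    have e2 : ∑ v, (G.degree v - 2) + ∑ _v : V, 2 = ∑ v, G.degree v := by
      rw [← Finset.sum_add_distrib]
      exact Finset.sum_congr rfl fun v _ => by have := hdeg v; omega
    rw [← SimpleGraph.coe_edgeFinset, Set.ncard_coe_finset] at hE
    rw [Finset.sum_const, Finset.card_univ, smul_eq_mul] at e2
    omega
  obtain ⟨a, -, ha⟩ : ∃ a ∈ Finset.univ, G.degree a - 2 ≠ 0 :=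
    Finset.exists_ne_zero_of_sum_ne_zero (by rw [hsum]; norm_num)
  have ha3 : 3 ≤ G.degree a := by omega
  have hthread := fun u (hu : G.Adj a u) => exists_thread hdeg hℓ h2 h3 ha3 hu
  obtain ⟨u₀, -, hu₀⟩ := exists_ne_adj_of_two_le_degree (hdeg a) a
  obtain ⟨m₀, x₀, T₀, h00, -, hb⟩ := hthread u₀ hu₀
  obtain ⟨b, hbdef⟩ : ∃ b, b = x₀ m₀ := ⟨_, rfl⟩
  rw [← hbdef] at hb
  have hend : ∀ m x, IsThread G m x → x 0 = a → x m ≠ a := by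
    intro m x T h0 e
    have := T.inj _ _ le_rfl (Nat.zero_le m) (e.trans h0.symm)
    have := T.one_le
    omega
  have hba : b ≠ a := hbdef ▸ hend _ _ T₀ h00
  -- The thread from `a` ends at another vertex of degree at least three, so the total excess `2` is
  -- shared equally; all other vertices have degree two.
  have hdega : G.degree a = 3 ∧ G.degree b = 3 := by
    have h := Finset.sum_le_sum_of_subset (f := fun v => G.degree v - 2)
      (Finset.subset_univ {a, b})
    rw [hsum, Finset.sum_pair hba.symm] at h
    omega
  have hother : ∀ v, v ≠ a → v ≠ b → G.degree v = 2 := by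
    intro v hva hvb
    have h := Finset.sum_le_sum_of_subset (f := fun v => G.degree v - 2)
      (Finset.subset_univ {v, a, b})
    rw [hsum, Finset.sum_insert (by simp [hva, hvb]), Finset.sum_pair hba.symm] at h
    have := hdeg v
    omega
  have hcard : (G.neighborFinset a).card = 3 := by
    rw [G.card_neighborFinset_eq_degree, hdega.1]
  let e := (G.neighborFinset a).equivFinOfCardEq hcard
  let u : Fin 3 → V := fun i => e.symm i
  have hu : ∀ i, G.Adj a (u i) := fun i => (G.mem_neighborFinset a _).1 (e.symm i).2
  have huinj : Function.Injective u := Subtype.val_injective.comp e.symm.injective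
  have husurj : ∀ y, G.Adj a y → ∃ i, u i = y := fun y hy =>
    ⟨e ⟨y, (G.mem_neighborFinset a y).2 hy⟩, by simp [u]⟩
  choose m x T hx0 hx1 hxm using fun i => hthread (u i) (hu i)
  have hxb : ∀ i, x i (m i) = b := by
    intro i
    by_contra hne
    have := hother _ (hend _ _ (T i) (hx0 i)) hne
    have := hxm i
    omega
  have hpos : ∀ i, 1 ≤ m i := fun i => (T i).one_le
  -- Descent on `s`: at a common interior vertex of degree two, the predecessor on one thread is a
  -- neighbour on the other. Going back, one arrives at `a`, where the two threads leave by
  -- different edges.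
  have hdisj : ∀ i i', i ≠ i' → ∀ s t, 0 < s → s < m i → 0 < t → t < m i' → x i s ≠ x i' t := by
    intro i i' hii s
    induction s with
    | zero =>
      intro t h0
      omega
    | succ s ih =>
      intro t _ hs ht0 ht e
      obtain ⟨t, rfl⟩ := Nat.exists_eq_add_of_le' ht0
      have hd := (T i').degree _ ht0 ht
      have hadj := ((T i).adj s (by omega)).symm
      rw [e] at hadj
      rcases eq_or_eq_of_degree_eq_two hd ((T i').adj t (by omega)).symm ((T i').adj (t + 1) ht)
        (fun e' => by have := (T i').inj _ _ (by omega) (by omega) e'; omega) hadj with h | h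
      · rcases Nat.eq_zero_or_pos t with rfl | h1
        · rw [hx0 i', ← hx0 i] at h
          obtain rfl := (T i).inj _ _ (by omega) (by omega) h
          rw [zero_add, hx1, hx1] at e
          exact hii (huinj e)
        · rcases Nat.eq_zero_or_pos s with rfl | h2
          · rw [hx0 i, ← hx0 i'] at h
            have := (T i').inj _ _ (by omega) (by omega) h
            omega
          · exact ih t h2 (by omega) h1 (by omega) h
      · rcases Nat.eq_zero_or_pos s with rfl | h2
        · rw [hx0 i, ← hx0 i'] at h
          have := (T i').inj _ _ (by omega) (by omega) h
          omega
        · rcases (Nat.succ_le_of_lt ht).lt_or_eq with h1 | h1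
          · exact ih (t + 1 + 1) h2 (by omega) (by omega) h1 h
          · rw [Nat.succ_eq_add_one] at h1
            rw [h1, hxb i', ← hxb i] at h
            have := (T i).inj _ _ (by omega) (by omega) h
            omega
  -- The three last edges are distinct and therefore exhaust the edges at `b`.
  have hpen : Function.Injective fun i => x i (m i - 1) := by
    intro i i' h
    have h : x i (m i - 1) = x i' (m i' - 1) := h
    by_contra hne
    have hp := hpos i
    have hp' := hpos i'
    by_cases h1 : m i = 1
    · have h1' : m i' = 1 := by
        rw [h1, Nat.sub_self, hx0 i, ← hx0 i'] at h
        have := (T i').inj _ _ (by omega) (by omega) h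
        omega
      refine hne (huinj ?_)
      have e1 := hxb i
      have e2 := hxb i'
      rw [h1, hx1] at e1
      rw [h1', hx1] at e2
      exact e1.trans e2.symm
    · by_cases h1' : m i' = 1
      · rw [h1', Nat.sub_self, hx0 i', ← hx0 i] at h
        have := (T i).inj _ _ (by omega) (by omega) h
        omega
      · exact hdisj i i' hne _ _ (by omega) (by omega) (by omega) (by omega) h
  -- Every edge at a thread vertex belongs to a thread. By connectedness the threads then cover the
  -- graph.
  have hnbr : ∀ i, ∀ j ≤ m i, ∀ y, G.Adj (x i j) y →
      ∃ i', ∃ l < m i', s(x i j, y) = s(x i' l, x i' (l + 1)) := by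
    intro i j hj y hy
    rcases Nat.eq_zero_or_pos j with rfl | h0
    · rw [hx0] at hy ⊢
      obtain ⟨i', rfl⟩ := husurj y hy
      exact ⟨i', 0, hpos i', by rw [hx0, zero_add, hx1]⟩
    · rcases hj.lt_or_eq with hj | rfl
      · obtain ⟨j, rfl⟩ := Nat.exists_eq_add_of_le' h0
        rcases eq_or_eq_of_degree_eq_two ((T i).degree _ h0 hj) ((T i).adj j (by omega)).symm
          ((T i).adj (j + 1) hj)
          (fun e' => by have := (T i).inj _ _ (by omega) (by omega) e'; omega) hy with rfl | rfl
        · exact ⟨i, j, by omega, Sym2.eq_swap⟩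
        · exact ⟨i, j + 1, hj, rfl⟩
      · rw [hxb] at hy ⊢
        have hsub : Finset.univ.image (fun i => x i (m i - 1)) ⊆ G.neighborFinset b := by
          intro v hv
          obtain ⟨i, -, rfl⟩ := Finset.mem_image.1 hv
          rw [G.mem_neighborFinset, ← hxb i]
          have := (T i).adj (m i - 1) (by have := hpos i; omega)
          rw [Nat.sub_add_cancel (hpos i)] at this
          exact this.symm
        have heq := Finset.eq_of_subset_of_card_le hsub (by
          rw [Finset.card_image_of_injective _ hpen, G.card_neighborFinset_eq_degree, hdega.2]
          simp)
        have hy' : y ∈ Finset.univ.image (fun i => x i (m i - 1)) :=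
          heq ▸ (G.mem_neighborFinset b y).2 hy
        obtain ⟨i', -, rfl⟩ := Finset.mem_image.1 hy'
        refine ⟨i', m i' - 1, by have := hpos i'; omega, ?_⟩
        rw [Nat.sub_add_cancel (hpos i'), hxb]
        exact Sym2.eq_swap
  have hcov : ∀ v, ∃ i, ∃ j ≤ m i, x i j = v := by
    intro v
    have hr := (SimpleGraph.reachable_iff_reflTransGen a v).1 (hconn.preconnected a v)
    induction hr with
    | refl => exact ⟨0, 0, Nat.zero_le _, hx0 0⟩
    | tail _ hadj ih =>
      obtain ⟨i, j, hj, rfl⟩ := ih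
      obtain ⟨i', l, hl, e⟩ := hnbr i j hj _ hadj
      rcases Sym2.eq_iff.1 e with h | h
      · exact ⟨i', l + 1, hl, h.2.symm⟩
      · exact ⟨i', l, hl.le, h.2.symm⟩
  choose P hPl hPv using fun i => exists_walk_getVert (m i) (hx0 i) (hxb i) (T i).adj
  have hPath : ∀ i, (P i).IsPath := by
    intro i
    rw [← SimpleGraph.Walk.IsPath.getVert_injOn_iff]
    intro j hj k hk e
    have hj : j ≤ m i := hPl i ▸ hj
    have hk : k ≤ m i := hPl i ▸ hk
    rw [hPv i j hj, hPv i k hk] at e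
    exact (T i).inj j k hj hk e
  have hsupp : ∀ i v, v ∈ (P i).support ↔ ∃ j ≤ m i, x i j = v := by
    intro i v
    rw [SimpleGraph.Walk.mem_support_iff_exists_getVert]
    constructor
    · rintro ⟨j, rfl, hj⟩
      rw [hPl] at hj
      exact ⟨j, hj, (hPv i j hj).symm⟩
    · rintro ⟨j, hj, rfl⟩
      exact ⟨j, hPv i j hj, hPl i ▸ hj⟩
  refine ⟨a, b, fun i => ⟨P i, hPath i⟩, hba.symm, ?_, ?_, ?_, ?_⟩
  · intro i i' h
    have h : P i = P i' := congrArg Subtype.val h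
    have e1 := hPv i 1 (hpos i)
    rw [h, hPv i' 1 (hpos i'), hx1, hx1] at e1
    exact (huinj e1).symm
  · intro i i' hne v hv hv'
    obtain ⟨j, hj, rfl⟩ := (hsupp i v).1 hv
    obtain ⟨j', hj', e⟩ := (hsupp i' _).1 hv'
    by_contra! hcon
    have h1 : j ≠ 0 := fun h => hcon.1 (by rw [h, hx0])
    have h2 : j ≠ m i := fun h => hcon.2 (by rw [h, hxb])
    have h3 : j' ≠ 0 := fun h => hcon.1 (by rw [← e, h, hx0])
    have h4 : j' ≠ m i' := fun h => hcon.2 (by rw [← e, h, hxb])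
    exact hdisj i i' hne j j' (by omega) (by omega) (by omega) (by omega) e.symm
  · intro v
    obtain ⟨i, h⟩ := hcov v
    exact ⟨i, (hsupp i v).2 h⟩
  · intro e
    induction e with | _ v y =>
    intro he
    obtain ⟨i, j, hj, rfl⟩ := hcov v
    obtain ⟨i', l, hl, h⟩ := hnbr i j hj y he
    refine ⟨i', (SimpleGraph.Walk.mem_edges_iff_getVert _ _).2 ⟨l, hPl i' ▸ hl, ?_⟩⟩
    rw [h, hPv i' l hl.le, hPv i' (l + 1) hl]

end Threads

end BalancedComplex


namespace BalancedComplex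

open Set PLTopology

/-! ### Theta graphs and their vertices. -/

namespace IsTheta

variable {V : Type*} {G : SimpleGraph V} {a b : V} {P : Fin 3 → G.Path a b}

theorem one_le_length (h : IsTheta G a b P) (i : Fin 3) : 1 ≤ (P i).1.length := by
  by_contra! h0
  exact h.ne (SimpleGraph.Walk.eq_of_length_eq_zero (p := (P i).1) (by omega))

theorem getVert_inj (i : Fin 3) {j j' : ℕ} (hj : j ≤ (P i).1.length)
    (hj' : j' ≤ (P i).1.length) (e : (P i).1.getVert j = (P i).1.getVert j') : j = j' :=
  (P i).2.getVert_injOn hj hj' e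

theorem getVert_eq (h : IsTheta G a b P) {i i' : Fin 3} {j j' : ℕ} (hj : j ≤ (P i).1.length)
    (hj' : j' ≤ (P i').1.length) (e : (P i).1.getVert j = (P i').1.getVert j') :
    (i = i' ∧ j = j') ∨ (j = 0 ∧ j' = 0) ∨ (j = (P i).1.length ∧ j' = (P i').1.length) := by
  by_cases hi : i = i'
  · subst hi
    exact Or.inl ⟨rfl, getVert_inj i hj hj' e⟩
  · rcases h.inter i i' hi _ ((P i).1.getVert_mem_support j)
      (e ▸ (P i').1.getVert_mem_support j') with h0 | h0
    · refine Or.inr (Or.inl ⟨getVert_inj i hj (Nat.zero_le _) ?_,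
        getVert_inj i' hj' (Nat.zero_le _) ?_⟩)
      · rw [h0, SimpleGraph.Walk.getVert_zero]
      · rw [← e, h0, SimpleGraph.Walk.getVert_zero]
    · refine Or.inr (Or.inr ⟨getVert_inj i hj le_rfl ?_, getVert_inj i' hj' le_rfl ?_⟩)
      · rw [h0, SimpleGraph.Walk.getVert_length]
      · rw [← e, h0, SimpleGraph.Walk.getVert_length]

theorem eq_of_length_eq_one (h : IsTheta G a b P) {i i' : Fin 3} (h1 : (P i).1.length = 1)
    (h1' : (P i').1.length = 1) : i = i' := by
  refine h.injective (Subtype.ext ?_)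
  refine SimpleGraph.Walk.ext_getVert_le_length (h1.trans h1'.symm) fun k hk => ?_
  rcases (by omega : k = 0 ∨ k = 1) with rfl | rfl
  · simp
  · have e := (P i).1.getVert_length
    have e' := (P i').1.getVert_length
    rw [h1] at e
    rw [h1'] at e'
    exact e.trans e'.symm

theorem snd_injective (h : IsTheta G a b P) : Function.Injective fun i => (P i).1.getVert 1 := by
  intro i i' e
  rcases h.getVert_eq (h.one_le_length i) (h.one_le_length i') e with e | e | e
  · exact e.1
  · omega
  · exact h.eq_of_length_eq_one e.1.symm e.2.symm

theorem adj_getVert (i : Fin 3) {j : ℕ} (hj : j < (P i).1.length) :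
    G.Adj ((P i).1.getVert j) ((P i).1.getVert (j + 1)) :=
  (P i).1.adj_getVert_succ hj

theorem adj_snd (h : IsTheta G a b P) (i : Fin 3) : G.Adj a ((P i).1.getVert 1) := by
  simpa using adj_getVert i (h.one_le_length i)

theorem exists_edge (h : IsTheta G a b P) {v y : V} (hy : G.Adj v y) :
    ∃ i, ∃ j < (P i).1.length, (v = (P i).1.getVert j ∧ y = (P i).1.getVert (j + 1)) ∨
      (v = (P i).1.getVert (j + 1) ∧ y = (P i).1.getVert j) := by
  obtain ⟨i, hi⟩ := h.edges s(v, y) hy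
  obtain ⟨j, hj, e⟩ := (SimpleGraph.Walk.mem_edges_iff_getVert _ _).1 hi
  exact ⟨i, j, hj, Sym2.eq_iff.1 e⟩

theorem exists_eq_snd (h : IsTheta G a b P) {y : V} (hy : G.Adj a y) :
    ∃ i, y = (P i).1.getVert 1 := by
  obtain ⟨i, j, hj, ⟨e, e'⟩ | ⟨e, e'⟩⟩ := h.exists_edge hy
  · obtain rfl : 0 = j := getVert_inj i (Nat.zero_le _) hj.le (by simpa using e)
    exact ⟨i, e'⟩
  · have : 0 = j + 1 := getVert_inj i (Nat.zero_le _) hj (by simpa using e)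
    omega

theorem eq_or_eq_of_adj (h : IsTheta G a b P) {i : Fin 3} {j : ℕ} (hj : j + 1 < (P i).1.length)
    {y : V} (hy : G.Adj ((P i).1.getVert (j + 1)) y) :
    y = (P i).1.getVert j ∨ y = (P i).1.getVert (j + 1 + 1) := by
  obtain ⟨i', k, hk, ⟨e, e'⟩ | ⟨e, e'⟩⟩ := h.exists_edge hy
  · rcases h.getVert_eq hj.le hk.le e with ⟨rfl, rfl⟩ | e | e
    · exact Or.inr e'
    · omega
    · omega
  · rcases h.getVert_eq hj.le hk e with ⟨rfl, e⟩ | e | e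
    · obtain rfl : j = k := by omega
      exact Or.inl e'
    · omega
    · omega

end IsTheta

/-! ### The arc system of a theta graph in a balanced pseudomanifold. -/

section ThetaComplex

variable {E : Type*} [NormedAddCommGroup E] [NormedSpace ℝ E] {d : ℕ}
  {Δ : Geometry.SimplicialComplex ℝ E} {κ : E → Fin (d + 1)} {p q : Fin (d + 1)}
  {a b : (rankSelected Δ κ {p, q}).vertices}
  {P : Fin 3 → (graph (rankSelected Δ κ {p, q})).Path a b}

theorem IsTheta.two_le (hP : IsTheta (graph (rankSelected Δ κ {p, q})) a b P)
    (h : IsNormalPseudomanifold d Δ) : 2 ≤ d :=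
  two_le_of_three_neighbors h (hP.adj_snd 0) (hP.adj_snd 1) (hP.adj_snd 2)
    (hP.snd_injective.ne (by decide)) (hP.snd_injective.ne (by decide))
    (hP.snd_injective.ne (by decide))

open Classical in
theorem IsTheta.link_eq (hP : IsTheta (graph (rankSelected Δ κ {p, q})) a b P)
    (h : IsNormalPseudomanifold d Δ) (hκ : IsBalancedColoring Δ κ) (i : Fin 3) {j : ℕ}
    (hj : j < (P i).1.length) :
    linkComplex Δ {((P i).1.getVert j : E), ((P i).1.getVert (j + 1) : E)} = branchLink Δ P i := by
  induction j with
  | zero =>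
    rw [SimpleGraph.Walk.getVert_zero]
    rfl
  | succ j ih =>
    rw [← ih (by omega), Finset.pair_comm ((P i).1.getVert j : E)]
    exact link_eq_of_two_neighbors h hκ (IsTheta.adj_getVert i hj)
      (IsTheta.adj_getVert i (by omega)).symm fun y hy => (hP.eq_or_eq_of_adj hj hy).symm

-- The arcs carry the colours `p` and `q`, and the links of their edges carry the remaining colours.
-- Every facet has one vertex of each of the two colours, hence contains an edge of an arc and is
-- its join with a simplex of the link.
open Classical in
theorem IsTheta.arcSystem (hP : IsTheta (graph (rankSelected Δ κ {p, q})) a b P)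
    (h : IsNormalPseudomanifold d Δ) (hκ : IsBalancedColoring Δ κ) (hpq : p ≠ q) :
    ArcSystem Δ (fun v => κ v = p ∨ κ v = q) (pathLength P) (pathVertex P) (branchLink Δ P) := by
  have hd := hP.two_le h
  have hsdiff : ∀ {τ : Finset E} {u v : (rankSelected Δ κ {p, q}).vertices}, τ ∈ Δ.facets →
      (graph (rankSelected Δ κ {p, q})).Adj u v → (u : E) ∈ τ → (v : E) ∈ τ →
      τ \ {(u : E), (v : E)} ∈ (linkComplex Δ {(u : E), (v : E)}).faces ∧
        {(u : E), (v : E)} ∪ τ \ {(u : E), (v : E)} = τ := by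
    intro τ u v hτ huv hu hv
    have hpair : {(u : E), (v : E)} ⊆ τ := by simp [Finset.insert_subset_iff, hu, hv]
    refine ⟨?_, Finset.union_sdiff_of_subset hpair⟩
    rw [mem_linkComplex, Finset.sdiff_union_of_subset hpair]
    refine ⟨Δ.down_closed hτ.1 Finset.sdiff_subset ?_, hτ.1, Finset.sdiff_disjoint⟩
    rw [← Finset.card_pos, Finset.card_sdiff_of_subset hpair, h.pure.2 τ hτ,
      Finset.card_pair fun e => huv.1 (Subtype.ext e)]
    omega
  have hedge : ∀ i, ∃ τ ∈ Δ.facets, (a : E) ∈ τ ∧ ((P i).1.getVert 1 : E) ∈ τ := by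
    intro i
    obtain ⟨τ, hτ, hsub⟩ := h.exists_facet (Or.inr (adj_face (hP.adj_snd i)))
    rw [Finset.insert_subset_iff, Finset.singleton_subset_iff] at hsub
    exact ⟨τ, hτ, hsub⟩
  refine
    { finite := h.finite
      pos := hP.one_le_length
      start := fun i i' => by rw [pathVertex_zero, pathVertex_zero]
      finish := fun i i' => by rw [pathVertex_length, pathVertex_length]
      inj := fun i i' j j' hj hj' e => hP.getVert_eq hj hj' (Subtype.ext e)
      long := fun i i' e e' => hP.eq_of_length_eq_one e e'
      mem_S := fun i j _ => vertex_color _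
      notMem_S := ?_
      link := fun i j hj => hP.link_eq h hκ i hj
      nonempty := ?_
      cover := ?_
      meet := ?_ }
  -- A link vertex of colour `p` or `q` would be adjacent to both ends of the edge, although these
  -- already have the two colours.
  · intro i σ hσ v hv hS
    obtain ⟨-, hface, hdisj⟩ := mem_linkComplex.1 hσ
    rw [Finset.disjoint_left] at hdisj
    have hv' : v ∈ (rankSelected Δ κ {p, q}).vertices :=
      mem_vertices_of_mem hface (Finset.mem_union_left _ hv) hS
    have hva : (⟨v, hv'⟩ : (rankSelected Δ κ {p, q}).vertices) ≠ a := by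
      rintro rfl
      exact hdisj hv (by simp)
    have hvu : (⟨v, hv'⟩ : (rankSelected Δ κ {p, q}).vertices) ≠ (P i).1.snd := by
      intro e
      exact hdisj hv (by simp [← e])
    have hadj := adj_of_mem (u := a) (v := ⟨v, hv'⟩) hface (by simp) (Finset.mem_union_left _ hv)
      hva.symm
    exact adj_color hκ (adj_of_mem (u := ⟨v, hv'⟩) (v := (P i).1.snd) hface
      (Finset.mem_union_left _ hv) (by simp) hvu) (adj_adj_color hκ hadj (hP.adj_snd i))
  · intro i
    obtain ⟨τ, hτ, ha, hu⟩ := hedge i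
    exact ⟨_, (hsdiff hτ (hP.adj_snd i) ha hu).1⟩
  · intro σ hσ
    obtain ⟨τ, hτ, hστ⟩ := h.exists_facet (Or.inr hσ)
    obtain ⟨u, hu, huc⟩ := h.exists_color hκ hτ p
    obtain ⟨v, hv, hvc⟩ := h.exists_color hκ hτ q
    have hadj := adj_of_mem (u := ⟨u, mem_vertices_of_mem hτ.1 hu (Or.inl huc)⟩)
      (v := ⟨v, mem_vertices_of_mem hτ.1 hv (Or.inr hvc)⟩) hτ.1 hu hv (by
        intro e
        exact hpq (huc.symm.trans ((congrArg (fun w => κ w.1) e).trans hvc)))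
    obtain ⟨i, j, hj, ⟨e, e'⟩ | ⟨e, e'⟩⟩ := hP.exists_edge hadj
    · have := hsdiff (u := (P i).1.getVert j) (v := (P i).1.getVert (j + 1)) hτ
        (IsTheta.adj_getVert i hj) (e ▸ hu) (e' ▸ hv)
      rw [hP.link_eq h hκ i hj] at this
      exact ⟨i, j, hj, _, this.1, hστ.trans this.2.ge⟩
    · have := hsdiff (u := (P i).1.getVert j) (v := (P i).1.getVert (j + 1)) hτ
        (IsTheta.adj_getVert i hj) (e' ▸ hv) (e ▸ hu)
      rw [hP.link_eq h hκ i hj] at this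
      exact ⟨i, j, hj, _, this.1, hστ.trans this.2.ge⟩
  -- Exchanging the second vertex of path `i` in a facet at `a` leads to the second vertex of
  -- another path. What the two facets have in common besides `a` lies in both links.
  · intro i
    obtain ⟨τ, hτ, ha, hu⟩ := hedge i
    obtain ⟨y, hy, hne, hf⟩ := h.exists_exchange_adj hκ (hP.adj_snd i) hτ ha hu
    obtain ⟨k, rfl⟩ := hP.exists_eq_snd hy
    have hau : (a : E) ≠ (P i).1.getVert 1 := fun e => (hP.adj_snd i).1 (Subtype.ext e)
    have hyτ : ((P k).1.getVert 1 : E) ∉ τ := fun hm =>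
      hne (Subtype.ext (hκ.eq hτ.1 hm hu (adj_adj_color hκ hy (hP.adj_snd i))))
    refine ⟨k, fun e => hne (e ▸ rfl), _, (hsdiff hτ (hP.adj_snd i) ha hu).1, ?_⟩
    have := (hsdiff hf hy (Finset.mem_insert_of_mem (Finset.mem_erase.2 ⟨hau, ha⟩))
      (Finset.mem_insert_self _ _)).1
    have e : insert ((P k).1.getVert 1 : E) (τ.erase ((P i).1.getVert 1 : E)) \
        {(a : E), ((P k).1.getVert 1 : E)} = τ \ {(a : E), ((P i).1.getVert 1 : E)} := by
      ext w
      simp only [Finset.mem_sdiff, Finset.mem_insert, Finset.mem_erase, Finset.mem_singleton]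
      constructor
      · rintro ⟨h1 | h1, h2⟩
        · exact (h2 (Or.inr h1)).elim
        · exact ⟨h1.2, fun h3 => h3.elim (fun h3 => h2 (Or.inl h3)) h1.1⟩
      · rintro ⟨h1, h2⟩
        refine ⟨Or.inr ⟨fun h3 => h2 (Or.inr h3), h1⟩, ?_⟩
        rintro (h3 | h3)
        · exact h2 (Or.inl h3)
        · exact hyτ (h3 ▸ h1)
    rw [e] at this
    exact this

/-- Two first edges at `a` with the same link would leave no room for the third. -/
theorem IsTheta.branchLink_injective (hP : IsTheta (graph (rankSelected Δ κ {p, q})) a b P)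
    (h : IsNormalPseudomanifold d Δ) (hκ : IsBalancedColoring Δ κ) :
    Function.Injective (branchLink Δ P) := by
  intro i i' e
  by_contra hne
  obtain ⟨k, hk, hk'⟩ : ∃ k, k ≠ i ∧ k ≠ i' := by
    have : ∀ i i' : Fin 3, ∃ k, k ≠ i ∧ k ≠ i' := by decide
    exact this i i'
  rcases eq_or_eq_of_link_eq h (hP.two_le h) hκ (hP.adj_snd i) (hP.adj_snd i')
    (hP.snd_injective.ne hne) e (hP.adj_snd k) with e | e
  · exact hk (hP.snd_injective e)
  · exact hk' (hP.snd_injective e)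

open Classical in
/-- A rank-two subcomplex with `Γ = 1` is a theta graph. -/
theorem exists_isTheta_rankSelected (h : IsNormalPseudomanifold d Δ)
    (hκ : IsBalancedColoring Δ κ) (hpq : p ≠ q) (hΓ : Gam Δ κ p q = 1) :
    ∃ (a b : (rankSelected Δ κ {p, q}).vertices)
      (P : Fin 3 → (graph (rankSelected Δ κ {p, q})).Path a b),
      IsTheta (graph (rankSelected Δ κ {p, q})) a b P := by
  have := finite_vertices (κ := κ) (S := {p, q}) h.finite
  have := Fintype.ofFinite (rankSelected Δ κ {p, q}).vertices
  have hE := ncard_edgeSet h.finite hκ hpq hΓ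
  rw [Nat.card_eq_fintype_card] at hE
  -- Edges are labelled by their links.
  refine exists_isTheta (ℓ := fun u v => linkComplex Δ {(u : E), (v : E)})
    (connected_graph h hκ hpq) ?_ hE (fun u v => ?_) ?_ ?_
  · intro w
    obtain ⟨u, u', hu, hu', hne⟩ := exists_two_neighbors h hκ hpq w
    rw [← SimpleGraph.card_neighborFinset_eq_degree, ← Finset.card_pair hne]
    exact Finset.card_le_card (by simp [Finset.insert_subset_iff, hu, hu'])
  · simp only [Finset.pair_comm]
  · intro w u u' hw hne hu hu'
    exact link_eq_of_two_neighbors h hκ hu hu'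
      fun y hy => eq_or_eq_of_degree_eq_two hw hu hu' hne hy
  · intro w u u' hne hu hu' hL
    rw [← SimpleGraph.card_neighborFinset_eq_degree, ← Finset.card_pair hne]
    refine Finset.card_le_card fun y hy => ?_
    rw [SimpleGraph.mem_neighborFinset] at hy
    rw [Finset.mem_insert, Finset.mem_singleton]
    by_contra hcon
    push Not at hcon
    have hd := two_le_of_three_neighbors h hu hu' hy hne hcon.1.symm hcon.2.symm
    exact (eq_or_eq_of_link_eq h hd hκ hu hu' hne hL hy).elim hcon.1 hcon.2

end ThetaComplex

end BalancedComplex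


theorem lemma5p6 {E : Type*} [NormedAddCommGroup E] [NormedSpace ℝ E] [FiniteDimensional ℝ E]
    (d : ℕ) (Δ : Geometry.SimplicialComplex ℝ E) (κ : E → Fin (d + 1))
    (hΔ : IsNormalPseudomanifold d Δ) (hκ : IsBalancedColoring Δ κ)
    (p q : Fin (d + 1)) (hpq : p ≠ q) (hΓ : Gam Δ κ p q = 1) :
    (∀ x : Δ.space, groupRank (FundamentalGroup Δ.space x) = 0) ∧
    (∃ (a b : (rankSelected Δ κ {p, q}).vertices)
      (P : Fin 3 → (graph (rankSelected Δ κ {p, q})).Path a b),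
      IsTheta (graph (rankSelected Δ κ {p, q})) a b P) ∧
    (IsPLManifold d Δ →
      IsPLSphere d Δ.space ∧
      Nonempty (Δ.space ≃ₜ Metric.sphere (0 : EuclideanSpace ℝ (Fin (d + 1))) 1) ∧
      ∀ (a b : (rankSelected Δ κ {p, q}).vertices)
        (P : Fin 3 → (graph (rankSelected Δ κ {p, q})).Path a b),
        IsTheta (graph (rankSelected Δ κ {p, q})) a b P → IsBallDecomposition Δ P d) := by
  obtain ⟨a, b, P, hP⟩ := exists_isTheta_rankSelected hΔ hκ hpq hΓ
  have A := hP.arcSystem hΔ hκ hpq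
  refine ⟨fun x => ?_, ⟨a, b, P, hP⟩, fun hM => ?_⟩
  · have := A.simplyConnectedSpace
    exact groupRank_fundamentalGroup x
  · have hS := A.isPLSphere_space hM (hP.two_le hΔ)
    -- The decomposition is claimed for every choice of ends and order of the paths, so the arc
    -- system is rebuilt for the given ones.
    exact ⟨hS, PLTopology.nonempty_homeomorph_sphere hS, fun a b P hP =>
      isBallDecomposition (hP.arcSystem hΔ hκ hpq) hM (hP.two_le hΔ)
        (hP.branchLink_injective hΔ hκ)⟩
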